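/- Fix $\eta_3\in(-2,2)$ and consider on $\mathbb R^4$ the system $$x_1'=x_2,\qquad x_2'=x_3,\qquad x_3'=x_4,\qquad x_4'=-x_1+\eta_3x_3+x_1^2,$$ with local flow $\varphi$ and first integral $H=\tfrac12x_1^2-\tfrac13x_1^3-\tfrac{\eta_3}{2}x_2^2+x_2x_4-\tfrac12x_3^2$. Let $W^u(\mathcal O)$ be the (two-dimensional, immersed) unstable manifold of the origin $\mathcal O$. Near $\mathcal O$ the local unstable manifold is a graph $x_3=a(x_1,x_2)$, $x_4=b(x_1,x_2)$; let $r>0$ be such that $a,b$ are real analytic on a neighbourhood of the closed disc of radius $r$, and suppose that the curve $D^u=\{\sigma(\theta):\theta\in(0,2\pi]\}$, where $\sigma(\theta)=(x_1,x_2,a(x_1,x_2),b(x_1,x_2))$ with $(x_1,x_2)=(r\cos\theta,r\sin\theta)$, is contained in $W^u(\mathcal O)$. Let $S=\{x_2=0\}$ and $C=S\cap\{H=0\}$. On $C$ let $$v_1=\{x_1=x_3=0\},\qquad v_2=\{x_1=\tfrac32,\ x_3=0\},$$ $$C_1=\{x_1<0,\ x_3>0\},\quad C_2=\{x_1>0,\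 x_3>0\},\quad C_3=\{x_1>0,\ x_3<0\},\quad C_4=\{x_1<0,\ x_3<0\}.$$ For a point $p\in\mathbb R^4$ let $\Pi(p)=\varphi(t,p)$, where $t>0$ is the first positive time with $\varphi(t,p)\in S$, whenever there is one; on $C$ this is the Poincaré map. Put $\Sigma^u_1=\Pi(D^u)$ and $\Sigma^u_{k+1}=\Pi(\Sigma^u_k)$ for $k\ge1$. Let $k\ge1$ and let $q=(0,0,0,q_4)\in\Sigma^u_k\cap v_1$ with $q_4>0$. Assume that 1. at $q$, $W^u(\mathcal O)$ intersects $v_1$ transversely within the three-dimensional level set $\{H=0\}$, that is, $T_qW^u(\mathcal O)+T_qv_1=T_q\{H=0\}$; 2. the orbit of $q$ meets $D^u$ in exactly one point $p$; 3. writing $q=\varphi(T,p)$ with $T>0$, one has $\varphi(t,p)\notin v_1\cup v_2$ for $0<t<T$ (before reaching $q$ the orbit is never tangent to $S$). Then every neighbourhood of $q$ contains an open neighbourhood $U$ of $q$ such that $$(\Sigma^u_k\cap U)\setminus\{q\}=\Sigma^{u,3}_k\cup\Sigma^{u,4}_k,$$ where $\Sigma^{u,3}_k\subset C_3$ and $\Sigma^{u,4}_k\subset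 C_4$ are open arcs having $q$ as an end point, $\Pi$ is defined at every point of these two arcs, and $$\Sigma^{u,1}_{k+1}:=\Pi(\Sigma^{u,4}_k)\subset\Sigma^u_{k+1}\cap C_1,\qquad \Sigma^{u,2}_{k+1}:=\Pi(\Sigma^{u,3}_k)\subset\Sigma^u_{k+1}\cap C_2$$ are open arcs, both having $q$ as an end point. (An open arc with end point $q$ is a set $c((0,1))$ with $c:[0,1]\to\mathbb R^4$ continuous and injective and $c(0)=q$.) -/

import Mathlib

open Set Filter Topology

noncomputable section

namespace Bifocus

/-- Phase space `ℝ⁴`; the coordinates `x₁, x₂, x₃, x₄` are `x 0, x 1, x 2, x 3`. -/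
abbrev E4 : Type := Fin 4 → ℝ

/-- The vector field `(x₂, x₃, x₄, -x₁ + η₃ x₃ + x₁²)`. -/
def vf (η : ℝ) (x : E4) : E4 := ![x 1, x 2, x 3, -x 0 + η * x 2 + x 0 ^ 2]

/-- The first integral. -/
def H (η : ℝ) (x : E4) : ℝ :=
  1 / 2 * x 0 ^ 2 - 1 / 3 * x 0 ^ 3 - η / 2 * x 1 ^ 2 + x 1 * x 3 - 1 / 2 * x 2 ^ 2

/-- Times (of either sign) up to which the solution starting at `x` exists. -/
def flowDomain (η : ℝ) (x : E4) : Set ℝ :=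
  {t | ∃ γ : ℝ → E4, γ 0 = x ∧ IsIntegralCurveOn γ (fun _ => vf η) (uIcc 0 t)}

open Classical in
/-- The (local) flow `φ(t, x)`; it is meaningful for `t ∈ flowDomain η x`, where by uniqueness of
solutions the choice of the solution does not matter. -/
def flow (η : ℝ) (t : ℝ) (x : E4) : E4 :=
  if h : ∃ γ : ℝ → E4, γ 0 = x ∧ IsIntegralCurveOn γ (fun _ => vf η) (uIcc 0 t)
  then h.choose t else 0

/-- The full orbit of `x`. -/
def orbit (η : ℝ) (x : E4) : Set E4 := {y | ∃ t ∈ flowDomain η x, flow η t x = y}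

/-- The global unstable manifold of the origin. -/
def Wu (η : ℝ) : Set E4 :=
  {x | ∃ γ : ℝ → E4, γ 0 = x ∧ IsIntegralCurveOn γ (fun _ => vf η) (Iic 0) ∧
    Tendsto γ atBot (𝓝 0)}

/-- The point over `u = (x₁, x₂)` on the graph `x₃ = a (x₁, x₂)`, `x₄ = b (x₁, x₂)`. -/
def graphPt (a b : ℝ × ℝ → ℝ) (u : ℝ × ℝ) : E4 := ![u.1, u.2, a u, b u]

/-- In some neighbourhood `N` of the origin, the graph of `(a, b)` is the local unstable manifold,
i.e. the set of points whose backward orbit stays in `N` and tends to the origin. -/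
def IsLocalUnstableGraph (η : ℝ) (a b : ℝ × ℝ → ℝ) : Prop :=
  ∃ N ∈ 𝓝 (0 : E4), ∀ x ∈ N,
    (x 2 = a (x 0, x 1) ∧ x 3 = b (x 0, x 1)) ↔
      ∃ γ : ℝ → E4, γ 0 = x ∧ IsIntegralCurveOn γ (fun _ => vf η) (Iic 0) ∧
        (∀ t ≤ 0, γ t ∈ N) ∧ Tendsto γ atBot (𝓝 0)

/-- The parametrization `σ(θ)` of the closed curve `Dᵘ` over the circle of radius `r`. -/
def sigma (r : ℝ) (a b : ℝ × ℝ → ℝ) (θ : ℝ) : E4 :=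
  graphPt a b (r * Real.cos θ, r * Real.sin θ)

/-- `Dᵘ`. -/
def Du (r : ℝ) (a b : ℝ × ℝ → ℝ) : Set E4 := sigma r a b '' Ioc 0 (2 * Real.pi)

/-- `Dᵘ⁺`. -/
def DuPlus (r : ℝ) (a b : ℝ × ℝ → ℝ) : Set E4 := sigma r a b '' Ioc 0 Real.pi

/-- `Dᵘ⁻`. -/
def DuMinus (r : ℝ) (a b : ℝ × ℝ → ℝ) : Set E4 :=
  sigma r a b '' Ioc Real.pi (2 * Real.pi)

/-- The standing setting for `a`, `b` and the radius `r` of `Dᵘ`: the graph of `(a, b)` is the local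
unstable manifold of the origin, `a` and `b` are analytic on (a neighbourhood of) the closed disc of
radius `r`, and `Dᵘ` lies in the unstable manifold. -/
structure IsSetting (η r : ℝ) (a b : ℝ × ℝ → ℝ) : Prop where
  r_pos : 0 < r
  analytic_a : AnalyticOnNhd ℝ a {u | u.1 ^ 2 + u.2 ^ 2 ≤ r ^ 2}
  analytic_b : AnalyticOnNhd ℝ b {u | u.1 ^ 2 + u.2 ^ 2 ≤ r ^ 2}
  local_unstable : IsLocalUnstableGraph η a b
  Du_subset : Du r a b ⊆ Wu η

/-- The cross section `x₂ = 0`. -/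
def S : Set E4 := {x | x 1 = 0}

/-- The loop cylinder. -/
def C (η : ℝ) : Set E4 := S ∩ {x | H η x = 0}

def v₁ : Set E4 := {x | x 1 = 0 ∧ x 0 = 0 ∧ x 2 = 0}

def v₂ : Set E4 := {x | x 1 = 0 ∧ x 0 = 3 / 2 ∧ x 2 = 0}

def C₁ (η : ℝ) : Set E4 := {x ∈ C η | x 0 < 0 ∧ 0 < x 2}

def C₂ (η : ℝ) : Set E4 := {x ∈ C η | 0 < x 0 ∧ 0 < x 2}

def C₃ (η : ℝ) : Set E4 := {x ∈ C η | 0 < x 0 ∧ x 2 < 0}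

def C₄ (η : ℝ) : Set E4 := {x ∈ C η | x 0 < 0 ∧ x 2 < 0}

/-- `t > 0` is the first positive time at which the orbit of `x` meets the cross section. -/
def IsReturnTime (η : ℝ) (x : E4) (t : ℝ) : Prop :=
  0 < t ∧ t ∈ flowDomain η x ∧ flow η t x ∈ S ∧ ∀ s ∈ Ioo 0 t, flow η s x ∉ S

/-- The Poincaré map `Π` is well defined at `x`. -/
def PoincareDefined (η : ℝ) (x : E4) : Prop := ∃ t, IsReturnTime η x t

/-- The image of `A` under the Poincaré map `Π` (of the points of `A` where it is defined). -/
def poincareImage (η : ℝ) (A : Set E4) : Set E4 :=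
  {y | ∃ x ∈ A, ∃ t, IsReturnTime η x t ∧ flow η t x = y}

/-- The successive first intersections with the cross section, starting from `A`. -/
def crossings (η : ℝ) (A : Set E4) : ℕ → Set E4
  | 0 => A
  | k + 1 => poincareImage η (crossings η A k)

/-- `Σᵘ_k = Σᵘ⁺_k ∪ Σᵘ⁻_k` (for `k ≥ 1`). -/
def SigmaU (η r : ℝ) (a b : ℝ × ℝ → ℝ) (k : ℕ) : Set E4 :=
  crossings η (DuPlus r a b) k ∪ crossings η (DuMinus r a b) k

/-- `Wᵘ` and the line `v₁`, whose direction is the fourth coordinate axis, intersect transversely at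
`q` inside the three-dimensional level set `H = 0`: the sum of the tangent spaces of `Wᵘ` and of
`v₁` is the tangent space of the level set. Near `q` the immersed surface `Wᵘ` is parametrized by
transporting the local unstable manifold with the flow. -/
def TransverseToV₁At (η r : ℝ) (a b : ℝ × ℝ → ℝ) (q : E4) : Prop :=
  ∃ T : ℝ, 0 ≤ T ∧ ∃ u : ℝ × ℝ, u.1 ^ 2 + u.2 ^ 2 < r ^ 2 ∧
    T ∈ flowDomain η (graphPt a b u) ∧ flow η T (graphPt a b u) = q ∧
    LinearMap.range (fderiv ℝ (fun w => flow η T (graphPt a b w)) u).toLinearMap ⊔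
        Submodule.span ℝ {(![0, 0, 0, 1] : E4)} =
      LinearMap.ker (fderiv ℝ (H η) q).toLinearMap

/-- `A` is an open arc having `q` as an end point. -/
def IsOpenArcFrom (q : E4) (A : Set E4) : Prop :=
  ∃ c : ℝ → E4, ContinuousOn c (Icc 0 1) ∧ InjOn c (Icc 0 1) ∧ c 0 = q ∧ A = c '' Ioo 0 1

end Bifocus

end

/-! ### The local flow: uniqueness, continuity, group law, first integral, unstable manifold. -/

namespace Bifocus

noncomputable section

open Metric
open scoped NNReal

variable {η : ℝ} {x y : E4} {s t : ℝ}

/-! The local picture is a fold. At `q` one has `x₂ = 0`, `x₂' = x₃ = 0` and `x₂'' = x₄ = q₄ > 0`,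
so along every orbit near `q` the function `x₂` is strictly convex in time, with its minimum where
`x₃ = 0`. There `H = 0` reads `x₂ (x₄ - η x₂ / 2) = -x₁² (1/2 - x₁/3)`; hence the minimum is
negative unless `x₁ = 0`. A nearby orbit in `H = 0` therefore crosses `S` twice, first downwards
(`x₃ < 0`) and then upwards (`x₃ > 0`), the two crossings merging into one tangency for the orbit of
`q`. Transversality gives a curve in `Wᵘ` through `q` whose velocity has `x₁`-component 1 and
`x₃`-component 0, so that `x₁` at both crossings has the sign of the parameter `s`. The downward
crossings form a curve `l`, in `C₃` for `s > 0` and in `C₄` for `s < 0`; the upward ones form a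
curve `m` in `C₂` and `C₁`; and `Π (l s) = m s` for `s ≠ 0`. This is `exists_two_crossings`.

It remains to see that `Σᵘ_k` is exactly `l` near `q`. By `mem_crossings_succ_iff`, membership means
that the backward orbit reaches `Dᵘ` at some time `-t` with exactly `k` crossings of `S` in `(-t,
0]`. The earlier crossings of the orbit of `q` are simple by hypothesis 3, and its point on `Dᵘ` is
off `S`, so their number is locally constant (`eventually_encard_zeros_eq`): downward crossings have
the right count and upward ones exceed it by one. Conversely, let `y` near `q` be in `Σᵘ_k`.
Backward orbits in `Wᵘ` spiral around the origin because `|η| < 2`, so the count bounds `t`;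
compactness of `Dᵘ`, hypothesis 2 and the absence of periodic orbits in `Wᵘ` then force `t` to be
close to the corresponding time `T₀` of `q` (`eventually_forall_mem_Ioo`). Such a `y` lies on an
orbit through the transverse curve (`exists_eq_flow_sectionCurve`).

Both arguments need the graph of `(a, b)` to be invariant beyond the circle of radius `r`, whereas
it is the unstable manifold only near the origin. The invariance equations are analytic identities
and extend to a disc of radius `R > r` (`exists_isInvariantGraph`). -/

lemma contDiff_vf (η : ℝ) : ContDiff ℝ 1 (vf η) := by
  rw [contDiff_pi]
  intro i
  fin_cases i <;> simp only [vf] <;> simp <;> fun_prop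

lemma continuous_vf (η : ℝ) : Continuous (vf η) := (contDiff_vf η).continuous

lemma exists_lipschitzOnWith_vf (η R : ℝ) :
    ∃ K, LipschitzOnWith K (vf η) (closedBall 0 R) :=
  (contDiff_vf η).contDiffOn.exists_lipschitzOnWith one_ne_zero (convex_closedBall 0 R)
    (isCompact_closedBall 0 R)

/-- Both curves stay in one ball on the compact time interval, where the field is Lipschitz. The
field is general because the clamped field below needs the same uniqueness. -/
lemma eqOn_of_isIntegralCurveOn {v : E4 → E4}
    (hv : ∀ R, ∃ K, LipschitzOnWith K v (closedBall 0 R)) {γ₁ γ₂ : ℝ → E4}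
    (h₁ : IsIntegralCurveOn γ₁ (fun _ => v) (uIcc 0 t))
    (h₂ : IsIntegralCurveOn γ₂ (fun _ => v) (uIcc 0 t)) (h : γ₁ 0 = γ₂ 0) :
    EqOn γ₁ γ₂ (uIcc 0 t) := by
  obtain ⟨R₁, hR₁⟩ := (isCompact_uIcc.image_of_continuousOn h₁.continuousOn).isBounded.subset_closedBall 0
  obtain ⟨R₂, hR₂⟩ := (isCompact_uIcc.image_of_continuousOn h₂.continuousOn).isBounded.subset_closedBall 0
  obtain ⟨K, hK⟩ := hv (max R₁ R₂)
  have b₁ : ∀ τ ∈ uIcc 0 t, γ₁ τ ∈ closedBall (0 : E4) (max R₁ R₂) := fun τ hτ =>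
    closedBall_subset_closedBall (le_max_left _ _) (hR₁ (mem_image_of_mem _ hτ))
  have b₂ : ∀ τ ∈ uIcc 0 t, γ₂ τ ∈ closedBall (0 : E4) (max R₁ R₂) := fun τ hτ =>
    closedBall_subset_closedBall (le_max_right _ _) (hR₂ (mem_image_of_mem _ hτ))
  rcases le_total 0 t with ht | ht
  · rw [uIcc_of_le ht] at *
    have hn : ∀ τ ∈ Ico 0 t, Icc 0 t ∈ 𝓝[Ici τ] τ := fun τ hτ =>
      mem_of_superset (Icc_mem_nhdsGE hτ.2) (Icc_subset_Icc_left hτ.1)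
    exact ODE_solution_unique_of_mem_Icc_right (v := fun _ => v)
      (s := fun _ => closedBall (0 : E4) (max R₁ R₂)) (fun _ _ => hK)
      h₁.continuousOn (fun τ hτ => (h₁ τ (Ico_subset_Icc_self hτ)).mono_of_mem_nhdsWithin (hn τ hτ))
      (fun τ hτ => b₁ τ (Ico_subset_Icc_self hτ))
      h₂.continuousOn (fun τ hτ => (h₂ τ (Ico_subset_Icc_self hτ)).mono_of_mem_nhdsWithin (hn τ hτ))
      (fun τ hτ => b₂ τ (Ico_subset_Icc_self hτ)) h
  · rw [uIcc_of_ge ht] at *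
    have hn : ∀ τ ∈ Ioc t 0, Icc t 0 ∈ 𝓝[Iic τ] τ := fun τ hτ =>
      mem_of_superset (Icc_mem_nhdsLE hτ.1) (Icc_subset_Icc_right hτ.2)
    exact ODE_solution_unique_of_mem_Icc_left (v := fun _ => v)
      (s := fun _ => closedBall (0 : E4) (max R₁ R₂)) (fun _ _ => hK)
      h₁.continuousOn (fun τ hτ => (h₁ τ (Ioc_subset_Icc_self hτ)).mono_of_mem_nhdsWithin (hn τ hτ))
      (fun τ hτ => b₁ τ (Ioc_subset_Icc_self hτ))
      h₂.continuousOn (fun τ hτ => (h₂ τ (Ioc_subset_Icc_self hτ)).mono_of_mem_nhdsWithin (hn τ hτ))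
      (fun τ hτ => b₂ τ (Ioc_subset_Icc_self hτ)) h

lemma flow_eq_of_isIntegralCurveOn {γ : ℝ → E4} (h0 : γ 0 = x)
    (h : IsIntegralCurveOn γ (fun _ => vf η) (uIcc 0 t)) : flow η t x = γ t := by
  have hex : ∃ γ : ℝ → E4, γ 0 = x ∧ IsIntegralCurveOn γ (fun _ => vf η) (uIcc 0 t) := ⟨γ, h0, h⟩
  rw [flow, dif_pos hex]
  exact eqOn_of_isIntegralCurveOn (exists_lipschitzOnWith_vf η) hex.choose_spec.2 h
    (hex.choose_spec.1.trans h0.symm) right_mem_uIcc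

lemma flow_eq_of_ordConnected {γ : ℝ → E4} {J : Set ℝ} (hJ : OrdConnected J) (hJ0 : 0 ∈ J)
    (h0 : γ 0 = x) (h : IsIntegralCurveOn γ (fun _ => vf η) J) (ht : t ∈ J) :
    t ∈ flowDomain η x ∧ flow η t x = γ t := by
  have := h.mono (hJ.uIcc_subset hJ0 ht)
  exact ⟨⟨γ, h0, this⟩, flow_eq_of_isIntegralCurveOn h0 this⟩

lemma flowDomain_subset (ht : t ∈ flowDomain η x) : uIcc 0 t ⊆ flowDomain η x := by
  obtain ⟨γ, h0, h⟩ := ht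
  exact fun s hs => ⟨γ, h0, h.mono (uIcc_subset_uIcc_left hs)⟩

lemma zero_mem_flowDomain (η : ℝ) (x : E4) : 0 ∈ flowDomain η x :=
  ⟨fun s => x + s • vf η x, by simp, by
    intro t ht
    have ht : t = 0 := by simpa using ht
    subst ht
    have := ((hasDerivAt_id (0 : ℝ)).smul_const (vf η x)).const_add x
    simpa using this.hasDerivWithinAt⟩

@[simp]
lemma flow_zero (η : ℝ) (x : E4) : flow η 0 x = x := by
  obtain ⟨γ, h0, h⟩ := zero_mem_flowDomain η x
  rw [flow_eq_of_isIntegralCurveOn h0 h, h0]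

lemma isIntegralCurveOn_flow (ht : t ∈ flowDomain η x) :
    IsIntegralCurveOn (fun s => flow η s x) (fun _ => vf η) (uIcc 0 t) := by
  obtain ⟨γ, h0, h⟩ := ht
  have he : ∀ s ∈ uIcc 0 t, flow η s x = γ s := fun s hs =>
    flow_eq_of_isIntegralCurveOn h0 (h.mono (uIcc_subset_uIcc_left hs))
  intro s hs
  have := (h s hs).congr he (he s hs)
  simpa only [he s hs] using this

lemma ordConnected_flowDomain (η : ℝ) (x : E4) : OrdConnected (flowDomain η x) :=
  ordConnected_of_uIcc_subset_left (x := 0) fun _ hy => flowDomain_subset hy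

/-- The coordinatewise projection onto the cube of half side `M`. -/
def clamp (M : ℝ) (x : E4) : E4 := fun i => max (-M) (min M (x i))

lemma lipschitzWith_clamp (M : ℝ) : LipschitzWith 1 (clamp M) := by
  refine LipschitzWith.of_dist_le_mul fun x y => ?_
  rw [NNReal.coe_one, one_mul, dist_pi_le_iff dist_nonneg]
  intro i
  refine le_trans ?_ (dist_le_pi_dist x y i)
  have := (LipschitzWith.id (α := ℝ)).const_min M |>.const_max (-M) |>.dist_le_mul (x i) (y i)
  simpa [clamp] using this

lemma clamp_mem {M : ℝ} (hM : 0 ≤ M) (x : E4) : clamp M x ∈ closedBall (0 : E4) M := by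
  rw [mem_closedBall_zero_iff, pi_norm_le_iff_of_nonneg hM]
  intro i
  rw [Real.norm_eq_abs, abs_le]
  exact ⟨le_max_left _ _, max_le (by linarith) (min_le_left _ _)⟩

lemma clamp_of_norm_le {M : ℝ} (h : ‖x‖ ≤ M) : clamp M x = x := by
  funext i
  have := (norm_le_pi_norm x i).trans h
  rw [Real.norm_eq_abs, abs_le] at this
  simp [clamp, this.1, this.2]

/-- The clamped field is bounded by some `B` and globally Lipschitz, so Picard–Lindelöf works on a
time interval of any length: solutions starting in the unit ball stay in the ball of radius `B * R +
1`. -/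
lemma exists_clamped_local_flow (η : ℝ) {M : ℝ} (hM : 0 ≤ M) (x₀ : E4) {R : ℝ} (hR : 0 ≤ R) :
    ∃ α : E4 × ℝ → E4, (∀ x ∈ closedBall x₀ 1, α ⟨x, 0⟩ = x ∧
      IsIntegralCurveOn (fun t => α ⟨x, t⟩) (fun _ x => vf η (clamp M x)) (Icc (-R) R)) ∧
      ContinuousOn α (closedBall x₀ 1 ×ˢ Icc (-R) R) := by
  obtain ⟨K, hK⟩ := exists_lipschitzOnWith_vf η M
  obtain ⟨B, hB⟩ := ((isCompact_closedBall (0 : E4) M).image (continuous_vf η)).isBounded.exists_norm_le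
  have hB0 : 0 ≤ B := (norm_nonneg _).trans (hB _ (mem_image_of_mem _ (clamp_mem hM 0)))
  have := IsPicardLindelof.of_time_independent (f := fun x => vf η (clamp M x)) (tmin := -R)
    (tmax := R) (t₀ := ⟨0, by simp [hR]⟩) (x₀ := x₀) (a := ⟨B * R + 1, by positivity⟩) (r := 1)
    (L := ⟨B, hB0⟩) (K := K * 1)
    (fun x _ => hB _ (mem_image_of_mem _ (clamp_mem hM x)))
    (hK.comp (lipschitzWith_clamp M).lipschitzOnWith fun x _ => clamp_mem hM x)
    (by
      simp only [sub_zero, zero_sub, neg_neg, max_self]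
      change B * R ≤ B * R + 1 - 1
      linarith)
  exact this.exists_forall_mem_closedBall_eq_hasDerivWithinAt_continuousOn

lemma exists_lipschitzOnWith_clamped (η : ℝ) {M : ℝ} (hM : 0 ≤ M) (R : ℝ) :
    ∃ K, LipschitzOnWith K (fun x => vf η (clamp M x)) (closedBall 0 R) := by
  obtain ⟨K, hK⟩ := exists_lipschitzOnWith_vf η M
  exact ⟨_, hK.comp (lipschitzWith_clamp M).lipschitzOnWith fun x _ => clamp_mem hM x⟩

/-- The local flow is jointly continuous on its (open) domain. -/
lemma exists_continuousAt_eventually_flow (ht : t ∈ flowDomain η x) :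
    ∃ α : E4 × ℝ → E4, ContinuousAt α (x, t) ∧
      ∀ᶠ p in 𝓝 (x, t), p.2 ∈ flowDomain η p.1 ∧ flow η p.2 p.1 = α p := by
  obtain ⟨γ, h0, h⟩ := ht
  obtain ⟨M, hM⟩ := (isCompact_uIcc.image_of_continuousOn h.continuousOn).isBounded.exists_norm_le
  have hM0 : 0 ≤ M := (norm_nonneg _).trans (hM _ (mem_image_of_mem _ left_mem_uIcc))
  have hM1 : 0 ≤ M + 1 := by linarith
  obtain ⟨α, hα, hc⟩ := exists_clamped_local_flow η hM1 x (R := |t| + 1) (by positivity)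
  have hsub : ∀ s : ℝ, |s| ≤ |t| + 1 → uIcc 0 s ⊆ Icc (-(|t| + 1)) (|t| + 1) := by
    intro s hs
    rw [abs_le] at hs
    refine uIcc_subset_Icc ⟨by linarith [abs_nonneg t], by linarith [abs_nonneg t]⟩ hs
  have hγ : IsIntegralCurveOn γ (fun _ x => vf η (clamp (M + 1) x)) (uIcc 0 t) := by
    intro s hs
    have := h s hs
    rwa [← clamp_of_norm_le (M := M + 1) (x := γ s)
      ((hM _ (mem_image_of_mem _ hs)).trans (by linarith))] at this
  have hx := hα x (mem_closedBall_self zero_le_one)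
  have heq : EqOn (fun s => α (x, s)) γ (uIcc 0 t) :=
    eqOn_of_isIntegralCurveOn (exists_lipschitzOnWith_clamped η hM1)
      (hx.2.mono (hsub t (by linarith))) hγ (hx.1.trans h0.symm)
  have hcont : ∀ s ∈ uIcc 0 t, ContinuousAt α (x, s) := by
    intro s hs
    refine hc.continuousAt (prod_mem_nhds (closedBall_mem_nhds _ one_pos) ?_)
    have hs' : |s| ≤ |t| := by
      have := abs_sub_left_of_mem_uIcc hs
      simpa using this
    rw [abs_le] at hs'
    exact Icc_mem_nhds (by linarith) (by linarith)
  refine ⟨α, hcont t right_mem_uIcc, ?_⟩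
  -- Rescaling time to the fixed compact interval `[0, 1]` gives a uniform bound. Below `M + 1` the
  -- clamp is inactive, so these clamped solutions are true ones.
  have key : ∀ᶠ p : E4 × ℝ in 𝓝 (x, t), ∀ θ ∈ Icc (0 : ℝ) 1, ‖α (p.1, θ * p.2)‖ < M + 1 := by
    refine isCompact_Icc.eventually_forall_of_forall_eventually fun θ hθ => ?_
    have hm : θ * t ∈ uIcc 0 t := by
      rcases le_total 0 t with h | h
      · rw [uIcc_of_le h]; exact ⟨mul_nonneg hθ.1 h, mul_le_of_le_one_left h hθ.2⟩
      · rw [uIcc_of_ge h]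
        exact ⟨by nlinarith [hθ.2], mul_nonpos_of_nonneg_of_nonpos hθ.1 h⟩
    have hca : ContinuousAt (fun z : (E4 × ℝ) × ℝ => ‖α (z.1.1, z.2 * z.1.2)‖) ((x, t), θ) := by
      have h1 : ContinuousAt (fun z : (E4 × ℝ) × ℝ => (z.1.1, z.2 * z.1.2)) ((x, t), θ) := by fun_prop
      exact (ContinuousAt.comp (f := fun z : (E4 × ℝ) × ℝ => (z.1.1, z.2 * z.1.2)) (hcont _ hm) h1).norm
    refine hca.eventually_lt_const (lt_of_le_of_lt (?_ : _ ≤ M) (by linarith))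
    have : α (x, θ * t) = γ (θ * t) := heq hm
    simp only [this]
    exact hM _ (mem_image_of_mem _ hm)
  have h1 : ∀ᶠ p : E4 × ℝ in 𝓝 (x, t), p.1 ∈ closedBall x 1 :=
    continuousAt_fst.eventually (closedBall_mem_nhds x one_pos)
  have h2 : ∀ᶠ p : E4 × ℝ in 𝓝 (x, t), |p.2| < |t| + 1 :=
    (continuousAt_snd.abs).eventually_lt_const (by simp)
  filter_upwards [key, h1, h2] with p hp hp1 hp2
  have hI : IsIntegralCurveOn (fun s => α (p.1, s)) (fun _ => vf η) (uIcc 0 p.2) := by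
    have h3 := (hα p.1 hp1).2.mono (hsub p.2 hp2.le)
    intro s hs
    have h4 := h3 s hs
    have : ‖α (p.1, s)‖ ≤ M + 1 := by
      rcases eq_or_ne p.2 0 with h | h
      · rw [h] at hs
        have hs : s = 0 := by simpa using hs
        have := hp 0 (by simp)
        rw [zero_mul] at this
        rw [hs]; exact this.le
      · have hθ : s / p.2 ∈ Icc (0 : ℝ) 1 := by
          rcases le_total 0 p.2 with h' | h'
          · rw [uIcc_of_le h'] at hs
            exact ⟨div_nonneg hs.1 h', div_le_one_of_le₀ hs.2 h'⟩
          · rw [uIcc_of_ge h'] at hs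
            exact ⟨div_nonneg_of_nonpos hs.2 h', div_le_one_of_ge hs.1 h'⟩
        have := hp _ hθ
        rw [div_mul_cancel₀ _ h] at this
        exact this.le
    simpa only [clamp_of_norm_le this] using h4
  exact ⟨⟨_, (hα p.1 hp1).1, hI⟩, flow_eq_of_isIntegralCurveOn (hα p.1 hp1).1 hI⟩

lemma eventually_mem_flowDomain (ht : t ∈ flowDomain η x) :
    ∀ᶠ p : E4 × ℝ in 𝓝 (x, t), p.2 ∈ flowDomain η p.1 := by
  obtain ⟨α, -, h⟩ := exists_continuousAt_eventually_flow ht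
  exact h.mono fun p hp => hp.1

lemma continuousAt_flow (ht : t ∈ flowDomain η x) :
    ContinuousAt (fun p : E4 × ℝ => flow η p.2 p.1) (x, t) := by
  obtain ⟨α, hα, h⟩ := exists_continuousAt_eventually_flow ht
  exact hα.congr (h.mono fun p hp => hp.2.symm)

lemma isOpen_flowDomain (η : ℝ) (x : E4) : IsOpen (flowDomain η x) := by
  rw [isOpen_iff_mem_nhds]
  intro t ht
  exact (Continuous.prodMk_right x).continuousAt.eventually (eventually_mem_flowDomain ht)

lemma hasDerivAt_flow (ht : t ∈ flowDomain η x) :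
    HasDerivAt (fun s => flow η s x) (vf η (flow η t x)) t := by
  obtain ⟨ε, hε, hb⟩ := Metric.isOpen_iff.1 (isOpen_flowDomain η x) t ht
  have hp : t + ε / 2 ∈ flowDomain η x := hb (by simp [abs_of_pos hε]; linarith)
  have hm : t - ε / 2 ∈ flowDomain η x := hb (by simp [abs_of_pos hε]; linarith)
  rcases lt_trichotomy t 0 with h | h | h
  · have := isIntegralCurveOn_flow hm
    rw [uIcc_of_ge (by linarith)] at this
    exact (this t ⟨by linarith, h.le⟩).hasDerivAt (Icc_mem_nhds (by linarith) h)
  · have h1 := isIntegralCurveOn_flow hm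
    have h2 := isIntegralCurveOn_flow hp
    rw [uIcc_of_ge (by linarith)] at h1
    rw [uIcc_of_le (by linarith)] at h2
    have h3 := (h1 t ⟨by linarith, h.le⟩).union (h2 t ⟨h.ge, by linarith⟩)
    rw [Icc_union_Icc_eq_Icc (by linarith) (by linarith)] at h3
    exact h3.hasDerivAt (Icc_mem_nhds (by linarith) (by linarith))
  · have := isIntegralCurveOn_flow hp
    rw [uIcc_of_le (by linarith)] at this
    exact (this t ⟨h.le, by linarith⟩).hasDerivAt (Icc_mem_nhds h (by linarith))

/-- In this form of the group law both times belong to the existence interval of the same point, so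
a translate of one solution proves it; `flow_neg` and `flow_add` follow. -/
lemma flow_sub (ht : t ∈ flowDomain η x) (hs : s ∈ flowDomain η x) :
    s - t ∈ flowDomain η (flow η t x) ∧ flow η (s - t) (flow η t x) = flow η s x := by
  have hJ : OrdConnected ((fun τ => τ + t) ⁻¹' flowDomain η x) :=
    (ordConnected_flowDomain η x).preimage_mono fun a b h => by simpa using h
  have := flow_eq_of_ordConnected (γ := fun τ => flow η (τ + t) x) (x := flow η t x) hJ
    (by simpa using ht) (by simp) (t := s - t)
    (fun τ hτ => ((hasDerivAt_flow (η := η) (x := x) hτ).comp_add_const τ t).hasDerivWithinAt)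
    (by simpa using hs)
  simpa using this

lemma flow_neg (ht : t ∈ flowDomain η x) :
    -t ∈ flowDomain η (flow η t x) ∧ flow η (-t) (flow η t x) = x := by
  simpa using flow_sub ht (zero_mem_flowDomain η x)

lemma flow_add (ht : t ∈ flowDomain η x) (hs : s ∈ flowDomain η (flow η t x)) :
    t + s ∈ flowDomain η x ∧ flow η (t + s) x = flow η s (flow η t x) := by
  have h := flow_neg ht
  have := flow_sub h.1 hs
  rw [h.2] at this
  simpa [add_comm] using this

lemma flow_zero_right (η t : ℝ) : t ∈ flowDomain η 0 ∧ flow η t 0 = 0 := by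
  refine flow_eq_of_ordConnected (γ := fun _ => (0 : E4)) (J := univ) ordConnected_univ trivial rfl
    (fun s _ => ?_) trivial
  have : vf η 0 = 0 := by
    funext i; fin_cases i <;> simp [vf]
  change HasDerivWithinAt _ (vf η 0) _ _
  rw [this]
  exact (hasDerivAt_const s (0 : E4)).hasDerivWithinAt

section Coordinates

lemma hasDerivAt_flow_zero (ht : t ∈ flowDomain η x) :
    HasDerivAt (fun s => flow η s x 0) (flow η t x 1) t :=
  hasDerivAt_pi.1 (hasDerivAt_flow ht) 0

lemma hasDerivAt_flow_one (ht : t ∈ flowDomain η x) :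
    HasDerivAt (fun s => flow η s x 1) (flow η t x 2) t :=
  hasDerivAt_pi.1 (hasDerivAt_flow ht) 1

lemma hasDerivAt_flow_two (ht : t ∈ flowDomain η x) :
    HasDerivAt (fun s => flow η s x 2) (flow η t x 3) t :=
  hasDerivAt_pi.1 (hasDerivAt_flow ht) 2

lemma hasDerivAt_flow_three (ht : t ∈ flowDomain η x) :
    HasDerivAt (fun s => flow η s x 3)
      (-flow η t x 0 + η * flow η t x 2 + flow η t x 0 ^ 2) t :=
  hasDerivAt_pi.1 (hasDerivAt_flow ht) 3

end Coordinates

lemma H_flow (ht : t ∈ flowDomain η x) : H η (flow η t x) = H η x := by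
  have hd : ∀ s ∈ flowDomain η x, HasDerivAt (fun s => H η (flow η s x)) 0 s := by
    intro s hs
    have h0 := hasDerivAt_flow_zero hs
    have h1 := hasDerivAt_flow_one hs
    have h2 := hasDerivAt_flow_two hs
    have h3 := hasDerivAt_flow_three hs
    have := ((((h0.pow 2).const_mul (1 / 2)).sub ((h0.pow 3).const_mul (1 / 3))).sub
      ((h1.pow 2).const_mul (η / 2))).add (h1.mul h3) |>.sub ((h2.pow 2).const_mul (1 / 2))
    refine this.congr_deriv ?_
    norm_num
    ring
  have := (ordConnected_flowDomain η x).convex.is_const_of_fderivWithin_eq_zero (𝕜 := ℝ)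
    (f := fun s => H η (flow η s x))
    (fun s hs => (hd s hs).differentiableAt.differentiableWithinAt)
    (fun s hs => by
      rw [fderivWithin_of_isOpen (isOpen_flowDomain η x) hs]
      have := (hd s hs).hasFDerivAt.fderiv
      rw [this]; ext; simp)
    ht (zero_mem_flowDomain η x)
  simpa using this

lemma continuous_H (η : ℝ) : Continuous (H η) := by
  unfold H; fun_prop

lemma mem_Wu_iff : x ∈ Wu η ↔
    Iic 0 ⊆ flowDomain η x ∧ Tendsto (fun t => flow η t x) atBot (𝓝 0) := by
  constructor
  · rintro ⟨γ, h0, h, hl⟩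
    have hf : ∀ t ∈ Iic (0 : ℝ), t ∈ flowDomain η x ∧ flow η t x = γ t := fun t ht =>
      flow_eq_of_ordConnected ordConnected_Iic (by simp) h0 h ht
    refine ⟨fun t ht => (hf t ht).1, hl.congr' ?_⟩
    filter_upwards [eventually_le_atBot (0 : ℝ)] with t ht using (hf t ht).2.symm
  · rintro ⟨h, hl⟩
    exact ⟨fun t => flow η t x, by simp, fun t ht => (hasDerivAt_flow (h ht)).hasDerivWithinAt, hl⟩

lemma flow_mem_Wu (hx : x ∈ Wu η) (ht : t ∈ flowDomain η x) : flow η t x ∈ Wu η := by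
  rw [mem_Wu_iff] at hx ⊢
  have hd : ∀ s ≤ -t, s ≤ 0 → s + t ∈ flowDomain η x := fun s hs _ => hx.1 (by
    simp only [mem_Iic]; linarith)
  have hI : ∀ s ≤ (0 : ℝ), s + t ∈ flowDomain η x := by
    intro s hs
    rcases le_total (s + t) 0 with h | h
    · exact hx.1 h
    · exact flowDomain_subset ht (by rw [uIcc_of_le (by linarith)]; exact ⟨h, by linarith⟩)
  have hf : ∀ s ≤ (0 : ℝ), s ∈ flowDomain η (flow η t x) ∧
      flow η s (flow η t x) = flow η (s + t) x := fun s hs => by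
    simpa using flow_sub ht (hI s hs)
  refine ⟨fun s hs => (hf s hs).1, ?_⟩
  refine (hx.2.comp (tendsto_atBot_add_const_right _ t tendsto_id)).congr' ?_
  filter_upwards [eventually_le_atBot (0 : ℝ)] with s hs using (hf s hs).2.symm

lemma H_eq_zero_of_mem_Wu (hx : x ∈ Wu η) : H η x = 0 := by
  rw [mem_Wu_iff] at hx
  have h1 : Tendsto (fun t => H η (flow η t x)) atBot (𝓝 (H η 0)) :=
    (continuous_H η).continuousAt.tendsto.comp hx.2
  have h2 : Tendsto (fun t => H η (flow η t x)) atBot (𝓝 (H η x)) :=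
    tendsto_const_nhds.congr' (by
      filter_upwards [eventually_le_atBot (0 : ℝ)] with t ht using (H_flow (hx.1 ht)).symm)
  rw [tendsto_nhds_unique h2 h1]
  simp [H]

/-- A nonconstant orbit in the unstable manifold of the origin is not periodic. -/
lemma flow_injOn_of_mem_Wu (hx : x ∈ Wu η) (hx0 : x ≠ 0) :
    InjOn (fun t => flow η t x) (flowDomain η x) := by
  have main : ∀ s ∈ flowDomain η x, ∀ t ∈ flowDomain η x, s < t → flow η s x ≠ flow η t x := by
    intro s hs t ht hst he
    set z := flow η t x with hz
    have hzW : z ∈ Wu η := flow_mem_Wu hx ht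
    have h1 := flow_sub ht hs
    rw [he] at h1
    -- A period could be iterated backwards, but the backward orbit of `z` tends to the origin, so
    -- `z = 0`.
    have h2 : ∀ n : ℕ, flow η (n * (s - t)) z = z ∧ (n * (s - t)) ∈ flowDomain η z := by
      intro n
      induction n with
      | zero => simp [zero_mem_flowDomain]
      | succ n ih =>
        have h3 := flow_add ih.2 (s := s - t) (by rw [ih.1]; exact h1.1)
        rw [ih.1, h1.2] at h3
        have e : ((n + 1 : ℕ) : ℝ) * (s - t) = n * (s - t) + (s - t) := by push_cast; ring
        rw [e]
        exact ⟨h3.2, h3.1⟩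
    have h4 : Tendsto (fun n : ℕ => flow η (n * (s - t)) z) atTop (𝓝 0) :=
      (mem_Wu_iff.1 hzW).2.comp (tendsto_natCast_atTop_atTop.atTop_mul_const_of_neg (by linarith))
    have h5 : z = 0 := tendsto_nhds_unique
      (tendsto_const_nhds.congr fun n => (h2 n).1.symm) h4
    have h6 := (flow_neg ht).2
    rw [← hz, h5, (flow_zero_right η _).2] at h6
    exact hx0 h6.symm
  intro s hs t ht he
  rcases lt_trichotomy s t with h | h | h
  · exact absurd he (main s hs t ht h)
  · exact h
  · exact absurd he.symm (main t ht s hs h)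

end

end Bifocus

/-! ### The invariant analytic graph over a disc. -/

namespace Bifocus

noncomputable section

open Metric

variable {η : ℝ} {x y : E4} {s t R : ℝ} {a b : ℝ × ℝ → ℝ}

/-- The closed Euclidean disc of radius `R`. -/
def disc (R : ℝ) : Set (ℝ × ℝ) := {u | u.1 ^ 2 + u.2 ^ 2 ≤ R ^ 2}

/-- The projection `(x₁, x₂)` of a point of phase space. -/
def pr (x : E4) : ℝ × ℝ := (x 0, x 1)

@[fun_prop]
lemma continuous_pr : Continuous pr := by unfold pr; fun_prop

@[simp] lemma pr_graphPt (a b : ℝ × ℝ → ℝ) (u : ℝ × ℝ) : pr (graphPt a b u) = u := rfl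

lemma graphPt_pr_eq_iff : graphPt a b (pr x) = x ↔ x 2 = a (pr x) ∧ x 3 = b (pr x) := by
  constructor
  · intro h
    exact ⟨(congrFun h 2).symm, (congrFun h 3).symm⟩
  · rintro ⟨h1, h2⟩
    funext i
    fin_cases i
    · rfl
    · rfl
    · exact h1.symm
    · exact h2.symm

lemma isCompact_disc (R : ℝ) : IsCompact (disc R) := by
  refine Metric.isCompact_of_isClosed_isBounded (isClosed_le (by fun_prop) (by fun_prop)) ?_
  refine (isBounded_closedBall (x := (0 : ℝ × ℝ)) (r := |R|)).subset fun u hu => ?_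
  have hu : u.1 ^ 2 + u.2 ^ 2 ≤ R ^ 2 := hu
  rw [mem_closedBall_zero_iff, Prod.norm_def, max_le_iff]
  exact ⟨sq_le_sq.1 (by nlinarith [sq_nonneg u.2]), sq_le_sq.1 (by nlinarith [sq_nonneg u.1])⟩

lemma convex_disc (R : ℝ) : Convex ℝ (disc R) := by
  have h1 : ConvexOn ℝ univ (fun u : ℝ × ℝ => u.1 ^ 2) :=
    (even_two.convexOn_pow (𝕜 := ℝ)).comp_linearMap (LinearMap.fst ℝ ℝ ℝ)
  have h2 : ConvexOn ℝ univ (fun u : ℝ × ℝ => u.2 ^ 2) :=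
    (even_two.convexOn_pow (𝕜 := ℝ)).comp_linearMap (LinearMap.snd ℝ ℝ ℝ)
  have := (h1.add h2).convex_le (R ^ 2)
  simpa [disc] using this

lemma zero_mem_disc (R : ℝ) : (0 : ℝ × ℝ) ∈ disc R := by
  simp [disc]; positivity

lemma disc_mem_nhds {u : ℝ × ℝ} (hu : u.1 ^ 2 + u.2 ^ 2 < R ^ 2) : disc R ∈ 𝓝 u := by
  have hc : ContinuousAt (fun v : ℝ × ℝ => v.1 ^ 2 + v.2 ^ 2) u := by fun_prop
  have : ∀ᶠ v : ℝ × ℝ in 𝓝 u, v.1 ^ 2 + v.2 ^ 2 < R ^ 2 := hc.eventually_lt_const hu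
  exact this.mono fun v hv => hv.le

/-- Analyticity holds on an open set, which contains a `δ`-thickening of the compact disc; radial
contraction moves a point of the larger disc by at most `δ` into the smaller one. -/
lemma exists_analyticOnNhd_larger_disc {r : ℝ} (hr : 0 < r) {f : ℝ × ℝ → ℝ}
    (hf : AnalyticOnNhd ℝ f (disc r)) :
    ∃ δ > 0, AnalyticOnNhd ℝ f (disc (r + δ)) := by
  obtain ⟨δ, hδ, h⟩ := (isCompact_disc r).exists_cthickening_subset_open
    (isOpen_analyticAt ℝ f) hf
  refine ⟨δ, hδ, fun u hu => h ?_⟩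
  have hu : u.1 ^ 2 + u.2 ^ 2 ≤ (r + δ) ^ 2 := hu
  have hrδ : 0 < r + δ := by linarith
  refine mem_cthickening_of_dist_le u ((r / (r + δ)) • u) δ _ ?_ ?_
  · simp only [disc, mem_ofPred_eq, Prod.smul_fst, Prod.smul_snd, smul_eq_mul, mul_pow, ← mul_add]
    calc (r / (r + δ)) ^ 2 * (u.1 ^ 2 + u.2 ^ 2) ≤ (r / (r + δ)) ^ 2 * (r + δ) ^ 2 := by gcongr
      _ = r ^ 2 := by field_simp
  · have hn : ‖u‖ ≤ r + δ := by
      rw [Prod.norm_def, max_le_iff]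
      exact ⟨abs_le_of_sq_le_sq (by nlinarith [sq_nonneg u.2]) hrδ.le,
        abs_le_of_sq_le_sq (by nlinarith [sq_nonneg u.1]) hrδ.le⟩
    have e : u - (r / (r + δ)) • u = (δ / (r + δ)) • u := by
      have : u = (1 : ℝ) • u := (one_smul ℝ u).symm
      nth_rewrite 1 [this]
      rw [← sub_smul]
      congr 1
      field_simp
      ring
    rw [dist_eq_norm, e, norm_smul, Real.norm_of_nonneg (by positivity)]
    calc δ / (r + δ) * ‖u‖ ≤ δ / (r + δ) * (r + δ) := by gcongr
      _ = δ := by field_simp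

lemma analyticAt_clm_apply {E F G : Type*} [NormedAddCommGroup E] [NormedSpace ℝ E]
    [NormedAddCommGroup F] [NormedSpace ℝ F] [NormedAddCommGroup G] [NormedSpace ℝ G]
    {f : E → F →L[ℝ] G} {g : E → F} {u : E} (hf : AnalyticAt ℝ f u) (hg : AnalyticAt ℝ g u) :
    AnalyticAt ℝ (fun v => f v (g v)) u :=
  ((ContinuousLinearMap.id ℝ (F →L[ℝ] G)).analyticAt_bilinear (f u, g u)).comp_of_eq
    (hf.prod hg) rfl

/-- Over the disc of radius `R`, the graph of the analytic pair `(a, b)` is a locally invariant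
surface through the origin, contained in the zero level set of the first integral. -/
structure IsInvariantGraph (η R : ℝ) (a b : ℝ × ℝ → ℝ) : Prop where
  analytic_a : AnalyticOnNhd ℝ a (disc R)
  analytic_b : AnalyticOnNhd ℝ b (disc R)
  a_zero : a 0 = 0
  b_zero : b 0 = 0
  fderiv_a : ∀ u ∈ disc R, fderiv ℝ a u (u.2, a u) = b u
  fderiv_b : ∀ u ∈ disc R, fderiv ℝ b u (u.2, a u) = -u.1 + η * a u + u.1 ^ 2
  H_eq_zero : ∀ u ∈ disc R, H η (graphPt a b u) = 0

lemma IsLocalUnstableGraph.zero (h : IsLocalUnstableGraph η a b) : a 0 = 0 ∧ b 0 = 0 := by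
  obtain ⟨N, hN, h⟩ := h
  have := (h 0 (mem_of_mem_nhds hN)).2 ⟨fun t => flow η t 0, by simp,
    fun t _ => (hasDerivAt_flow (flow_zero_right η t).1).hasDerivWithinAt,
    fun t _ => by simp only [(flow_zero_right η t).2]; exact mem_of_mem_nhds hN,
    by simp only [(flow_zero_right η _).2]; exact tendsto_const_nhds⟩
  exact ⟨this.1.symm, this.2.symm⟩

lemma continuousAt_graphPt {u : ℝ × ℝ} (ha : ContinuousAt a u) (hb : ContinuousAt b u) :
    ContinuousAt (graphPt a b) u := by
  rw [continuousAt_pi]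
  intro i
  fin_cases i
  · exact continuousAt_fst
  · exact continuousAt_snd
  · exact ha
  · exact hb

/-- The backward orbit of a point of the graph stays on the graph, since each of its points
satisfies the same characterization. Differentiating `x₃ = a` and `x₄ = b` along it from the left at
time 0 gives the equations. -/
lemma IsLocalUnstableGraph.eventually (h : IsLocalUnstableGraph η a b)
    (ha : AnalyticAt ℝ a 0) (hb : AnalyticAt ℝ b 0) :
    ∀ᶠ u in 𝓝 (0 : ℝ × ℝ), fderiv ℝ a u (u.2, a u) = b u ∧
      fderiv ℝ b u (u.2, a u) = -u.1 + η * a u + u.1 ^ 2 ∧ H η (graphPt a b u) = 0 := by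
  have h0 := h.zero
  obtain ⟨N, hN, h⟩ := h
  have hg : graphPt a b 0 = 0 := by
    funext i
    fin_cases i <;> simp [graphPt, h0]
  have hN' : ∀ᶠ u in 𝓝 (0 : ℝ × ℝ), graphPt a b u ∈ N :=
    (continuousAt_graphPt ha.continuousAt hb.continuousAt).eventually (by rwa [hg])
  filter_upwards [hN', ha.eventually_analyticAt, hb.eventually_analyticAt] with u hu hau hbu
  obtain ⟨γ, hγ0, hγ, hγN, hγl⟩ := (h _ hu).1 ⟨rfl, rfl⟩
  have hon : ∀ t ≤ 0, γ t 2 = a (pr (γ t)) ∧ γ t 3 = b (pr (γ t)) := by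
    intro t ht
    refine (h _ (hγN t ht)).2 ⟨fun s => γ (s + t), by simp, ?_, fun s hs => hγN _ (by linarith),
      hγl.comp (tendsto_atBot_add_const_right _ t tendsto_id)⟩
    exact (hγ.comp_add t).mono fun s hs => by
      have hs : s ≤ 0 := hs
      rw [mem_vadd_set]
      exact ⟨t + s, by simp only [mem_Iic]; linarith, by simp⟩
  have hd := hasDerivWithinAt_pi.1 (hγ 0 (by simp))
  have hpr : HasDerivWithinAt (fun t => pr (γ t)) (u.2, a u) (Iic 0) 0 := by
    have e0 := hd 0
    have e1 := hd 1
    rw [hγ0] at e0 e1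
    exact e0.prodMk e1
  have hpr0 : pr (γ 0) = u := by rw [hγ0]; rfl
  have huniq := uniqueDiffWithinAt_Iic (0 : ℝ)
  refine ⟨?_, ?_, ?_⟩
  · have e2 := hd 2
    have e3 := (hau.differentiableAt.hasFDerivAt).comp_hasDerivWithinAt_of_eq (0 : ℝ) hpr hpr0.symm
    have e4 := e3.congr (f₁ := fun t => γ t 2) (fun t ht => (hon t ht).1) (hon 0 le_rfl).1
    rw [huniq.eq_deriv _ e4 e2, hγ0]
    rfl
  · have e2 := hd 3
    have e3 := (hbu.differentiableAt.hasFDerivAt).comp_hasDerivWithinAt_of_eq (0 : ℝ) hpr hpr0.symm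
    have e4 := e3.congr (f₁ := fun t => γ t 3) (fun t ht => (hon t ht).2) (hon 0 le_rfl).2
    rw [huniq.eq_deriv _ e4 e2, hγ0]
    rfl
  · exact H_eq_zero_of_mem_Wu ⟨γ, hγ0, hγ, hγl⟩

/-- Identity principle on the connected disc: the equations hold near 0 and both sides are analytic.
-/
lemma isInvariantGraph_of_analyticOnNhd (h : IsLocalUnstableGraph η a b)
    (ha : AnalyticOnNhd ℝ a (disc R)) (hb : AnalyticOnNhd ℝ b (disc R)) :
    IsInvariantGraph η R a b := by
  have hev := h.eventually (ha 0 (zero_mem_disc R)) (hb 0 (zero_mem_disc R))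
  have hfst : AnalyticOnNhd ℝ (fun u : ℝ × ℝ => u.1) (disc R) := fun _ _ => analyticAt_fst
  have hsnd : AnalyticOnNhd ℝ (fun u : ℝ × ℝ => u.2) (disc R) := fun _ _ => analyticAt_snd
  have hc : IsPreconnected (disc R) := (convex_disc R).isPreconnected
  refine ⟨ha, hb, h.zero.1, h.zero.2, ?_, ?_, ?_⟩
  · have h1 : AnalyticOnNhd ℝ (fun u => fderiv ℝ a u (u.2, a u)) (disc R) := fun u hu =>
      analyticAt_clm_apply (ha.fderiv u hu) ((hsnd u hu).prod (ha u hu))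
    exact h1.eqOn_of_preconnected_of_eventuallyEq hb hc (zero_mem_disc R)
      (hev.mono fun u hu => hu.1)
  · have h1 : AnalyticOnNhd ℝ (fun u => fderiv ℝ b u (u.2, a u)) (disc R) := fun u hu =>
      analyticAt_clm_apply (hb.fderiv u hu) ((hsnd u hu).prod (ha u hu))
    refine h1.eqOn_of_preconnected_of_eventuallyEq ?_ hc (zero_mem_disc R)
      (hev.mono fun u hu => hu.2.1)
    · exact (hfst.neg.add (analyticOnNhd_const.mul ha)).add (hfst.pow 2)
  · have h0 : AnalyticOnNhd ℝ (fun _ : ℝ × ℝ => (0 : ℝ)) (disc R) := analyticOnNhd_const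
    have h1 : AnalyticOnNhd ℝ (fun u : ℝ × ℝ =>
      1 / 2 * u.1 ^ 2 - 1 / 3 * u.1 ^ 3 - η / 2 * u.2 ^ 2 + u.2 * b u - 1 / 2 * a u ^ 2)
        (disc R) :=
      ((((analyticOnNhd_const.mul (hfst.pow 2)).sub (analyticOnNhd_const.mul (hfst.pow 3))).sub
        (analyticOnNhd_const.mul (hsnd.pow 2))).add (hsnd.mul hb)).sub
        (analyticOnNhd_const.mul (ha.pow 2))
    exact h1.eqOn_of_preconnected_of_eventuallyEq h0 hc (zero_mem_disc R)
      (hev.mono fun u hu => hu.2.2)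

lemma IsSetting.exists_isInvariantGraph {r : ℝ} (h : IsSetting η r a b) :
    ∃ R > r, IsInvariantGraph η R a b := by
  obtain ⟨δ₁, h1, ha⟩ := exists_analyticOnNhd_larger_disc h.r_pos h.analytic_a
  obtain ⟨δ₂, h2, hb⟩ := exists_analyticOnNhd_larger_disc h.r_pos h.analytic_b
  have hr := h.r_pos
  have hsub : ∀ δ ≥ min δ₁ δ₂, disc (r + min δ₁ δ₂) ⊆ disc (r + δ) := by
    intro δ hδ u hu
    have hm : 0 < min δ₁ δ₂ := lt_min h1 h2
    have hu : u.1 ^ 2 + u.2 ^ 2 ≤ (r + min δ₁ δ₂) ^ 2 := hu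
    have h3 : (r + min δ₁ δ₂) ^ 2 ≤ (r + δ) ^ 2 := by gcongr
    exact hu.trans h3
  exact ⟨r + min δ₁ δ₂, by linarith [lt_min h1 h2], isInvariantGraph_of_analyticOnNhd
    h.local_unstable (ha.mono (hsub _ (min_le_left _ _))) (hb.mono (hsub _ (min_le_right _ _)))⟩

/-- Grönwall's inequality forwards from `τ₀`, and backwards by reversing time. -/
lemma eq_zero_of_norm_deriv_le {E : Type*} [NormedAddCommGroup E] [NormedSpace ℝ E]
    {f f' : ℝ → E} {K s t τ₀ : ℝ} (hf : ∀ τ ∈ Icc s t, HasDerivAt f (f' τ) τ)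
    (hK : ∀ τ ∈ Icc s t, ‖f' τ‖ ≤ K * ‖f τ‖) (hτ₀ : τ₀ ∈ Icc s t) (h0 : f τ₀ = 0) :
    ∀ τ ∈ Icc s t, f τ = 0 := by
  intro τ hτ
  rcases le_total τ₀ τ with h | h
  · have hsub : Icc τ₀ t ⊆ Icc s t := Icc_subset_Icc_left hτ₀.1
    exact eq_zero_of_abs_deriv_le_mul_abs_self_of_eq_zero_right (f := f) (f' := f') (K := K)
      (fun σ hσ => (hf σ (hsub hσ)).continuousAt.continuousWithinAt)
      (fun σ hσ => (hf σ (hsub (Ico_subset_Icc_self hσ))).hasDerivWithinAt) h0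
      (fun σ hσ => hK σ (hsub (Ico_subset_Icc_self hσ))) τ ⟨h, hτ.2⟩
  · have hsub : ∀ σ ∈ Icc (-τ₀) (-s), -σ ∈ Icc s t := fun σ hσ =>
      ⟨by linarith [hσ.2], by linarith [hσ.1, hτ₀.2]⟩
    have hd : ∀ σ ∈ Icc (-τ₀) (-s), HasDerivAt (fun σ => f (-σ)) (-f' (-σ)) σ := fun σ hσ => by
      have := (hf _ (hsub σ hσ)).scomp σ (hasDerivAt_neg σ)
      rwa [neg_one_smul] at this
    have := eq_zero_of_abs_deriv_le_mul_abs_self_of_eq_zero_right (f := fun σ => f (-σ))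
      (f' := fun σ => -f' (-σ)) (K := K) (a := -τ₀) (b := -s)
      (fun σ hσ => (hd σ hσ).continuousAt.continuousWithinAt)
      (fun σ hσ => (hd σ (Ico_subset_Icc_self hσ)).hasDerivWithinAt) (by simpa using h0)
      (fun σ hσ => by simpa using hK _ (hsub σ (Ico_subset_Icc_self hσ))) (-τ)
      ⟨by linarith, by linarith [hτ.1]⟩
    simpa using this

/-- An orbit segment over the disc which has a point on the invariant graph lies in the graph. -/
lemma IsInvariantGraph.graphPt_pr_flow (h : IsInvariantGraph η R a b)
    (hdom : Icc s t ⊆ flowDomain η x) (hdisc : ∀ τ ∈ Icc s t, pr (flow η τ x) ∈ disc R)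
    {τ₀ : ℝ} (hτ₀ : τ₀ ∈ Icc s t) (h0 : graphPt a b (pr (flow η τ₀ x)) = flow η τ₀ x) :
    ∀ τ ∈ Icc s t, graphPt a b (pr (flow η τ x)) = flow η τ x := by
  obtain ⟨A, hA⟩ := ((isCompact_disc R).image_of_continuousOn
    h.analytic_a.fderiv.continuousOn).isBounded.exists_norm_le
  obtain ⟨B, hB⟩ := ((isCompact_disc R).image_of_continuousOn
    h.analytic_b.fderiv.continuousOn).isBounded.exists_norm_le
  have hA0 : 0 ≤ A := (norm_nonneg _).trans (hA _ (mem_image_of_mem _ (hdisc _ hτ₀)))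
  have hB0 : 0 ≤ B := (norm_nonneg _).trans (hB _ (mem_image_of_mem _ (hdisc _ hτ₀)))
  set d : ℝ → ℝ × ℝ := fun τ =>
    (flow η τ x 2 - a (pr (flow η τ x)), flow η τ x 3 - b (pr (flow η τ x))) with hd
  set d' : ℝ → ℝ × ℝ := fun τ =>
    (flow η τ x 3 - fderiv ℝ a (pr (flow η τ x)) (flow η τ x 1, flow η τ x 2),
      (-flow η τ x 0 + η * flow η τ x 2 + flow η τ x 0 ^ 2) -
        fderiv ℝ b (pr (flow η τ x)) (flow η τ x 1, flow η τ x 2)) with hd'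
  have hder : ∀ τ ∈ Icc s t, HasDerivAt d (d' τ) τ := by
    intro τ hτ
    have hpr : HasDerivAt (fun τ => pr (flow η τ x)) (flow η τ x 1, flow η τ x 2) τ :=
      (hasDerivAt_flow_zero (hdom hτ)).prodMk (hasDerivAt_flow_one (hdom hτ))
    have h1 := (h.analytic_a _ (hdisc τ hτ)).differentiableAt.hasFDerivAt.comp_hasDerivAt τ hpr
    have h2 := (h.analytic_b _ (hdisc τ hτ)).differentiableAt.hasFDerivAt.comp_hasDerivAt τ hpr
    exact ((hasDerivAt_flow_two (hdom hτ)).sub h1).prodMk ((hasDerivAt_flow_three (hdom hτ)).sub h2)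
  have hbound : ∀ τ ∈ Icc s t, ‖d' τ‖ ≤ (1 + A + |η| + B) * ‖d τ‖ := by
    intro τ hτ
    set y := flow η τ x with hy
    have ea := h.fderiv_a _ (hdisc τ hτ)
    have eb := h.fderiv_b _ (hdisc τ hτ)
    rw [← hy] at ea eb
    -- The planar velocity of the orbit is that of the graph plus the deviation `d` in `x₃`.
    -- Cancelling the invariance equations leaves `d'` linear in `d` with bounded coefficients, so
    -- Grönwall applies.
    have hsplit : (y 1, y 2) = ((pr y).2, a (pr y)) + (0, y 2 - a (pr y)) := by
      simp [pr]
    have e1 : d' τ = ((d τ).2 - fderiv ℝ a (pr y) (0, (d τ).1),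
        η * (d τ).1 - fderiv ℝ b (pr y) (0, (d τ).1)) := by
      simp only [hd', hd, ← hy]
      rw [hsplit, map_add, map_add, ea, eb]
      ext
      · ring
      · simp only [pr]; ring
    have n1 : |(d τ).1| ≤ ‖d τ‖ := norm_fst_le (d τ)
    have n2 : |(d τ).2| ≤ ‖d τ‖ := norm_snd_le (d τ)
    have n3 : ‖((0 : ℝ), (d τ).1)‖ ≤ ‖d τ‖ := by
      rw [Prod.norm_def]; simp [n1]
    have n4 : |fderiv ℝ a (pr y) (0, (d τ).1)| ≤ A * ‖d τ‖ :=
      (ContinuousLinearMap.le_opNorm _ _).trans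
        (mul_le_mul (hA _ (mem_image_of_mem _ (hdisc τ hτ))) n3 (norm_nonneg _) hA0)
    have n5 : |fderiv ℝ b (pr y) (0, (d τ).1)| ≤ B * ‖d τ‖ :=
      (ContinuousLinearMap.le_opNorm _ _).trans
        (mul_le_mul (hB _ (mem_image_of_mem _ (hdisc τ hτ))) n3 (norm_nonneg _) hB0)
    have n6 : |η * (d τ).1| ≤ |η| * ‖d τ‖ := by
      rw [abs_mul]; gcongr
    have n7 := mul_nonneg (abs_nonneg η) (norm_nonneg (d τ))
    have n8 := mul_nonneg hA0 (norm_nonneg (d τ))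
    have n9 := mul_nonneg hB0 (norm_nonneg (d τ))
    rw [e1, Prod.norm_def, max_le_iff]
    refine ⟨(abs_sub _ _).trans ?_, (abs_sub _ _).trans ?_⟩
    · nlinarith
    · nlinarith [norm_nonneg (d τ)]
  have hz : d τ₀ = 0 := by
    rw [graphPt_pr_eq_iff] at h0
    simp only [hd]
    ext
    · simp [h0.1]
    · simp [h0.2]
  intro τ hτ
  have := eq_zero_of_norm_deriv_le hder hbound hτ₀ hz τ hτ
  rw [graphPt_pr_eq_iff]
  simp only [hd, Prod.mk_eq_zero, sub_eq_zero] at this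
  exact this

/-- The linear part of `a` at the origin, found from the invariance of the graph: the projection of
the vector field to the `(x₁, x₂)`-plane has a focus at the origin. -/
lemma IsInvariantGraph.fderiv_a_zero (h : IsInvariantGraph η R a b) (hR : R ≠ 0)
    (hη : -2 < η ∧ η < 2) :
    ∃ c : ℝ, c ^ 2 = η + 2 ∧ ∀ w : ℝ × ℝ, fderiv ℝ a 0 w = -w.1 + c * w.2 := by
  have hn : disc R ∈ 𝓝 (0 : ℝ × ℝ) := disc_mem_nhds (by simp; positivity)
  have ha := h.analytic_a 0 (zero_mem_disc R)
  have hb := h.analytic_b 0 (zero_mem_disc R)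
  set A := fderiv ℝ a 0 with hA
  set B := fderiv ℝ b 0 with hB
  have hA' : HasFDerivAt a A 0 := ha.differentiableAt.hasFDerivAt
  have hB' : HasFDerivAt b B 0 := hb.differentiableAt.hasFDerivAt
  have hF : HasFDerivAt (fun u : ℝ × ℝ => (u.2, a u)) ((ContinuousLinearMap.snd ℝ ℝ ℝ).prod A) 0 :=
    hasFDerivAt_snd.prodMk hA'
  have h1 : ∀ w, B w = A (w.2, A w) := by
    have e1 := (ha.fderiv.differentiableAt.hasFDerivAt).clm_apply hF
    have e2 := e1.congr_of_eventuallyEq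
      (f₁ := b) (mem_of_superset hn fun u hu => (h.fderiv_a u hu).symm)
    intro w
    have := congrArg (fun L => L w) (hB'.unique e2)
    have hz : ((0 : ℝ), a 0) = 0 := by rw [h.a_zero]; rfl
    simpa [hz] using this
  have h2 : ∀ w : ℝ × ℝ, -w.1 + η * A w = B (w.2, A w) := by
    have e1 := (hb.fderiv.differentiableAt.hasFDerivAt).clm_apply hF
    have e2 := e1.congr_of_eventuallyEq (f₁ := fun u : ℝ × ℝ => -u.1 + η * a u + u.1 ^ 2)
      (mem_of_superset hn fun u hu => (h.fderiv_b u hu).symm)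
    have e3 : HasFDerivAt (fun u : ℝ × ℝ => -u.1 + η * a u + u.1 ^ 2) _ 0 :=
      ((hasFDerivAt_fst (𝕜 := ℝ) (p := (0 : ℝ × ℝ))).neg.add (hA'.const_mul η)).add
        ((hasFDerivAt_fst (𝕜 := ℝ) (p := (0 : ℝ × ℝ))).pow 2)
    intro w
    have := congrArg (fun L => L w) (e3.unique e2)
    have hz : ((0 : ℝ), a 0) = 0 := by rw [h.a_zero]; rfl
    simpa [hz] using this
  set p := A (1, 0) with hp
  set c := A (0, 1) with hc
  have hlin : ∀ w : ℝ × ℝ, A w = w.1 * p + w.2 * c := by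
    intro w
    have : w = w.1 • ((1 : ℝ), (0 : ℝ)) + w.2 • ((0 : ℝ), (1 : ℝ)) := by ext <;> simp
    nth_rewrite 1 [this]
    rw [map_add, map_smul, map_smul]; rfl
  have k1 := h2 (1, 0)
  have k2 := h2 (0, 1)
  simp only [h1, hlin] at k1 k2
  norm_num at k1 k2
  -- The linearized invariance equations are `p² + p c² = η p - 1` and `c (2 p + c²) = η c`. If `c =
  -- 0`, then `p² - η p + 1 = 0` has no real root; otherwise `p² = 1`, and `p = 1` would give `c² =
  -- η - 2 < 0`.
  have k3 : c * (2 * p + c ^ 2 - η) = 0 := by linarith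
  have hp2 : p = -1 ∧ c ^ 2 = η + 2 := by
    rcases mul_eq_zero.1 k3 with h0 | h0
    · rw [h0] at k1
      exfalso
      nlinarith [sq_nonneg (p - η / 2), sq_nonneg p]
    · have hcc : c ^ 2 = η - 2 * p := by linarith
      have hp1 : (p - 1) * (p + 1) = 0 := by nlinarith
      rcases mul_eq_zero.1 hp1 with h3 | h3
      · exfalso
        have : p = 1 := by linarith
        rw [this] at hcc
        nlinarith [sq_nonneg c]
      · have : p = -1 := by linarith
        exact ⟨this, by rw [hcc, this]; ring⟩
  refine ⟨c, hp2.2, fun w => ?_⟩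
  rw [hlin, hp2.1]
  ring

end

end Bifocus

/-! ### Backward spiralling around the origin. -/

namespace Bifocus

noncomputable section

open Metric

variable {η : ℝ} {x y : E4} {s t R : ℝ} {a b : ℝ × ℝ → ℝ}

lemma IsLocalUnstableGraph.eventually_graphPt_pr_flow (h : IsLocalUnstableGraph η a b)
    (hx : x ∈ Wu η) : ∀ᶠ t in atBot, graphPt a b (pr (flow η t x)) = flow η t x := by
  obtain ⟨N, hN, h⟩ := h
  obtain ⟨hdom, hlim⟩ := mem_Wu_iff.1 hx
  obtain ⟨t₀, ht₀⟩ := eventually_atBot.1 (hlim.eventually hN)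
  filter_upwards [eventually_le_atBot t₀, eventually_le_atBot 0] with t h1 h2
  rw [graphPt_pr_eq_iff]
  refine (h _ (ht₀ t h1)).2 ⟨fun s => flow η (s + t) x, by simp, ?_,
    fun s hs => ht₀ _ (by linarith), hlim.comp (tendsto_atBot_add_const_right _ t tendsto_id)⟩
  intro s hs
  have hs : s ≤ 0 := hs
  exact ((hasDerivAt_flow (hdom (by simp only [mem_Iic]; linarith))).comp_add_const s
    t).hasDerivWithinAt

lemma le_of_mem_interior_Iic {t₁ t : ℝ} (ht : t ∈ interior (Iic t₁)) : t ≤ t₁ :=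
  mem_Iic.1 (interior_subset ht)

/-- While `x₁ ≠ 0`, the polar angle `arctan (x₂ / x₁)` is smooth with values in an interval of
length `π`. On the graph its derivative is `(x₁ x₃ - x₂²) / (x₁² + x₂²)` with `x₃ ≈ -x₁ + c x₂` and
`|c| < 2`, hence bounded above by a negative constant. A long time interval would use up more than
`π`. -/
lemma exists_flow_zero_eq_zero (hη : -2 < η ∧ η < 2) (h : IsLocalUnstableGraph η a b)
    (hg : IsInvariantGraph η R a b) (hR : R ≠ 0) (hx : x ∈ Wu η) (t₀ : ℝ) :
    ∃ t ≤ t₀, flow η t x 0 = 0 := by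
  by_contra! hne
  obtain ⟨hdom, hlim⟩ := mem_Wu_iff.1 hx
  obtain ⟨c, hc2, hc⟩ := hg.fderiv_a_zero hR hη
  have hc1 : |c| < 2 := by
    rw [← abs_two, ← sq_lt_sq]; linarith [hη.2]
  -- The quadratic form `-x₁² + c x₁ x₂ - x₂²` is at most `-k (x₁² + x₂²)`; half of `k` absorbs the
  -- nonlinear remainder.
  set k : ℝ := 1 - |c| / 2 with hk
  have hk0 : 0 < k := by rw [hk]; linarith
  have hfd := (hg.analytic_a 0 (zero_mem_disc R)).differentiableAt.hasFDerivAt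
  have hlo : ∀ᶠ u in 𝓝 (0 : ℝ × ℝ), |a u - (-u.1 + c * u.2)| ≤ k / 2 * ‖u‖ := by
    have := (hasFDerivAt_iff_isLittleO_nhds_zero.1 hfd).def (half_pos hk0)
    simpa [hg.a_zero, hc] using this
  have hpr : Tendsto (fun t => pr (flow η t x)) atBot (𝓝 0) := by
    have := (continuous_pr.tendsto 0).comp hlim
    simpa [pr] using! this
  obtain ⟨t₁, ht₁⟩ := eventually_atBot.1 ((hpr.eventually hlo).and
    ((h.eventually_graphPt_pr_flow hx).and
      ((eventually_le_atBot 0).and (eventually_le_atBot t₀))))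
  have hd : ∀ t ≤ t₁, HasDerivAt (fun t => Real.arctan (flow η t x 1 / flow η t x 0))
      (1 / (1 + (flow η t x 1 / flow η t x 0) ^ 2) *
        ((flow η t x 2 * flow η t x 0 - flow η t x 1 * flow η t x 1) / flow η t x 0 ^ 2)) t := by
    intro t ht
    have hD := hdom (ht₁ t ht).2.2.1
    exact ((hasDerivAt_flow_one hD).div (hasDerivAt_flow_zero hD) (hne t (ht₁ t ht).2.2.2)).arctan
  have hle : ∀ t ≤ t₁, 1 / (1 + (flow η t x 1 / flow η t x 0) ^ 2) *
        ((flow η t x 2 * flow η t x 0 - flow η t x 1 * flow η t x 1) / flow η t x 0 ^ 2)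
        ≤ -(k / 2) := by
    intro t ht
    obtain ⟨h1, h2, -, h4⟩ := ht₁ t ht
    have hx0 := hne t h4
    rw [graphPt_pr_eq_iff] at h2
    rw [← h2.1] at h1
    simp only [pr] at h1
    set X := flow η t x 0
    set Y := flow η t x 1
    set Z := flow η t x 2
    have hX : 0 < X ^ 2 := by positivity
    have e : 1 / (1 + (Y / X) ^ 2) * ((Z * X - Y * Y) / X ^ 2) =
        (Z * X - Y * Y) / (X ^ 2 + Y ^ 2) := by field_simp
    rw [e, div_le_iff₀ (by positivity)]
    have m1 : |(Z - (-X + c * Y)) * X| ≤ k / 2 * (X ^ 2 + Y ^ 2) := by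
      rw [abs_mul]
      have m2 : ‖(X, Y)‖ * |X| ≤ X ^ 2 + Y ^ 2 := by
        rw [Prod.norm_def]
        simp only [Real.norm_eq_abs]
        rcases max_cases |X| |Y| with h | h <;> rw [h.1] <;>
          nlinarith [sq_abs X, sq_abs Y, sq_nonneg (|X| - |Y|)]
      calc _ ≤ (k / 2 * ‖(X, Y)‖) * |X| := by gcongr
        _ = k / 2 * (‖(X, Y)‖ * |X|) := by ring
        _ ≤ _ := by gcongr
    have m3 : c * Y * X ≤ |c| / 2 * (X ^ 2 + Y ^ 2) := by
      have : |c * Y * X| ≤ |c| / 2 * (X ^ 2 + Y ^ 2) := by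
        rw [abs_mul, abs_mul]
        have : |Y| * |X| ≤ (X ^ 2 + Y ^ 2) / 2 := by
          nlinarith [sq_abs X, sq_abs Y, sq_nonneg (|X| - |Y|)]
        nlinarith [abs_nonneg c]
      exact (le_abs_self _).trans this
    have m4 := (le_abs_self _).trans m1
    have hkc : |c| / 2 = 1 - k := by rw [hk]; ring
    rw [hkc] at m3
    nlinarith
  have hπ := Real.pi_pos
  -- At rate at most `-k / 2`, this length makes the angle drop by at least `2π`.
  set t₂ := t₁ - 4 * Real.pi / k with ht₂
  have hlt : t₂ ≤ t₁ := by
    have : 0 < 4 * Real.pi / k := by positivity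
    linarith
  have := (convex_Iic t₁).image_sub_le_mul_sub_of_deriv_le
    (f := fun t => Real.arctan (flow η t x 1 / flow η t x 0))
    (fun t ht => (hd t ht).continuousAt.continuousWithinAt)
    (fun t ht => (hd t (le_of_mem_interior_Iic ht)).differentiableAt.differentiableWithinAt)
    (C := -(k / 2)) (fun t ht => by
      rw [(hd t (le_of_mem_interior_Iic ht)).deriv]; exact hle t (le_of_mem_interior_Iic ht))
    t₂ hlt t₁ self_mem_Iic hlt
  have e : -(k / 2) * (t₁ - t₂) = -(2 * Real.pi) := by
    rw [ht₂]; field_simp; ring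
  rw [e] at this
  have b1 := Real.neg_pi_div_two_lt_arctan (flow η t₁ x 1 / flow η t₁ x 0)
  have b2 := Real.arctan_lt_pi_div_two (flow η t₂ x 1 / flow η t₂ x 0)
  linarith

/-- Backward orbits in the unstable manifold spiral: `x₂` takes both signs infinitely often. -/
lemma exists_mul_flow_one_neg (hη : -2 < η ∧ η < 2) (h : IsLocalUnstableGraph η a b)
    (hg : IsInvariantGraph η R a b) (hR : R ≠ 0) (hx : x ∈ Wu η) (hx0 : x ≠ 0)
    {σ : ℝ} (hσ : σ ≠ 0) (t₀ : ℝ) : ∃ t < t₀, σ * flow η t x 1 < 0 := by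
  by_contra! hpos
  obtain ⟨hdom, hlim⟩ := mem_Wu_iff.1 hx
  obtain ⟨t₁, ht₁⟩ := eventually_atBot.1 ((h.eventually_graphPt_pr_flow hx).and
      ((eventually_le_atBot 0).and (eventually_lt_atBot t₀)))
  have hd : ∀ t ≤ t₁, HasDerivAt (fun t => σ * flow η t x 0) (σ * flow η t x 1) t := fun t ht =>
    (hasDerivAt_flow_zero (hdom (ht₁ t ht).2.1)).const_mul σ
  -- If `σ x₂` is never negative, `σ x₁` increases from its limit 0 at `-∞`. Having a zero, it
  -- vanishes at all earlier times, and so does its derivative `σ x₂`; the orbit is then at the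
  -- origin.
  have hmono : MonotoneOn (fun t => σ * flow η t x 0) (Iic t₁) :=
    monotoneOn_of_hasDerivWithinAt_nonneg (convex_Iic t₁)
      (fun t ht => (hd t ht).continuousAt.continuousWithinAt)
      (fun t ht => (hd t (le_of_mem_interior_Iic ht)).hasDerivWithinAt)
      (fun t ht => hpos t (ht₁ t (le_of_mem_interior_Iic ht)).2.2)
  have hl0 : Tendsto (fun t => σ * flow η t x 0) atBot (𝓝 0) := by
    have := ((continuous_apply (0 : Fin 4)).tendsto (0 : E4)).comp hlim
    simpa using! this.const_mul σ
  have hnn : ∀ t ≤ t₁, 0 ≤ σ * flow η t x 0 := fun t ht =>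
    le_of_tendsto hl0 (by
      filter_upwards [eventually_le_atBot t] with s hs using hmono (hs.trans ht) ht hs)
  obtain ⟨t, ht, h0⟩ := exists_flow_zero_eq_zero hη h hg hR hx t₁
  have hz : ∀ s ≤ t, flow η s x 0 = 0 := by
    intro s hs
    have h1 := hmono (show s ∈ Iic t₁ from hs.trans ht) ht hs
    simp only [h0, mul_zero] at h1
    have := le_antisymm h1 (hnn s (hs.trans ht))
    simpa [hσ] using this
  have h1 : flow η (t - 1) x 1 = 0 := by
    have e1 := hasDerivAt_flow_zero (hdom (ht₁ (t - 1) (by linarith)).2.1)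
    have e2 : (fun s => flow η s x 0) =ᶠ[𝓝 (t - 1)] fun _ => 0 := by
      filter_upwards [Iic_mem_nhds (show t - 1 < t by linarith)] with s hs using hz s hs
    exact e1.unique ((hasDerivAt_const (t - 1) (0 : ℝ)).congr_of_eventuallyEq e2)
  have hpr : pr (flow η (t - 1) x) = 0 := by
    simp [pr, hz (t - 1) (by linarith), h1]
  obtain ⟨h2, h3, -⟩ := ht₁ (t - 1) (by linarith)
  rw [hpr] at h2
  have h4 : graphPt a b 0 = 0 := by
    funext i
    fin_cases i <;> simp [graphPt, h.zero]
  have h5 := (flow_neg (hdom h3)).2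
  rw [← h2, h4, (flow_zero_right η _).2] at h5
  exact hx0 h5.symm

lemma continuousAt_flow_left (ht : t ∈ flowDomain η x) : ContinuousAt (fun y => flow η t y) x :=
  ContinuousAt.comp (f := fun y => (y, t)) (continuousAt_flow ht) (by fun_prop)

lemma eventually_mem_flowDomain_left (ht : t ∈ flowDomain η x) :
    ∀ᶠ y in 𝓝 x, t ∈ flowDomain η y :=
  (Continuous.prodMk_left t).continuousAt.eventually (eventually_mem_flowDomain ht)

lemma continuousAt_flow_one (ht : t ∈ flowDomain η x) :
    ContinuousAt (fun y => flow η t y 1) x :=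
  (continuous_apply (1 : Fin 4)).continuousAt.comp (continuousAt_flow_left ht)

/-- Points near a point of the unstable manifold have many crossings with `S` in the past. -/
lemma exists_eventually_le_encard (hη : -2 < η ∧ η < 2) (h : IsLocalUnstableGraph η a b)
    (hg : IsInvariantGraph η R a b) (hR : R ≠ 0) (hx : x ∈ Wu η) (hx0 : x ≠ 0) (n : ℕ) :
    ∃ L > 0, 0 < flow η (-L) x 1 ∧ ∀ᶠ y in 𝓝 x, -L ∈ flowDomain η y ∧
      n ≤ {s ∈ Ioo (-L) 0 | flow η s y ∈ S}.encard := by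
  have hdom := (mem_Wu_iff.1 hx).1
  have hp : ∀ t₀, ∃ t < t₀, 0 < flow η t x 1 := fun t₀ => by
    simpa using exists_mul_flow_one_neg hη h hg hR hx hx0 (σ := -1) (by norm_num) t₀
  have hm : ∀ t₀, ∃ t < t₀, flow η t x 1 < 0 := fun t₀ => by
    simpa using exists_mul_flow_one_neg hη h hg hR hx hx0 (σ := 1) (by norm_num) t₀
  -- Each step goes further back to a negative and then to a positive value of `x₂`; the
  -- intermediate value theorem adds a crossing, also for nearby points.
  induction n with
  | zero =>
    obtain ⟨t, ht, h1⟩ := hp 0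
    refine ⟨-t, by linarith, by simpa using h1, ?_⟩
    filter_upwards [eventually_mem_flowDomain_left (hdom ht.le)] with y hy
    simpa using hy
  | succ n ih =>
    obtain ⟨L, hL, hL1, hev⟩ := ih
    obtain ⟨t, ht, ht1⟩ := hm (-L)
    obtain ⟨t', ht', ht'1⟩ := hp t
    have hD : t' ∈ flowDomain η x := hdom (by simp only [mem_Iic]; linarith)
    have hDt : t ∈ flowDomain η x := hdom (by simp only [mem_Iic]; linarith)
    refine ⟨-t', by linarith, by simpa using ht'1, ?_⟩
    filter_upwards [hev, eventually_mem_flowDomain_left hD,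
      (continuousAt_flow_one hD).eventually_const_lt ht'1,
      (continuousAt_flow_one hDt).eventually_lt_const ht1] with y hy hy1 hy2 hy3
    rw [neg_neg]
    refine ⟨hy1, ?_⟩
    have hsub : Icc t' 0 ⊆ flowDomain η y := by
      have := flowDomain_subset hy1
      rwa [uIcc_of_ge (by linarith)] at this
    have hcont : ContinuousOn (fun s => flow η s y 1) (Icc t' t) := fun s hs =>
      (hasDerivAt_flow_one (hsub ⟨hs.1, by linarith [hs.2]⟩)).continuousAt.continuousWithinAt
    obtain ⟨s, hs, hs0⟩ := intermediate_value_Ioo' ht'.le hcont ⟨hy3, hy2⟩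
    have hnot : s ∉ {s ∈ Ioo (-L) 0 | flow η s y ∈ S} := fun hmem => by
      have := hmem.1.1
      linarith [hs.2]
    have hins : insert s {s ∈ Ioo (-L) 0 | flow η s y ∈ S} ⊆
        {s ∈ Ioo t' 0 | flow η s y ∈ S} := by
      rw [insert_subset_iff]
      refine ⟨⟨⟨hs.1, by linarith [hs.2]⟩, hs0⟩, fun τ hτ => ⟨⟨by linarith [hτ.1.1], hτ.1.2⟩, hτ.2⟩⟩
    refine le_trans ?_ (encard_le_encard hins)
    rw [encard_insert_of_notMem hnot]
    push_cast
    gcongr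
    exact hy.2

end

end Bifocus

/-! ### Iterates of the Poincaré map as counts of crossings. -/

namespace Bifocus

noncomputable section

variable {η : ℝ} {x y : E4} {s t : ℝ}

lemma flow_add_of_mem (ht : t ∈ flowDomain η x) (hs : t + s ∈ flowDomain η x) :
    s ∈ flowDomain η (flow η t x) ∧ flow η s (flow η t x) = flow η (t + s) x := by
  simpa using flow_sub ht hs

/-- The times in `(-t, 0]` at which the orbit of `y` is in `S`. -/
def pastCrossings (η t : ℝ) (y : E4) : Set ℝ := {s ∈ Ioc (-t) 0 | flow η s y ∈ S}

lemma isReturnTime_iff_backward (h : -t ∈ flowDomain η y) :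
    IsReturnTime η (flow η (-t) y) t ↔ 0 < t ∧ y ∈ S ∧ ∀ s ∈ Ioo (-t) 0, flow η s y ∉ S := by
  have h0 := flow_neg h
  rw [neg_neg] at h0
  have hs : ∀ s ∈ Ioo (-t) 0, flow η (s + t) (flow η (-t) y) = flow η s y := fun s hs => by
    have h1 : s ∈ flowDomain η y :=
      flowDomain_subset h (by rw [uIcc_of_ge (by linarith [hs.1, hs.2])]; exact ⟨hs.1.le, hs.2.le⟩)
    have := (flow_sub h h1).2
    rwa [sub_neg_eq_add] at this
  constructor
  · rintro ⟨h1, -, h3, h4⟩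
    refine ⟨h1, by rwa [h0.2] at h3, fun s hs' => ?_⟩
    rw [← hs s hs']
    exact h4 _ ⟨by linarith [hs'.1], by linarith [hs'.2]⟩
  · rintro ⟨h1, h2, h3⟩
    refine ⟨h1, h0.1, by rwa [h0.2], fun s hs' => ?_⟩
    have h5 : s - t ∈ Ioo (-t) 0 := ⟨by linarith [hs'.1], by linarith [hs'.2]⟩
    have := hs _ h5
    rw [sub_add_cancel] at this
    rw [this]
    exact h3 _ h5

lemma mem_poincareImage_iff {A : Set E4} : y ∈ poincareImage η A ↔
    ∃ t > 0, -t ∈ flowDomain η y ∧ flow η (-t) y ∈ A ∧ y ∈ S ∧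
      ∀ s ∈ Ioo (-t) 0, flow η s y ∉ S := by
  constructor
  · rintro ⟨x, hx, t, ht, rfl⟩
    have h0 := flow_neg ht.2.1
    have ht' := ht
    rw [← h0.2, isReturnTime_iff_backward h0.1] at ht'
    exact ⟨t, ht.1, h0.1, by rwa [h0.2], ht'.2⟩
  · rintro ⟨t, ht, hD, hA, hS, hno⟩
    refine ⟨_, hA, t, (isReturnTime_iff_backward hD).2 ⟨ht, hS, hno⟩, ?_⟩
    simpa using (flow_neg hD).2

lemma pastCrossings_eq_insert {t₁ : ℝ} (ht : 0 < t₁) (htt : t₁ ≤ t) (hD : -t ∈ flowDomain η y)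
    (hS : y ∈ S) (hno : ∀ s ∈ Ioo (-t₁) 0, flow η s y ∉ S) :
    pastCrossings η t y =
      insert 0 ((fun s => s - t₁) '' pastCrossings η (t - t₁) (flow η (-t₁) y)) := by
  have hsub : Icc (-t) 0 ⊆ flowDomain η y := by
    have := flowDomain_subset hD
    rwa [uIcc_of_ge (by linarith)] at this
  have h1 : -t₁ ∈ flowDomain η y := hsub ⟨by linarith, by linarith⟩
  have hs : ∀ s ∈ Ioc (-t) 0, flow η (s + t₁) (flow η (-t₁) y) = flow η s y := fun s hs => by
    have := (flow_sub h1 (hsub ⟨hs.1.le, hs.2⟩)).2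
    rwa [sub_neg_eq_add] at this
  ext s
  simp only [pastCrossings, mem_insert_iff, mem_image]
  constructor
  · rintro ⟨hst, hsS⟩
    rcases eq_or_ne s 0 with h0 | h0
    · exact Or.inl h0
    · right
      have hneg : s < 0 := lt_of_le_of_ne hst.2 h0
      have : s ≤ -t₁ := by
        by_contra! hlt
        exact hno s ⟨hlt, hneg⟩ hsS
      exact ⟨s + t₁, ⟨⟨by linarith [hst.1], by linarith⟩, by rwa [hs s hst]⟩, by ring⟩
  · rintro (h0 | ⟨σ, ⟨hσ, hσS⟩, rfl⟩)
    · subst h0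
      exact ⟨⟨by linarith, le_rfl⟩, by simpa using hS⟩
    · have h2 : σ - t₁ ∈ Ioc (-t) 0 := ⟨by linarith [hσ.1], by linarith [hσ.2]⟩
      have := hs _ h2
      rw [sub_add_cancel] at this
      exact ⟨h2, by rwa [← this]⟩

lemma encard_pastCrossings {t₁ : ℝ} (ht : 0 < t₁) (htt : t₁ ≤ t) (hD : -t ∈ flowDomain η y)
    (hS : y ∈ S) (hno : ∀ s ∈ Ioo (-t₁) 0, flow η s y ∉ S) :
    (pastCrossings η t y).encard = (pastCrossings η (t - t₁) (flow η (-t₁) y)).encard + 1 := by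
  rw [pastCrossings_eq_insert ht htt hD hS hno, encard_insert_of_notMem,
    Function.Injective.encard_image (sub_left_injective)]
  rintro ⟨σ, ⟨hσ, -⟩, h⟩
  simp only at h
  linarith [hσ.2]

/-- The iterated first return is replaced by one count along a backward orbit, which can be
perturbed. The half-open interval `(-t, 0]` counts `y` itself but not the starting point in `A`,
even if that lies in `S`. -/
lemma mem_crossings_succ_iff {A : Set E4} {k : ℕ} : y ∈ crossings η A (k + 1) ↔
    ∃ t > 0, -t ∈ flowDomain η y ∧ flow η (-t) y ∈ A ∧ y ∈ S ∧
      (pastCrossings η t y).encard = k + 1 := by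
  induction k generalizing y with
  | zero =>
    rw [crossings, mem_poincareImage_iff]
    refine exists_congr fun t => and_congr_right fun ht => and_congr_right fun hD =>
      and_congr_right fun _ => and_congr_right fun hS => ?_
    constructor
    · intro hno
      rw [encard_pastCrossings ht le_rfl hD hS hno]
      simp [pastCrossings]
    · intro hc s hs hsS
      have h1 : (pastCrossings η t y).encard = 1 := by simpa using hc
      obtain ⟨z, hz⟩ := encard_eq_one.1 h1
      have m0 : (0 : ℝ) ∈ pastCrossings η t y := ⟨⟨by linarith, le_rfl⟩, by simpa using hS⟩
      have m1 : s ∈ pastCrossings η t y := ⟨⟨hs.1, hs.2.le⟩, hsS⟩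
      rw [hz, mem_singleton_iff] at m0 m1
      linarith [hs.2]
  | succ k ih =>
    rw [crossings, mem_poincareImage_iff]
    constructor
    · rintro ⟨t₁, ht₁, hD₁, hA, hS, hno⟩
      obtain ⟨t₂, ht₂, hD₂, hA₂, -, hc⟩ := ih.1 hA
      have h := flow_add hD₁ hD₂
      have e : -t₁ + -t₂ = -(t₁ + t₂) := by ring
      rw [e] at h
      refine ⟨t₁ + t₂, by linarith, h.1, by rw [h.2]; exact hA₂, hS, ?_⟩
      rw [encard_pastCrossings ht₁ (by linarith) h.1 hS hno, add_sub_cancel_left, hc]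
      push_cast
      rfl
    · rintro ⟨t, ht, hD, hA, hS, hc⟩
      set Z := pastCrossings η t y with hZ
      have hfin : Z.Finite := finite_of_encard_eq_coe (k := k + 1 + 1) (by rw [hc]; push_cast; rfl)
      have m0 : (0 : ℝ) ∈ Z := ⟨⟨by linarith, le_rfl⟩, by simpa using hS⟩
      have hne : (Z \ {0}).Nonempty := by
        rw [← encard_ne_zero]
        intro h0
        have h1 := encard_sdiff_singleton_add_one m0
        rw [h0, hc] at h1
        have h2 : ((0 + 1 : ℕ) : ℕ∞) = ((k + 1 + 1 : ℕ) : ℕ∞) := by push_cast; exact h1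
        have := ENat.natCast_inj.1 h2
        omega
      -- The last crossing before `y` is its preimage under the Poincaré map and has one past
      -- crossing less.
      obtain ⟨m, hm, hmax⟩ := (hfin.subset sdiff_subset).exists_maximal hne
      have hm0 : m < 0 := lt_of_le_of_ne hm.1.1.2 hm.2
      have hmt : -t < m := hm.1.1.1
      have hno : ∀ s ∈ Ioo (-(-m)) 0, flow η s y ∉ S := by
        intro s hs hsS
        rw [neg_neg] at hs
        have : s ∈ Z \ {0} := ⟨⟨⟨by linarith [hs.1], hs.2.le⟩, hsS⟩, hs.2.ne⟩
        linarith [hmax this hs.1.le, hs.1]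
      have hDm : m ∈ flowDomain η y :=
        flowDomain_subset hD (by rw [uIcc_of_ge (by linarith)]; exact ⟨hmt.le, hm0.le⟩)
      have hcm := encard_pastCrossings (t₁ := -m) (by linarith) (by linarith) hD hS hno
      rw [hc, neg_neg] at hcm
      refine ⟨-m, by linarith, by rwa [neg_neg], ?_, hS, hno⟩
      rw [neg_neg, ih]
      have e : -(t - -m) = -t - m := by ring
      have h := flow_sub hDm hD
      refine ⟨t - -m, by linarith, by rw [e]; exact h.1, by rw [e, h.2]; exact hA, hm.1.2, ?_⟩
      push_cast at hcm
      exact (WithTop.add_right_inj (by simp : (1 : ℕ∞) ≠ ⊤)).1 hcm.symm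

/-- The number of zeros of a function on an interval is locally constant under perturbations if the
zeros are simple and none is an end point. -/
lemma eventually_encard_zeros_eq {X : Type*} [TopologicalSpace X] {f f' : X → ℝ → ℝ} {x₀ : X}
    {A B : ℝ} (hf : ∀ t ∈ Icc A B, ContinuousAt (fun p : X × ℝ => f p.1 p.2) (x₀, t))
    (hf' : ∀ t ∈ Icc A B, ContinuousAt (fun p : X × ℝ => f' p.1 p.2) (x₀, t))
    (hd : ∀ᶠ x in 𝓝 x₀, ∀ t ∈ Icc A B, HasDerivAt (f x) (f' x t) t)
    (hA : f x₀ A ≠ 0) (hB : f x₀ B ≠ 0) (hz : ∀ t ∈ Icc A B, f x₀ t = 0 → f' x₀ t ≠ 0)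
    {n : ℕ} (hn : {t ∈ Icc A B | f x₀ t = 0}.encard = n) :
    ∀ᶠ x in 𝓝 x₀, {t ∈ Icc A B | f x t = 0}.encard = n := by
  have hnz : ∀ c d, Icc c d ⊆ Icc A B → (∀ t ∈ Icc c d, f x₀ t ≠ 0) →
      ∀ᶠ x in 𝓝 x₀, ∀ t ∈ Icc c d, f x t ≠ 0 := fun c d hcd h =>
    isCompact_Icc.eventually_forall_of_forall_eventually fun t ht =>
      (hf t (hcd ht)).eventually_ne (h t ht)
  -- The induction peels off the last zero `m`, which is why the right end point varies.
  induction n generalizing B with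
  | zero =>
    rw [Nat.cast_zero, encard_eq_zero] at hn
    have h0 : ∀ t ∈ Icc A B, f x₀ t ≠ 0 := fun t ht h =>
      notMem_empty t (hn ▸ (show t ∈ {t ∈ Icc A B | f x₀ t = 0} from ⟨ht, h⟩))
    filter_upwards [hnz A B subset_rfl h0] with x hx
    rw [Nat.cast_zero, encard_eq_zero, eq_empty_iff_forall_notMem]
    exact fun t ht => hx t ht.1 ht.2
  | succ n ih =>
    set Z := {t ∈ Icc A B | f x₀ t = 0} with hZ
    have hfin : Z.Finite := finite_of_encard_eq_coe hn
    have hne : Z.Nonempty := by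
      rw [← encard_ne_zero, hn]
      simp
    obtain ⟨m, hm, hmax⟩ := hfin.exists_maximal hne
    have hAm : A < m := lt_of_le_of_ne hm.1.1 fun h => hA (h ▸ hm.2)
    have hmB : m < B := lt_of_le_of_ne hm.1.2 fun h => hB (h ▸ hm.2)
    -- Multiplying by `σ` makes the function increasing near `m`, whichever the direction of the
    -- crossing.
    set σ := f' x₀ m with hσ
    have hσ0 : σ ≠ 0 := hz m hm.1 hm.2
    have hpos : ∀ᶠ p : X × ℝ in 𝓝 (x₀, m), 0 < σ * f' p.1 p.2 :=
      ((hf' m hm.1).const_mul σ).eventually_const_lt (mul_self_pos.2 hσ0)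
    obtain ⟨V, hV, W, hW, hVW⟩ := mem_nhds_prod_iff.1 hpos
    obtain ⟨ε, hε, hball⟩ := Metric.mem_nhds_iff.1 hW
    -- The window of radius `δ` around `m` lies inside `(A, B)` and in the region where `σ * f'` is
    -- positive; perturbed functions have exactly one zero in it and none to its right.
    set δ := min (ε / 2) (min ((m - A) / 2) ((B - m) / 2)) with hδ
    have hδ0 : 0 < δ := lt_min (by linarith) (lt_min (by linarith) (by linarith))
    have hδ1 : δ ≤ ε / 2 := min_le_left _ _
    have hδ2 : δ ≤ (m - A) / 2 := (min_le_right _ _).trans (min_le_left _ _)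
    have hδ3 : δ ≤ (B - m) / 2 := (min_le_right _ _).trans (min_le_right _ _)
    have hcW : ∀ t ∈ Icc (m - δ) (m + δ), t ∈ W := fun t ht => hball (by
      rw [Metric.mem_ball, Real.dist_eq, abs_lt]
      constructor <;> linarith [ht.1, ht.2])
    have hsub : Icc (m - δ) (m + δ) ⊆ Icc A B := Icc_subset_Icc (by linarith) (by linarith)
    have hmono : ∀ᶠ x in 𝓝 x₀, StrictMonoOn (fun t => σ * f x t) (Icc (m - δ) (m + δ)) := by
      filter_upwards [hV, hd] with x hx hdx
      refine strictMonoOn_of_hasDerivWithinAt_pos (convex_Icc _ _)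
        (fun t ht => ((hdx t (hsub ht)).const_mul σ).continuousAt.continuousWithinAt)
        (fun t ht => ((hdx t (hsub (interior_subset ht))).const_mul σ).hasDerivWithinAt)
        (fun t ht => hVW (mk_mem_prod hx (hcW t (interior_subset ht))))
    have hm1 : m - δ ∈ Icc (m - δ) (m + δ) := ⟨le_rfl, by linarith⟩
    have hm2 : m ∈ Icc (m - δ) (m + δ) := ⟨by linarith, by linarith⟩
    have hm3 : m + δ ∈ Icc (m - δ) (m + δ) := ⟨by linarith, le_rfl⟩
    have hmono₀ := hmono.self_of_nhds
    have hl₀ : σ * f x₀ (m - δ) < 0 := by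
      have := hmono₀ hm1 hm2 (by linarith)
      simpa [hm.2] using this
    have hr₀ : 0 < σ * f x₀ (m + δ) := by
      have := hmono₀ hm2 hm3 (by linarith)
      simpa [hm.2] using this
    have hcl : ∀ t ∈ Icc A B, ContinuousAt (fun x => σ * f x t) x₀ := fun t ht =>
      (ContinuousAt.comp (f := fun x => (x, t)) (hf t ht) (by fun_prop)).const_mul σ
    have hright : ∀ᶠ x in 𝓝 x₀, ∀ t ∈ Icc (m + δ) B, f x t ≠ 0 :=
      hnz _ _ (Icc_subset_Icc_left (by linarith)) fun t ht h => by
        have : t ∈ Z := ⟨⟨by linarith [ht.1], ht.2⟩, h⟩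
        linarith [hmax this (by linarith [ht.1]), ht.1]
    have hins : ∀ᶠ x in 𝓝 x₀, ∃ τ, τ ∉ {t ∈ Icc A (m - δ) | f x t = 0} ∧
        {t ∈ Icc A B | f x t = 0} = insert τ {t ∈ Icc A (m - δ) | f x t = 0} := by
      filter_upwards [hmono, hright, hd, (hcl _ (hsub hm1)).eventually_lt_const hl₀,
        (hcl _ (hsub hm3)).eventually_const_lt hr₀] with x h1 h2 h3 h4 h5
      have hcont : ContinuousOn (fun t => σ * f x t) (Icc (m - δ) (m + δ)) := fun t ht =>
        ((h3 t (hsub ht)).const_mul σ).continuousAt.continuousWithinAt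
      obtain ⟨τ, hτ, hτ0⟩ := intermediate_value_Ioo (by linarith) hcont ⟨h4, h5⟩
      have hτ0' : f x τ = 0 := by simpa [hσ0] using hτ0
      refine ⟨τ, fun h => by linarith [h.1.2, hτ.1], ?_⟩
      ext t
      simp only [mem_insert_iff]
      constructor
      · rintro ⟨ht, ht0⟩
        rcases le_total t (m - δ) with h | h
        · exact Or.inr ⟨⟨ht.1, h⟩, ht0⟩
        · rcases le_total t (m + δ) with h' | h'
          · left
            refine h1.injOn ⟨h, h'⟩ ⟨hτ.1.le, hτ.2.le⟩ ?_
            simp [ht0, hτ0']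
          · exact absurd ht0 (h2 t ⟨h', ht.2⟩)
      · rintro (rfl | ⟨ht, ht0⟩)
        · exact ⟨hsub ⟨hτ.1.le, hτ.2.le⟩, hτ0'⟩
        · exact ⟨⟨ht.1, by linarith [ht.2]⟩, ht0⟩
    have hsub' : Icc A (m - δ) ⊆ Icc A B := Icc_subset_Icc_right (by linarith)
    obtain ⟨τ₀, hτ₀, he₀⟩ := hins.self_of_nhds
    have hcard : {t ∈ Icc A (m - δ) | f x₀ t = 0}.encard = n := by
      have h1 := encard_insert_of_notMem hτ₀
      rw [← he₀, ← hZ, hn] at h1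
      push_cast at h1
      exact (WithTop.add_right_inj (by simp : (1 : ℕ∞) ≠ ⊤)).1 h1.symm
    have hih := ih (B := m - δ) (fun t ht => hf t (hsub' ht)) (fun t ht => hf' t (hsub' ht))
      (hd.mono fun x hx t ht => hx t (hsub' ht))
      (fun h => by rw [h] at hl₀; simp at hl₀) (fun t ht => hz t (hsub' ht)) hcard
      (fun c d hcd h => hnz c d (hcd.trans hsub') h)
    filter_upwards [hih, hins] with x hx ⟨τ, hτ, he⟩
    have h1 := encard_insert_of_notMem (s := {t ∈ Icc A (m - δ) | f x t = 0}) (a := τ) hτ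
    rw [← he, hx] at h1
    rw [h1]
    push_cast
    rfl

end

end Bifocus

/-! ### The fold: two crossings of `S` near a point of `v₁`. -/

namespace Bifocus

noncomputable section

variable {η : ℝ} {x y : E4} {s t : ℝ}

/-- A convex function which is positive at the end points of an interval and nonpositive at its
minimum has a first and a last zero. -/
lemma exists_first_last_zero {g g₁ : ℝ → ℝ} {A B m : ℝ}
    (hg : ∀ t ∈ Icc A B, HasDerivAt g (g₁ t) t) (hg₁ : StrictMonoOn g₁ (Icc A B))
    (hm : m ∈ Ioo A B) (hm₁ : g₁ m = 0) (hgm : g m ≤ 0) (hA : 0 < g A) (hB : 0 < g B) :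
    ∃ lo hi, A < lo ∧ lo ≤ m ∧ m ≤ hi ∧ hi < B ∧ g lo = 0 ∧ g hi = 0 ∧
      (∀ t ∈ Icc A B, t < lo ∨ hi < t → 0 < g t) ∧ (∀ t ∈ Ioo lo hi, g t < 0) ∧
      (g m < 0 → lo < m ∧ m < hi) ∧ (g m = 0 → lo = m ∧ hi = m) := by
  have hmI : m ∈ Icc A B := Ioo_subset_Icc_self hm
  have s1 : Icc A m ⊆ Icc A B := Icc_subset_Icc_right hm.2.le
  have s2 : Icc m B ⊆ Icc A B := Icc_subset_Icc_left hm.1.le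
  have ha : StrictAntiOn g (Icc A m) :=
    strictAntiOn_of_hasDerivWithinAt_neg (convex_Icc _ _)
      (fun t ht => (hg t (s1 ht)).continuousAt.continuousWithinAt)
      (fun t ht => (hg t (s1 (interior_subset ht))).hasDerivWithinAt)
      (fun t ht => by
        rw [interior_Icc] at ht
        rw [← hm₁]
        exact hg₁ (s1 (Ioo_subset_Icc_self ht)) hmI ht.2)
  have hb : StrictMonoOn g (Icc m B) :=
    strictMonoOn_of_hasDerivWithinAt_pos (convex_Icc _ _)
      (fun t ht => (hg t (s2 ht)).continuousAt.continuousWithinAt)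
      (fun t ht => (hg t (s2 (interior_subset ht))).hasDerivWithinAt)
      (fun t ht => by
        rw [interior_Icc] at ht
        rw [← hm₁]
        exact hg₁ hmI (s2 (Ioo_subset_Icc_self ht)) ht.1)
  rcases hgm.lt_or_eq with h | h
  · have hc : ContinuousOn g (Icc A B) := fun t ht => (hg t ht).continuousAt.continuousWithinAt
    obtain ⟨lo, hlo, hlo0⟩ := intermediate_value_Ioo' hm.1.le (hc.mono s1) ⟨h, hA⟩
    obtain ⟨hi, hhi, hhi0⟩ := intermediate_value_Ioo hm.2.le (hc.mono s2) ⟨h, hB⟩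
    refine ⟨lo, hi, hlo.1, hlo.2.le, hhi.1.le, hhi.2, hlo0, hhi0, ?_, ?_,
      fun _ => ⟨hlo.2, hhi.1⟩, fun h' => absurd h' h.ne⟩
    · rintro t ht (h' | h')
      · rw [← hlo0]
        exact ha ⟨ht.1, h'.le.trans hlo.2.le⟩ (Ioo_subset_Icc_self hlo) h'
      · rw [← hhi0]
        exact hb (Ioo_subset_Icc_self hhi) ⟨hhi.1.le.trans h'.le, ht.2⟩ h'
    · intro t ht
      rcases le_total t m with h' | h'
      · rw [← hlo0]
        exact ha (Ioo_subset_Icc_self hlo) ⟨hlo.1.le.trans ht.1.le, h'⟩ ht.1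
      · rw [← hhi0]
        exact hb ⟨h', ht.2.le.trans hhi.2.le⟩ (Ioo_subset_Icc_self hhi) ht.2
  · refine ⟨m, m, hm.1, le_rfl, le_rfl, hm.2, h, h, ?_, fun t ht => ?_,
      fun h' => absurd h h'.ne, fun _ => ⟨rfl, rfl⟩⟩
    · rintro t ht (h' | h')
      · rw [← h]
        exact ha ⟨ht.1, h'.le⟩ ⟨hm.1.le, le_rfl⟩ h'
      · rw [← h]
        exact hb ⟨le_rfl, hm.2.le⟩ ⟨h'.le, ht.2⟩ h'
    · exact absurd (ht.1.trans ht.2) (lt_irrefl _)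

/-- The zeros may merge, so the implicit function theorem does not apply at a double zero; the sign
pattern suffices. Positivity on `[A, τ]` persists and bounds `lo` from below. From above, one uses a
negative value just after `lo`, or, if `lo = hi`, positivity on `[τ, B]`. -/
lemma continuousOn_first_zero {I : Set ℝ} {g : ℝ → ℝ → ℝ} {lo hi : ℝ → ℝ} {A B : ℝ}
    (hg : ∀ s ∈ I, ∀ t ∈ Icc A B, ContinuousAt (fun p : ℝ × ℝ => g p.1 p.2) (s, t))
    (hA : ∀ s ∈ I, A < lo s) (hB : ∀ s ∈ I, hi s < B) (hle : ∀ s ∈ I, lo s ≤ hi s)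
    (h0 : ∀ s ∈ I, g s (lo s) = 0)
    (hpos : ∀ s ∈ I, ∀ t ∈ Icc A B, t < lo s ∨ hi s < t → 0 < g s t)
    (hneg : ∀ s ∈ I, ∀ t ∈ Ioo (lo s) (hi s), g s t < 0) : ContinuousOn lo I := by
  intro s₀ hs₀
  have hA₀ := hA s₀ hs₀
  have hB₀ := hB s₀ hs₀
  have hle₀ := hle s₀ hs₀
  have key : ∀ c d, Icc c d ⊆ Icc A B → (∀ t ∈ Icc c d, 0 < g s₀ t) →
      ∀ᶠ s in 𝓝[I] s₀, ∀ t ∈ Icc c d, 0 < g s t := fun c d hcd h =>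
    (isCompact_Icc.eventually_forall_of_forall_eventually fun t ht =>
      (hg s₀ hs₀ t (hcd ht)).eventually_const_lt (h t ht)).filter_mono nhdsWithin_le_nhds
  have hmem : ∀ᶠ s in 𝓝[I] s₀, s ∈ I := eventually_mem_nhdsWithin
  refine tendsto_order.2 ⟨fun τ hτ => ?_, fun τ hτ => ?_⟩
  · filter_upwards [key A τ (Icc_subset_Icc_right (by linarith)) fun t ht =>
      hpos s₀ hs₀ t ⟨ht.1, by linarith [ht.2]⟩ (Or.inl (ht.2.trans_lt hτ)), hmem] with s hs hsI
    by_contra! hcon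
    have := hs (lo s) ⟨(hA s hsI).le, hcon⟩
    rw [h0 s hsI] at this
    exact lt_irrefl _ this
  · rcases hle₀.lt_or_eq with h | h
    · obtain ⟨t', ht'1, ht'2⟩ := exists_between (lt_min hτ h)
      have ht'3 : t' < τ := ht'2.trans_le (min_le_left _ _)
      have ht'4 : t' < hi s₀ := ht'2.trans_le (min_le_right _ _)
      have hI' : t' ∈ Icc A B := ⟨by linarith, by linarith⟩
      have hc : ContinuousAt (fun s => g s t') s₀ :=
        ContinuousAt.comp (f := fun s => (s, t')) (hg s₀ hs₀ t' hI') (by fun_prop)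
      filter_upwards [(hc.eventually_lt_const (hneg s₀ hs₀ t' ⟨ht'1, ht'4⟩)).filter_mono
        nhdsWithin_le_nhds, hmem] with s hs hsI
      by_contra! hcon
      exact lt_asymm hs (hpos s hsI t' hI' (Or.inl (ht'3.trans_le hcon)))
    · filter_upwards [key τ B (Icc_subset_Icc_left (by linarith)) fun t ht =>
        hpos s₀ hs₀ t ⟨by linarith [ht.1], ht.2⟩ (Or.inr (by linarith [ht.1])), hmem] with s hs hsI
      by_contra! hcon
      have := hs (lo s) ⟨hcon, (hle s hsI).trans (hB s hsI).le⟩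
      rw [h0 s hsI] at this
      exact lt_irrefl _ this

/-- Reversing time exchanges first and last zeros. -/
lemma continuousOn_last_zero {I : Set ℝ} {g : ℝ → ℝ → ℝ} {lo hi : ℝ → ℝ} {A B : ℝ}
    (hg : ∀ s ∈ I, ∀ t ∈ Icc A B, ContinuousAt (fun p : ℝ × ℝ => g p.1 p.2) (s, t))
    (hA : ∀ s ∈ I, A < lo s) (hB : ∀ s ∈ I, hi s < B) (hle : ∀ s ∈ I, lo s ≤ hi s)
    (h0 : ∀ s ∈ I, g s (hi s) = 0)
    (hpos : ∀ s ∈ I, ∀ t ∈ Icc A B, t < lo s ∨ hi s < t → 0 < g s t)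
    (hneg : ∀ s ∈ I, ∀ t ∈ Ioo (lo s) (hi s), g s t < 0) : ContinuousOn hi I := by
  have := continuousOn_first_zero (I := I) (g := fun s t => g s (-t)) (lo := fun s => -hi s)
    (hi := fun s => -lo s) (A := -B) (B := -A)
    (fun s hs t ht => ContinuousAt.comp (g := fun p : ℝ × ℝ => g p.1 p.2)
      (f := fun p : ℝ × ℝ => (p.1, -p.2)) (x := (s, t)) (hg s hs (-t) ⟨by linarith [ht.2], by linarith [ht.1]⟩) (by fun_prop))
    (fun s hs => neg_lt_neg (hB s hs)) (fun s hs => neg_lt_neg (hA s hs))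
    (fun s hs => neg_le_neg (hle s hs)) (fun s hs => by simpa using h0 s hs)
    (fun s hs t ht h => hpos s hs (-t) ⟨by linarith [ht.2], by linarith [ht.1]⟩
      (h.symm.imp (fun h => by linarith) fun h => by linarith))
    (fun s hs t ht => hneg s hs (-t) ⟨by linarith [ht.2], by linarith [ht.1]⟩)
  exact this.neg.congr fun s _ => (neg_neg (hi s)).symm

lemma continuousAt_flow_comp {c : ℝ → E4} (hc : ContinuousAt c s) (ht : t ∈ flowDomain η (c s)) :
    ContinuousAt (fun p : ℝ × ℝ => flow η p.2 (c p.1)) (s, t) :=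
  ContinuousAt.comp (f := fun p : ℝ × ℝ => (c p.1, p.2)) (continuousAt_flow ht)
    ((hc.comp (f := fun p : ℝ × ℝ => p.1) (x := (s, t)) continuousAt_fst).prodMk continuousAt_snd)

/-- Behaviour of a one-parameter family of orbits in the zero level set of `H` near a point of `v₁`
which the family crosses transversely: with the exception of the central one, the orbits cross `S`
twice, downwards and then upwards. -/
theorem exists_two_crossings {q₄ : ℝ} (hq₄ : 0 < q₄) {c : ℝ → E4} (hc0 : c 0 = ![0, 0, 0, q₄])
    (hc : ∀ᶠ s in 𝓝 0, ContinuousAt c s) (hH : ∀ᶠ s in 𝓝 0, H η (c s) = 0)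
    (hd0 : HasDerivAt (fun s => c s 0) 1 0) (hd2 : HasDerivAt (fun s => c s 2) 0 0)
    {ε₀ : ℝ} (hε₀ : 0 < ε₀) :
    ∃ ε, 0 < ε ∧ ε < ε₀ ∧ ∃ δ > 0, ∃ lo hi : ℝ → ℝ, lo 0 = 0 ∧ hi 0 = 0 ∧
      ContinuousOn lo (Icc (-δ) δ) ∧ ContinuousOn hi (Icc (-δ) δ) ∧
      ∀ s ∈ Icc (-δ) δ, ContinuousAt c s ∧ H η (c s) = 0 ∧ Icc (-ε) ε ⊆ flowDomain η (c s) ∧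
        -ε < lo s ∧ lo s ≤ hi s ∧ hi s < ε ∧
        (∀ t ∈ Icc (-ε) ε, flow η t (c s) ∈ S ↔ t = lo s ∨ t = hi s) ∧
        (s ≠ 0 → lo s < hi s ∧ 0 < s * flow η (lo s) (c s) 0 ∧ 0 < s * flow η (hi s) (c s) 0 ∧
          flow η (lo s) (c s) 2 < 0 ∧ 0 < flow η (hi s) (c s) 2) := by
  have hcc : ContinuousAt c 0 := hc.self_of_nhds
  have hF : ContinuousAt (fun p : ℝ × ℝ => flow η p.2 (c p.1)) (0, 0) :=
    continuousAt_flow_comp hcc (zero_mem_flowDomain η _)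
  have hFi : ∀ i, ContinuousAt (fun p : ℝ × ℝ => flow η p.2 (c p.1) i) (0, 0) := fun i =>
    (continuous_apply i).continuousAt.comp hF
  -- a box on which the flow is controlled
  have hdom : ∀ᶠ p : ℝ × ℝ in 𝓝 (0, 0), p.2 ∈ flowDomain η (c p.1) := by
    have h1 : ContinuousAt (fun p : ℝ × ℝ => (c p.1, p.2)) (0, 0) :=
      (hcc.comp (f := fun p : ℝ × ℝ => p.1) (x := (0, 0)) continuousAt_fst).prodMk continuousAt_snd
    exact h1.eventually (eventually_mem_flowDomain (zero_mem_flowDomain η (c 0)))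
  have h3 : ∀ᶠ p : ℝ × ℝ in 𝓝 (0, 0), q₄ / 2 < flow η p.2 (c p.1) 3 :=
    (hFi 3).eventually_const_lt (by simp [hc0, hq₄])
  -- With `x₃' > q₄ / 2` and `|x₁'| < q₄ / 16`, `x₃` moves at least eight times as fast as `x₁`.
  -- Hence, where `x₃` is small against `x₁`, little time has passed and `x₁` is still close to `s`.
  have h1 : ∀ᶠ p : ℝ × ℝ in 𝓝 (0, 0), |flow η p.2 (c p.1) 1| < q₄ / 16 :=
    (hFi 1).abs.eventually_lt_const (by simp [hc0, hq₄])
  have h0 : ∀ᶠ p : ℝ × ℝ in 𝓝 (0, 0), |flow η p.2 (c p.1) 0| < 1 / 2 :=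
    (hFi 0).abs.eventually_lt_const (by simp [hc0])
  have h31 : ∀ᶠ p : ℝ × ℝ in 𝓝 (0, 0),
      0 < flow η p.2 (c p.1) 3 - η / 2 * flow η p.2 (c p.1) 1 :=
    ((hFi 3).sub ((hFi 1).const_mul _)).eventually_const_lt (by simp [hc0, hq₄])
  have hc1 : ∀ᶠ s in 𝓝 (0 : ℝ), |c s 0 - s| ≤ 1 / 4 * |s| := by
    have := (hasDerivAt_iff_isLittleO_nhds_zero.1 hd0).def (by norm_num : (0 : ℝ) < 1 / 4)
    simpa [hc0] using this
  have hc2 : ∀ᶠ s in 𝓝 (0 : ℝ), |c s 2| ≤ 1 / 4 * |s| := by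
    have := (hasDerivAt_iff_isLittleO_nhds_zero.1 hd2).def (by norm_num : (0 : ℝ) < 1 / 4)
    simpa [hc0] using this
  obtain ⟨V, hV, W, hW, hVW⟩ := mem_nhds_prod_iff.1
    (hdom.and (h3.and (h1.and (h0.and h31))))
  obtain ⟨ε₁, hε₁, hballW⟩ := Metric.mem_nhds_iff.1 hW
  obtain ⟨ε, hε, hεlt⟩ := exists_between (lt_min hε₁ hε₀)
  have hεW : Icc (-ε) ε ⊆ W := fun t ht => hballW (by
    rw [Metric.mem_ball, Real.dist_eq, sub_zero, abs_lt]
    have := hεlt.trans_le (min_le_left _ _)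
    constructor <;> linarith [ht.1, ht.2])
  have hbox : ∀ s ∈ V, ∀ t ∈ Icc (-ε) ε, t ∈ flowDomain η (c s) ∧ q₄ / 2 < flow η t (c s) 3 ∧
      |flow η t (c s) 1| < q₄ / 16 ∧ |flow η t (c s) 0| < 1 / 2 ∧
      0 < flow η t (c s) 3 - η / 2 * flow η t (c s) 1 := fun s hs t ht =>
    hVW (mk_mem_prod hs (hεW ht))
  have hmono2 : ∀ s ∈ V, StrictMonoOn (fun t => flow η t (c s) 2) (Icc (-ε) ε) := fun s hs =>
    strictMonoOn_of_hasDerivWithinAt_pos (convex_Icc _ _)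
      (fun t ht => (hasDerivAt_flow_two (hbox s hs t ht).1).continuousAt.continuousWithinAt)
      (fun t ht => (hasDerivAt_flow_two (hbox s hs t (interior_subset ht)).1).hasDerivWithinAt)
      (fun t ht => by linarith [(hbox s hs t (interior_subset ht)).2.1])
  have hmε : -ε ∈ Icc (-ε) ε := ⟨le_rfl, by linarith⟩
  have hpε : ε ∈ Icc (-ε) ε := ⟨by linarith, le_rfl⟩
  have hzε : (0 : ℝ) ∈ Icc (-ε) ε := ⟨by linarith, hε.le⟩
  have h0V : (0 : ℝ) ∈ V := mem_of_mem_nhds hV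
  have hq2 : flow η 0 (c 0) 2 = 0 := by simp [hc0]
  have hq1 : flow η 0 (c 0) 1 = 0 := by simp [hc0]
  have hA2 : flow η (-ε) (c 0) 2 < 0 := by
    exact (hmono2 0 h0V hmε hzε (by linarith)).trans_eq hq2
  have hB2 : 0 < flow η ε (c 0) 2 := by
    exact hq2.symm.trans_lt (hmono2 0 h0V hzε hpε hε)
  have hA1 : 0 < flow η (-ε) (c 0) 1 := by
    have : StrictAntiOn (fun t => flow η t (c 0) 1) (Icc (-ε) 0) :=
      strictAntiOn_of_hasDerivWithinAt_neg (convex_Icc _ _)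
        (fun t ht => (hasDerivAt_flow_one
          (hbox 0 h0V t ⟨ht.1, by linarith [ht.2]⟩).1).continuousAt.continuousWithinAt)
        (fun t ht => (hasDerivAt_flow_one (hbox 0 h0V t ⟨(interior_subset ht).1,
          by linarith [(interior_subset ht).2]⟩).1).hasDerivWithinAt)
        (fun t ht => by
          rw [interior_Icc] at ht
          exact (hmono2 0 h0V ⟨ht.1.le, by linarith [ht.2]⟩ hzε ht.2).trans_eq hq2)
    exact hq1.symm.trans_lt (this ⟨le_rfl, by linarith⟩ ⟨by linarith, le_rfl⟩ (by linarith))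
  have hB1 : 0 < flow η ε (c 0) 1 := by
    have : StrictMonoOn (fun t => flow η t (c 0) 1) (Icc 0 ε) :=
      strictMonoOn_of_hasDerivWithinAt_pos (convex_Icc _ _)
        (fun t ht => (hasDerivAt_flow_one
          (hbox 0 h0V t ⟨by linarith [ht.1], ht.2⟩).1).continuousAt.continuousWithinAt)
        (fun t ht => (hasDerivAt_flow_one (hbox 0 h0V t ⟨by linarith [(interior_subset ht).1],
          (interior_subset ht).2⟩).1).hasDerivWithinAt)
        (fun t ht => by
          rw [interior_Icc] at ht
          exact hq2.symm.trans_lt (hmono2 0 h0V hzε ⟨by linarith [ht.1], ht.2.le⟩ ht.1))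
    exact hq1.symm.trans_lt (this ⟨le_rfl, by linarith⟩ ⟨by linarith, le_rfl⟩ (by linarith))
  have hcs : ∀ i, ∀ t ∈ Icc (-ε) ε, ContinuousAt (fun s => flow η t (c s) i) 0 := fun i t ht =>
    (continuous_apply i).continuousAt.comp (ContinuousAt.comp (f := fun s : ℝ => (s, t))
      (continuousAt_flow_comp hcc (hbox 0 h0V t ht).1) (by fun_prop))
  have hall : ∀ᶠ s in 𝓝 (0 : ℝ), s ∈ V ∧ ContinuousAt c s ∧ H η (c s) = 0 ∧
      |c s 0 - s| ≤ 1 / 4 * |s| ∧ |c s 2| ≤ 1 / 4 * |s| ∧ flow η (-ε) (c s) 2 < 0 ∧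
      0 < flow η ε (c s) 2 ∧ 0 < flow η (-ε) (c s) 1 ∧ 0 < flow η ε (c s) 1 := by
    filter_upwards [hV, hc, hH, hc1, hc2, (hcs 2 _ hmε).eventually_lt_const hA2,
      (hcs 2 _ hpε).eventually_const_lt hB2, (hcs 1 _ hmε).eventually_const_lt hA1,
      (hcs 1 _ hpε).eventually_const_lt hB1] with s a1 a2 a3 a4 a5 a6 a7 a8 a9
    exact ⟨a1, a2, a3, a4, a5, a6, a7, a8, a9⟩
  obtain ⟨δ₁, hδ₁, hδball⟩ := Metric.eventually_nhds_iff.1 hall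
  obtain ⟨δ, hδ, hδlt⟩ := exists_between hδ₁
  have hI : ∀ s ∈ Icc (-δ) δ, _ := fun s hs => hδball (y := s) (by
    rw [Real.dist_eq, sub_zero, abs_lt]
    constructor <;> linarith [hs.1, hs.2])
  -- points close to the central orbit
  have hsign : ∀ s ∈ Icc (-δ) δ, s ≠ 0 → ∀ t ∈ Icc (-ε) ε,
      |flow η t (c s) 2| ≤ 2 * |flow η t (c s) 0| → 0 < s * flow η t (c s) 0 := by
    intro s hs hs0 t ht hle
    obtain ⟨hsV, -, -, e0, e2, -⟩ := hI s hs
    have m0 : |flow η t (c s) 0 - c s 0| ≤ q₄ / 16 * |t| := by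
      have := (convex_Icc (-ε) ε).norm_image_sub_le_of_norm_hasDerivWithin_le
        (f := fun t => flow η t (c s) 0) (C := q₄ / 16)
        (fun t ht => (hasDerivAt_flow_zero (hbox s hsV t ht).1).hasDerivWithinAt)
        (fun t ht => (hbox s hsV t ht).2.2.1.le) hzε ht
      simpa using this
    have m2 : q₄ / 2 * |t| ≤ |flow η t (c s) 2 - c s 2| := by
      have key : ∀ t₁ ∈ Icc (-ε) ε, ∀ t₂ ∈ Icc (-ε) ε, t₁ ≤ t₂ →
          q₄ / 2 * (t₂ - t₁) ≤ flow η t₂ (c s) 2 - flow η t₁ (c s) 2 :=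
        (convex_Icc (-ε) ε).mul_sub_le_image_sub_of_le_deriv
          (f := fun t => flow η t (c s) 2)
          (fun t ht => (hasDerivAt_flow_two (hbox s hsV t ht).1).continuousAt.continuousWithinAt)
          (fun t ht => (hasDerivAt_flow_two
            (hbox s hsV t (interior_subset ht)).1).differentiableAt.differentiableWithinAt)
          (fun t ht => by
            rw [(hasDerivAt_flow_two (hbox s hsV t (interior_subset ht)).1).deriv]
            exact (hbox s hsV t (interior_subset ht)).2.1.le)
      rcases le_total 0 t with h | h
      · have := key 0 hzε t ht h
        rw [flow_zero, sub_zero] at this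
        rw [abs_of_nonneg h]
        exact this.trans (le_abs_self _)
      · have := key t ht 0 hzε h
        rw [flow_zero] at this
        rw [abs_of_nonpos h, abs_sub_comm]
        refine le_trans ?_ (le_abs_self _)
        linarith
    -- If `x₁` and `s` had opposite signs, then `|x₁ - s| = |x₁| + |s|`. But `q₄ / 2 * |t| ≤ 2 |x₁|
    -- + |s| / 4`, so `|x₁ - s| ≤ (2 |x₁| + |s| / 4) / 8 + |s| / 4`, which is smaller.
    by_contra! hcon
    have e : |flow η t (c s) 0 - s| = |flow η t (c s) 0| + |s| := by
      rcases lt_or_gt_of_ne hs0 with h | h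
      · have : 0 ≤ flow η t (c s) 0 := by
          by_contra! h'
          exact absurd hcon (not_le.2 (mul_pos_of_neg_of_neg h h'))
        rw [abs_of_nonneg this, abs_of_neg h, abs_of_nonneg (by linarith)]
        ring
      · have : flow η t (c s) 0 ≤ 0 := by
          by_contra! h'
          exact absurd hcon (not_le.2 (mul_pos h h'))
        rw [abs_of_nonpos this, abs_of_pos h, abs_of_nonpos (by linarith)]
        ring
    have f1 := abs_sub (flow η t (c s) 2) (c s 2)
    have f2 := abs_sub_le (flow η t (c s) 0) (c s 0) s
    have f3 : 0 < |s| := abs_pos.2 hs0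
    have f4 := abs_nonneg (flow η t (c s) 0)
    linarith
  have hex : ∀ s : ℝ, ∃ lo hi m : ℝ, s ∈ Icc (-δ) δ → -ε < lo ∧ lo ≤ m ∧ m ≤ hi ∧ hi < ε ∧
      flow η m (c s) 2 = 0 ∧ flow η lo (c s) 1 = 0 ∧ flow η hi (c s) 1 = 0 ∧
      (∀ t ∈ Icc (-ε) ε, t < lo ∨ hi < t → 0 < flow η t (c s) 1) ∧
      (∀ t ∈ Ioo lo hi, flow η t (c s) 1 < 0) ∧
      (s ≠ 0 → lo < m ∧ m < hi) ∧ (s = 0 → lo = 0 ∧ hi = 0) := by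
    intro s
    by_cases hs : s ∈ Icc (-δ) δ
    swap
    · exact ⟨0, 0, 0, fun h => absurd h hs⟩
    obtain ⟨hsV, -, hHs, -, -, a6, a7, a8, a9⟩ := hI s hs
    have hcont : ContinuousOn (fun t => flow η t (c s) 2) (Icc (-ε) ε) := fun t ht =>
      (hasDerivAt_flow_two (hbox s hsV t ht).1).continuousAt.continuousWithinAt
    obtain ⟨m, hm, hm2⟩ := intermediate_value_Ioo (by linarith) hcont ⟨a6, a7⟩
    simp only at hm2
    have hmI := Ioo_subset_Icc_self hm
    obtain ⟨hmD, -, -, b0, b31⟩ := hbox s hsV m hmI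
    have hHm := H_flow hmD
    rw [hHs] at hHm
    simp only [H, hm2] at hHm
    set X := flow η m (c s) 0
    set Y := flow η m (c s) 1
    set Z := flow η m (c s) 3
    rw [abs_lt] at b0
    -- This is `H = 0` at the minimum of `x₂`. Both bracketed factors are positive, so `Y ≤ 0`, with
    -- equality only if `X = 0`.
    have hY : Y * (Z - η / 2 * Y) = -(X ^ 2 * (1 / 2 - X / 3)) := by linarith
    have hXX : 0 < 1 / 2 - X / 3 := by linarith [b0.2]
    have hYle : Y ≤ 0 := by
      by_contra! h'
      have := mul_pos h' b31
      nlinarith [mul_nonneg (sq_nonneg X) hXX.le]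
    have hYlt : s ≠ 0 → Y < 0 := by
      intro hs0
      have hX0 : 0 < s * X := hsign s hs hs0 m hmI (by rw [hm2]; simp)
      have hX : X ≠ 0 := fun h => by rw [h] at hX0; simp at hX0
      refine lt_of_le_of_ne hYle fun h => ?_
      rw [h, zero_mul] at hY
      have : 0 < X ^ 2 * (1 / 2 - X / 3) := by positivity
      linarith
    obtain ⟨lo, hi, k1, k2, k3, k4, k5, k6, k7, k8, k9, k10⟩ := exists_first_last_zero
      (g := fun t => flow η t (c s) 1) (g₁ := fun t => flow η t (c s) 2)
      (fun t ht => hasDerivAt_flow_one (hbox s hsV t ht).1) (hmono2 s hsV) hm hm2 hYle a8 a9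
    refine ⟨lo, hi, m, fun _ => ⟨k1, k2, k3, k4, hm2, k5, k6, k7, k8, fun h => k9 (hYlt h), ?_⟩⟩
    intro hs0
    subst hs0
    have hm0 : m = 0 := (hmono2 0 h0V).injOn hmI hzε (by simp only [hm2, hq2])
    have := k10 (by simp only [hm0, hq1])
    rwa [hm0] at this
  choose lo hi m hlh using hex
  have h0I : (0 : ℝ) ∈ Icc (-δ) δ := ⟨by linarith, hδ.le⟩
  have hgc : ∀ s ∈ Icc (-δ) δ, ∀ t ∈ Icc (-ε) ε,
      ContinuousAt (fun p : ℝ × ℝ => flow η p.2 (c p.1) 1) (s, t) := fun s hs t ht =>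
    (continuous_apply (1 : Fin 4)).continuousAt.comp
      (continuousAt_flow_comp (hI s hs).2.1 (hbox s (hI s hs).1 t ht).1)
  have r1 : ∀ s ∈ Icc (-δ) δ, -ε < lo s := fun s hs => (hlh s hs).1
  have r2 : ∀ s ∈ Icc (-δ) δ, hi s < ε := fun s hs => (hlh s hs).2.2.2.1
  have r3 : ∀ s ∈ Icc (-δ) δ, lo s ≤ hi s := fun s hs => (hlh s hs).2.1.trans (hlh s hs).2.2.1
  have r4 : ∀ s ∈ Icc (-δ) δ, ∀ t ∈ Icc (-ε) ε, t < lo s ∨ hi s < t → 0 < flow η t (c s) 1 :=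
    fun s hs => (hlh s hs).2.2.2.2.2.2.2.1
  have r5 : ∀ s ∈ Icc (-δ) δ, ∀ t ∈ Ioo (lo s) (hi s), flow η t (c s) 1 < 0 :=
    fun s hs => (hlh s hs).2.2.2.2.2.2.2.2.1
  have r6 : ∀ s ∈ Icc (-δ) δ, flow η (lo s) (c s) 1 = 0 := fun s hs => (hlh s hs).2.2.2.2.2.1
  have r7 : ∀ s ∈ Icc (-δ) δ, flow η (hi s) (c s) 1 = 0 := fun s hs => (hlh s hs).2.2.2.2.2.2.1
  refine ⟨ε, hε, hεlt.trans_le (min_le_right _ _), δ, hδ, lo, hi,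
    ((hlh 0 h0I).2.2.2.2.2.2.2.2.2.2 rfl).1, ((hlh 0 h0I).2.2.2.2.2.2.2.2.2.2 rfl).2,
    continuousOn_first_zero hgc r1 r2 r3 r6 r4 r5, continuousOn_last_zero hgc r1 r2 r3 r7 r4 r5, ?_⟩
  intro s hs
  have hsV := (hI s hs).1
  have loI : lo s ∈ Icc (-ε) ε := ⟨(r1 s hs).le, (r3 s hs).trans (r2 s hs).le⟩
  have hiI : hi s ∈ Icc (-ε) ε := ⟨(r1 s hs).le.trans (r3 s hs), (r2 s hs).le⟩
  refine ⟨(hI s hs).2.1, (hI s hs).2.2.1, fun t ht => (hbox s hsV t ht).1, r1 s hs, r3 s hs,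
    r2 s hs, ?_, ?_⟩
  · intro t ht
    constructor
    · intro h
      have h : flow η t (c s) 1 = 0 := h
      by_contra! hne
      rcases lt_or_gt_of_ne hne.1 with h' | h'
      · exact (r4 s hs t ht (Or.inl h')).ne' h
      · rcases lt_or_gt_of_ne hne.2 with h'' | h''
        · exact (r5 s hs t ⟨h', h''⟩).ne h
        · exact (r4 s hs t ht (Or.inr h'')).ne' h
    · rintro (rfl | rfl)
      · exact r6 s hs
      · exact r7 s hs
  · intro hs0
    have hzero : ∀ t ∈ Icc (-ε) ε, flow η t (c s) 1 = 0 → 0 < s * flow η t (c s) 0 := by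
      intro t ht h
      refine hsign s hs hs0 t ht ?_
      obtain ⟨hD, -, -, b0, -⟩ := hbox s hsV t ht
      have hHt := H_flow hD
      rw [(hI s hs).2.2.1] at hHt
      simp only [H, h] at hHt
      rw [abs_lt] at b0
      -- On `S` the equation `H = 0` becomes `x₃² = x₁² - 2/3 x₁³`, which is at most `4 x₁²` for
      -- `|x₁| < 1/2`; this is the hypothesis of `hsign`.
      have h2 : |flow η t (c s) 2| ≤ |2 * flow η t (c s) 0| := sq_le_sq.1 (by
        nlinarith [mul_nonneg (sq_nonneg (flow η t (c s) 0))
          (by linarith [b0.1] : (0 : ℝ) ≤ 3 + 2 / 3 * flow η t (c s) 0)])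
      rwa [abs_mul, abs_two] at h2
    obtain ⟨l1, l2⟩ := (hlh s hs).2.2.2.2.2.2.2.2.2.1 hs0
    have hm2 : flow η (m s) (c s) 2 = 0 := (hlh s hs).2.2.2.2.1
    have hmI : m s ∈ Icc (-ε) ε := ⟨loI.1.trans l1.le, l2.le.trans hiI.2⟩
    refine ⟨l1.trans l2, hzero _ loI (r6 s hs), hzero _ hiI (r7 s hs), ?_, ?_⟩
    · exact (hmono2 s hsV loI hmI l1).trans_eq hm2
    · exact hm2.symm.trans_lt (hmono2 s hsV hmI hiI l2)

end

end Bifocus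

/-! ### The past of `q` and its passage through `Dᵘ`. -/

namespace Bifocus

noncomputable section

variable {η r R : ℝ} {x y q : E4} {s t T T₀ : ℝ} {a b : ℝ × ℝ → ℝ} {u : ℝ × ℝ}

/-- The squared Euclidean norm on the `(x₁, x₂)`-plane. -/
def sqNorm (u : ℝ × ℝ) : ℝ := u.1 ^ 2 + u.2 ^ 2

@[fun_prop]
lemma continuous_sqNorm : Continuous sqNorm := by unfold sqNorm; fun_prop

lemma Du_eq_image (hr : 0 < r) (a b : ℝ × ℝ → ℝ) :
    Du r a b = graphPt a b '' {u | sqNorm u = r ^ 2} := by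
  ext x
  constructor
  · rintro ⟨θ, -, rfl⟩
    refine ⟨_, ?_, rfl⟩
    change (r * Real.cos θ) ^ 2 + (r * Real.sin θ) ^ 2 = r ^ 2
    nlinarith [Real.sin_sq_add_cos_sq θ]
  · rintro ⟨u, hu, rfl⟩
    have hu : u.1 ^ 2 + u.2 ^ 2 = r ^ 2 := hu
    obtain ⟨θ, h1, h2⟩ : ∃ θ : ℝ, u.1 = r * Real.cos θ ∧ u.2 = r * Real.sin θ := by
      set z : ℂ := ⟨u.1, u.2⟩ with hz
      have hn : ‖z‖ = r := by
        rw [Complex.norm_eq_sqrt_sq_add_sq, hu, Real.sqrt_sq hr.le]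
      have hz0 : z ≠ 0 := by
        rw [← norm_pos_iff, hn]; exact hr
      refine ⟨z.arg, ?_, ?_⟩
      · rw [Complex.cos_arg hz0, hn]; field_simp; rfl
      · rw [Complex.sin_arg, hn]; field_simp; rfl
    refine ⟨toIocMod Real.two_pi_pos 0 θ, ?_, ?_⟩
    · simpa using toIocMod_mem_Ioc Real.two_pi_pos 0 θ
    · have e : toIocMod Real.two_pi_pos 0 θ = θ - toIocDiv Real.two_pi_pos 0 θ * (2 * Real.pi) := by
        rw [toIocMod, zsmul_eq_mul]
      rw [sigma, e, Real.cos_sub_int_mul_two_pi, Real.sin_sub_int_mul_two_pi, ← h1, ← h2]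

lemma mem_Du_iff (hr : 0 < r) :
    x ∈ Du r a b ↔ sqNorm (pr x) = r ^ 2 ∧ graphPt a b (pr x) = x := by
  rw [Du_eq_image hr]
  constructor
  · rintro ⟨u, hu, rfl⟩
    exact ⟨hu, rfl⟩
  · rintro ⟨h1, h2⟩
    exact ⟨_, h1, h2⟩

lemma IsInvariantGraph.continuousAt_graphPt (hg : IsInvariantGraph η R a b) (hu : u ∈ disc R) :
    ContinuousAt (graphPt a b) u :=
  Bifocus.continuousAt_graphPt (hg.analytic_a u hu).continuousAt (hg.analytic_b u hu).continuousAt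

lemma disc_subset_disc (hr : 0 ≤ r) (hrR : r ≤ R) : disc r ⊆ disc R := fun u hu =>
  le_trans (show u.1 ^ 2 + u.2 ^ 2 ≤ r ^ 2 from hu) (by gcongr)

lemma IsInvariantGraph.isCompact_Du (hg : IsInvariantGraph η R a b) (hr : 0 < r) (hrR : r ≤ R) :
    IsCompact (Du r a b) := by
  rw [Du_eq_image hr]
  have h1 : {u | sqNorm u = r ^ 2} ⊆ disc r := fun u hu => le_of_eq hu
  have h2 : IsCompact {u | sqNorm u = r ^ 2} :=
    (isCompact_disc r).of_isClosed_subset (isClosed_eq continuous_sqNorm continuous_const) h1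
  exact h2.image_of_continuousOn fun u hu =>
    (hg.continuousAt_graphPt (disc_subset_disc hr.le hrR (h1 hu))).continuousWithinAt

lemma continuousAt_sqNorm_pr_flow (ht : t ∈ flowDomain η x) :
    ContinuousAt (fun t => sqNorm (pr (flow η t x))) t :=
  (continuous_sqNorm.comp continuous_pr).continuousAt.comp (hasDerivAt_flow ht).continuousAt

lemma IsInvariantGraph.graphPt_zero (hg : IsInvariantGraph η R a b) : graphPt a b 0 = 0 := by
  funext i
  fin_cases i <;> simp [graphPt, hg.a_zero, hg.b_zero]

/-- An orbit segment which starts on the graph over a disc and ends at a nonzero point over the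
origin has to leave the disc, through the curve `Dᵘ`. -/
lemma IsInvariantGraph.exists_exit (hg : IsInvariantGraph η R a b) (hr : 0 < r) (hrR : r ≤ R)
    (hdom : Icc t 0 ⊆ flowDomain η q) (ht : t ≤ 0) (hq : q ≠ 0) (hpr : pr q = 0)
    (hmem : pr (flow η t q) ∈ disc r) (hgr : graphPt a b (pr (flow η t q)) = flow η t q) :
    ∃ t' ∈ Icc t 0, (∀ τ ∈ Icc t t', pr (flow η τ q) ∈ disc r) ∧ flow η t' q ∈ Du r a b := by
  set N : ℝ → ℝ := fun τ => sqNorm (pr (flow η τ q)) with hN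
  have hNc : ∀ τ ∈ Icc t 0, ContinuousAt N τ := fun τ hτ => continuousAt_sqNorm_pr_flow (hdom hτ)
  set K := {τ ∈ Icc t 0 | r ^ 2 < N τ} with hK
  -- An orbit that never left the disc would remain on the graph, and `q`, lying over the origin,
  -- would be the origin.
  have hKne : K.Nonempty := by
    by_contra hne
    rw [Set.not_nonempty_iff_eq_empty] at hne
    have hall : ∀ τ ∈ Icc t 0, pr (flow η τ q) ∈ disc R := fun τ hτ => by
      refine disc_subset_disc hr.le hrR ?_
      by_contra h
      exact notMem_empty τ (hne ▸ (⟨hτ, not_le.1 h⟩ : τ ∈ K))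
    have := hg.graphPt_pr_flow hdom hall ⟨le_rfl, ht⟩ hgr 0 ⟨ht, le_rfl⟩
    rw [flow_zero, hpr, hg.graphPt_zero] at this
    exact hq this.symm
  have hbdd : BddBelow K := ⟨t, fun τ hτ => hτ.1.1⟩
  set t' := sInf K with ht'
  have ht'I : t' ∈ Icc t 0 :=
    ⟨le_csInf hKne fun τ hτ => hτ.1.1, (csInf_le hbdd hKne.some_mem).trans hKne.some_mem.1.2⟩
  have hlt : ∀ τ ∈ Ico t t', N τ ≤ r ^ 2 := fun τ hτ => by
    by_contra! h
    exact notMem_of_lt_csInf hτ.2 hbdd ⟨⟨hτ.1, hτ.2.le.trans ht'I.2⟩, h⟩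
  have hge : r ^ 2 ≤ N t' := by
    by_contra! h
    have h1 := mem_closure_iff_frequently.1 (csInf_mem_closure hKne hbdd)
    obtain ⟨τ, hτ1, hτ2⟩ := (h1.and_eventually ((hNc t' ht'I).eventually_lt_const h)).exists
    exact lt_asymm hτ1.2 hτ2
  have hle : N t' ≤ r ^ 2 := by
    rcases ht'I.1.lt_or_eq with h | h
    · by_contra! hcon
      have h1 : ∀ᶠ τ in 𝓝[<] t', r ^ 2 < N τ :=
        ((hNc t' ht'I).eventually_const_lt hcon).filter_mono nhdsWithin_le_nhds
      obtain ⟨τ, hτ1, hτ2⟩ := (h1.and (Ioo_mem_nhdsLT h)).exists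
      exact absurd hτ1 (not_lt.2 (hlt τ ⟨hτ2.1.le, hτ2.2⟩))
    · rw [← h]; exact hmem
  have hin : ∀ τ ∈ Icc t t', pr (flow η τ q) ∈ disc r := fun τ hτ => by
    rcases hτ.2.lt_or_eq with h | h
    · exact hlt τ ⟨hτ.1, h⟩
    · rw [h]; exact hle
  refine ⟨t', ht'I, hin, (mem_Du_iff hr).2 ⟨le_antisymm hle hge, ?_⟩⟩
  exact hg.graphPt_pr_flow ((Icc_subset_Icc_right ht'I.2).trans hdom)
    (fun τ hτ => disc_subset_disc hr.le hrR (hin τ hτ)) ⟨le_rfl, ht'I.1⟩ hgr t' ⟨ht'I.1, le_rfl⟩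

/-- On the graph over the disc of radius `r`, the curve `Dᵘ` is crossed outwards only away from
`S`. -/
lemma IsInvariantGraph.notMem_S_of_crossing (hg : IsInvariantGraph η R a b) (hr : 0 < r)
    (hrR : r ≤ R) (ht : t ∈ flowDomain η q) (hp : flow η t q ∈ Du r a b)
    (hl : ∀ᶠ τ in 𝓝[<] t, sqNorm (pr (flow η τ q)) < r ^ 2)
    (hr' : ∀ᶠ τ in 𝓝[>] t, r ^ 2 < sqNorm (pr (flow η τ q))) : flow η t q ∉ S := by
  intro hS
  have hS : flow η t q 1 = 0 := hS
  obtain ⟨hn, hgr⟩ := (mem_Du_iff hr).1 hp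
  have hdisc : pr (flow η t q) ∈ disc R := disc_subset_disc hr.le hrR hn.le
  have hH := hg.H_eq_zero _ hdisc
  rw [hgr] at hH
  have hX : flow η t q 0 ^ 2 = r ^ 2 := by
    have : flow η t q 0 ^ 2 + flow η t q 1 ^ 2 = r ^ 2 := hn
    rw [hS] at this
    linarith
  have hX0 : flow η t q 0 ≠ 0 := fun h => by
    rw [h] at hX
    nlinarith
  simp only [H, hS] at hH
  -- At such a point the planar velocity vanishes, so the equation for `b` gives `x₁ = x₁²`, that is
  -- `x₁ = 1`; but then `H = 1/6`.
  have hZ0 : flow η t q 2 ≠ 0 := by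
    intro h
    have ea := (graphPt_pr_eq_iff.1 hgr).1
    rw [h] at ea
    have eb := hg.fderiv_b _ hdisc
    rw [← ea] at eb
    have hz : ((pr (flow η t q)).2, (0 : ℝ)) = 0 := by
      simp only [pr, hS]; rfl
    rw [hz, map_zero] at eb
    simp only [pr] at eb
    rw [h] at hH
    have h1 : flow η t q 0 = 1 := by
      have : flow η t q 0 * (flow η t q 0 - 1) = 0 := by linarith
      rcases mul_eq_zero.1 this with h | h
      · exact absurd h hX0
      · linarith
    rw [h1] at hH
    norm_num at hH
  have hXZ : flow η t q 0 + flow η t q 2 ≠ 0 := by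
    intro h
    have : flow η t q 2 = -flow η t q 0 := by linarith
    rw [this] at hH
    have : flow η t q 0 ^ 3 = 0 := by linarith
    exact hX0 (by simpa using this)
  set N : ℝ → ℝ := fun τ => sqNorm (pr (flow η τ q)) with hN
  have hd : ∀ τ ∈ flowDomain η q, HasDerivAt N
      (2 * (flow η τ q 1 * (flow η τ q 0 + flow η τ q 2))) τ := by
    intro τ hτ
    have := ((hasDerivAt_flow_zero hτ).pow 2).add ((hasDerivAt_flow_one hτ).pow 2)
    refine this.congr_deriv ?_
    norm_num
    ring
  have hev : deriv N =ᶠ[𝓝 t] fun τ => 2 * (flow η τ q 1 * (flow η τ q 0 + flow η τ q 2)) := by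
    filter_upwards [(isOpen_flowDomain η q).mem_nhds ht] with τ hτ using (hd τ hτ).deriv
  have hd0 : deriv N t = 0 := by
    rw [(hd t ht).deriv, hS]; ring
  have hdd : deriv (deriv N) t = 2 * (flow η t q 2 * (flow η t q 0 + flow η t q 2)) := by
    rw [hev.deriv_eq]
    have := ((hasDerivAt_flow_one ht).mul
      ((hasDerivAt_flow_zero ht).add (hasDerivAt_flow_two ht))).const_mul 2
    rw [hS, zero_mul, add_zero] at this
    exact this.deriv
  -- On `S` the squared radius `N` has `N' = 0` and `N'' ≠ 0`, hence a local extremum, which is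
  -- incompatible with passing from below `r ^ 2` to above it.
  have hne : deriv (deriv N) t ≠ 0 := by
    rw [hdd]
    exact mul_ne_zero two_ne_zero (mul_ne_zero hZ0 hXZ)
  have hNt : N t = r ^ 2 := hn
  rcases lt_or_gt_of_ne hne with h | h
  · have hmax : ∀ᶠ τ in 𝓝[>] t, N τ ≤ N t := (isLocalMax_of_deriv_deriv_neg h hd0
      (hd t ht).continuousAt).filter_mono nhdsWithin_le_nhds
    obtain ⟨τ, h1, h2⟩ := (hmax.and hr').exists
    rw [hNt] at h1
    exact absurd h2 (not_lt.2 h1)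
  · have hmin : ∀ᶠ τ in 𝓝[<] t, N t ≤ N τ := (isLocalMin_of_deriv_deriv_pos h hd0
      (hd t ht).continuousAt).filter_mono nhdsWithin_le_nhds
    obtain ⟨τ, h1, h2⟩ := (hmin.and hl).exists
    rw [hNt] at h1
    exact absurd h2 (not_lt.2 h1)

/-- A nonzero point `q` over the origin whose orbit meets `Dᵘ` only at the time `-T₀`, coming from
a point of the graph over the open disc: the past of `q`. -/
structure IsPastConnection (η r R : ℝ) (a b : ℝ × ℝ → ℝ) (q : E4) (u : ℝ × ℝ) (T T₀ : ℝ) :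
    Prop where
  T₀_pos : 0 < T₀
  T₀_lt : T₀ < T
  subset_flowDomain : Iic 0 ⊆ flowDomain η q
  mem_Du : flow η (-T₀) q ∈ Du r a b
  eq_of_mem_Du : ∀ t ≤ 0, flow η t q ∈ Du r a b → t = -T₀
  sqNorm_lt : ∀ τ ∈ Ico (-T) (-T₀), sqNorm (pr (flow η τ q)) < r ^ 2
  lt_sqNorm : ∀ᶠ τ in 𝓝[>] (-T₀), r ^ 2 < sqNorm (pr (flow η τ q))
  notMem_S : flow η (-T₀) q ∉ S
  flow_neg_T : flow η (-T) q = graphPt a b u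

/-- The orbit starts over the open disc at time `-T` and must exit through `Dᵘ`; as it meets `Dᵘ`
once, the exit time is `-T₀`. Were it in the closed disc just afterwards, it would still be on the
graph, which extends to radius `R > r`, and would have to exit a second time. -/
lemma IsInvariantGraph.isPastConnection (hg : IsInvariantGraph η R a b) (hr : 0 < r) (hrR : r < R)
    (hdom : Iic 0 ⊆ flowDomain η q) (hq : q ≠ 0) (hpr : pr q = 0) (hT₀ : 0 < T₀)
    (hp : flow η (-T₀) q ∈ Du r a b)
    (honce : ∀ t ≤ 0, flow η t q ∈ Du r a b → t = -T₀) (hT : 0 ≤ T) (hu : sqNorm u < r ^ 2)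
    (hTu : flow η (-T) q = graphPt a b u) : IsPastConnection η r R a b q u T T₀ := by
  have hprT : pr (flow η (-T) q) = u := by rw [hTu]; rfl
  have hsub : ∀ t, Icc t 0 ⊆ flowDomain η q := fun t => Icc_subset_Iic_self.trans hdom
  obtain ⟨t', ht', hin, hD⟩ := hg.exists_exit hr hrR.le (hsub (-T)) (by linarith) hq hpr
    (by rw [hprT]; exact hu.le) (by rw [hprT, hTu])
  have e := honce t' ht'.2 hD
  subst e
  have hgr : ∀ τ ∈ Icc (-T) (-T₀), graphPt a b (pr (flow η τ q)) = flow η τ q :=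
    hg.graphPt_pr_flow ((Icc_subset_Icc_right ht'.2).trans (hsub (-T)))
      (fun τ hτ => disc_subset_disc hr.le hrR.le (hin τ hτ)) ⟨le_rfl, ht'.1⟩ (by rw [hprT, hTu])
  have hlt : ∀ τ ∈ Ico (-T) (-T₀), sqNorm (pr (flow η τ q)) < r ^ 2 := by
    intro τ hτ
    refine lt_of_le_of_ne (hin τ ⟨hτ.1, hτ.2.le⟩) fun h => ?_
    have := honce τ (by linarith [hτ.2]) ((mem_Du_iff hr).2 ⟨h, hgr τ ⟨hτ.1, hτ.2.le⟩⟩)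
    exact absurd this hτ.2.ne
  have hTT : T₀ < T := by
    rcases ht'.1.lt_or_eq with h | h
    · linarith
    · have := ((mem_Du_iff hr).1 hp).1
      rw [← h, hprT] at this
      exact absurd this hu.ne
  have hafter : ∀ᶠ τ in 𝓝[>] (-T₀), r ^ 2 < sqNorm (pr (flow η τ q)) := by
    have h1 : ∀ᶠ τ in 𝓝 (-T₀), sqNorm (pr (flow η τ q)) < R ^ 2 :=
      (continuousAt_sqNorm_pr_flow (hdom ht'.2)).eventually_lt_const (by
        simp only [((mem_Du_iff hr).1 hp).1]; gcongr)
    obtain ⟨δ, hδ, hball⟩ := Metric.eventually_nhds_iff.1 h1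
    have hm : 0 < min δ T₀ := lt_min hδ hT₀
    filter_upwards [Ioo_mem_nhdsGT (show -T₀ < -T₀ + min δ T₀ by linarith)] with τ hτ
    have hτ0 : τ ≤ 0 := by linarith [hτ.2, min_le_right δ T₀]
    have hgτ := hg.graphPt_pr_flow (s := -T₀) (t := τ) (x := q)
      (Icc_subset_Iic_self.trans ((Iic_subset_Iic.2 hτ0).trans hdom))
      (fun σ hσ => (hball (by
        rw [Real.dist_eq, abs_lt]
        constructor <;> linarith [hσ.1, hσ.2, hτ.2, min_le_left δ T₀])).le)
      (τ₀ := -T₀) ⟨le_rfl, hτ.1.le⟩ ((mem_Du_iff hr).1 hp).2 τ ⟨hτ.1.le, le_rfl⟩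
    by_contra! hcon
    obtain ⟨t'', ht'', -, hD'⟩ := hg.exists_exit hr hrR.le (hsub τ) hτ0 hq hpr hcon hgτ
    have := honce t'' ht''.2 hD'
    linarith [ht''.1, hτ.1]
  refine ⟨hT₀, hTT, hdom, hp, honce, hlt, hafter, ?_, hTu⟩
  refine hg.notMem_S_of_crossing hr hrR.le (hdom ht'.2) hp ?_ hafter
  filter_upwards [Ioo_mem_nhdsLT (show -T < -T₀ by linarith)] with τ hτ using
    hlt τ ⟨hτ.1.le, hτ.2⟩

end

end Bifocus

/-! ### The transverse curve in `Wᵘ` through `q`. -/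

namespace Bifocus

noncomputable section

variable {η r R : ℝ} {x y q : E4} {s t T T₀ : ℝ} {a b : ℝ × ℝ → ℝ} {u ν : ℝ × ℝ}

/-- The determinant of two vectors of the plane. -/
def cross (w ν : ℝ × ℝ) : ℝ := w.1 * ν.2 - w.2 * ν.1

@[fun_prop]
lemma continuous_cross (ν : ℝ × ℝ) : Continuous fun w => cross w ν := by unfold cross; fun_prop

lemma exists_eq_smul_of_cross_eq_zero {w : ℝ × ℝ} (hν : ν ≠ 0) (h : cross w ν = 0) :
    ∃ k : ℝ, w = k • ν := by
  have h : w.1 * ν.2 - w.2 * ν.1 = 0 := h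
  by_cases h1 : ν.1 = 0
  · have h2 : ν.2 ≠ 0 := fun h2 => hν (Prod.ext h1 h2)
    refine ⟨w.2 / ν.2, Prod.ext ?_ ?_⟩
    · rw [h1] at h
      have : w.1 = 0 := by
        have : w.1 * ν.2 = 0 := by linarith
        exact (mul_eq_zero.1 this).resolve_right h2
      simp [h1, this]
    · simp [h2]
  · refine ⟨w.1 / ν.1, Prod.ext ?_ ?_⟩
    · simp [h1]
    · simp only [Prod.smul_snd, smul_eq_mul]
      field_simp
      linarith

lemma continuousAt_graphPt_line (hg : IsInvariantGraph η R a b) (hu : u ∈ disc R) (ν : ℝ × ℝ) :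
    ContinuousAt (fun s : ℝ => graphPt a b (u + s • ν)) 0 :=
  ContinuousAt.comp (g := graphPt a b) (f := fun s : ℝ => u + s • ν)
    (by simpa using hg.continuousAt_graphPt hu) (by fun_prop)

lemma differentiable_H (η : ℝ) : Differentiable ℝ (H η) := by
  unfold H; fun_prop

lemma vf_apply_zero (η : ℝ) (x : E4) : vf η x 0 = x 1 := rfl

lemma vf_apply_two (η : ℝ) (x : E4) : vf η x 2 = x 3 := rfl

/-- Transversality provides a line in the plane, transverse to the projected flow, whose points
are carried by the flow to a curve through `q` with a prescribed velocity. -/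
lemma IsInvariantGraph.exists_transverse_direction {q₄ : ℝ} (hq₄ : q₄ ≠ 0)
    (hg : IsInvariantGraph η R a b)
    (hu : sqNorm u < R ^ 2) (hT : T ∈ flowDomain η (graphPt a b u))
    (hTq : flow η T (graphPt a b u) = ![0, 0, 0, q₄])
    (htr : LinearMap.range (fderiv ℝ (fun w => flow η T (graphPt a b w)) u).toLinearMap ⊔
        Submodule.span ℝ {(![0, 0, 0, 1] : E4)} =
      LinearMap.ker (fderiv ℝ (H η) ![0, 0, 0, q₄]).toLinearMap) :
    ∃ ν : ℝ × ℝ, ν ≠ 0 ∧ cross (u.2, a u) ν ≠ 0 ∧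
      HasDerivAt (fun s : ℝ => flow η T (graphPt a b (u + s • ν)) 0) 1 0 ∧
      HasDerivAt (fun s : ℝ => flow η T (graphPt a b (u + s • ν)) 2) 0 0 := by
  set G : ℝ × ℝ → E4 := fun w => flow η T (graphPt a b w) with hG
  set D := fderiv ℝ G u with hD
  -- Along `q + s e₁` the first integral is `s² / 2 - s³ / 3`, so `e₁` is tangent to the level set.
  -- Transversality writes `e₁` as `D ν` plus a multiple of `e₄`, which does not affect the
  -- coordinates 0 and 2.
  have he0 : (![1, 0, 0, 0] : E4) ∈
      LinearMap.ker (fderiv ℝ (H η) ![0, 0, 0, q₄]).toLinearMap := by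
    have h1 : HasDerivAt (fun s : ℝ => (![0, 0, 0, q₄] : E4) + s • (![1, 0, 0, 0] : E4))
        ![1, 0, 0, 0] 0 := by
      simpa using ((hasDerivAt_id (0 : ℝ)).smul_const (![1, 0, 0, 0] : E4)).const_add
        (![0, 0, 0, q₄] : E4)
    have h2 := (differentiable_H η ![0, 0, 0, q₄]).hasFDerivAt.comp_hasDerivAt_of_eq (0 : ℝ) h1
      (by simp)
    have h3 : (H η ∘ fun s : ℝ => (![0, 0, 0, q₄] : E4) + s • (![1, 0, 0, 0] : E4)) =
        fun s : ℝ => 1 / 2 * s ^ 2 - 1 / 3 * s ^ 3 := by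
      funext s
      simp [H]
    rw [h3] at h2
    have h4 : HasDerivAt (fun s : ℝ => 1 / 2 * s ^ 2 - 1 / 3 * s ^ 3) 0 0 := by
      have := ((hasDerivAt_pow 2 (0 : ℝ)).const_mul (1 / 2)).sub
        ((hasDerivAt_pow 3 (0 : ℝ)).const_mul (1 / 3))
      simpa using! this
    rw [LinearMap.mem_ker]
    exact h2.unique h4
  rw [← htr, Submodule.mem_sup] at he0
  obtain ⟨y, ⟨ν, rfl⟩, z, hz, hyz⟩ := he0
  obtain ⟨k, rfl⟩ := Submodule.mem_span_singleton.1 hz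
  have hν0 : D ν 0 = 1 := by
    have := congrFun hyz 0
    simpa using this
  have hν2 : D ν 2 = 0 := by
    have := congrFun hyz 2
    simpa using this
  -- Without differentiability `fderiv` would be 0, contradicting `D ν 0 = 1`.
  have hdiff : DifferentiableAt ℝ G u := by
    by_contra h
    rw [hD, fderiv_zero_of_not_differentiableAt h] at hν0
    simp at hν0
  have hline : HasDerivAt (fun s : ℝ => G (u + s • ν)) (D ν) 0 := by
    have h1 : HasDerivAt (fun s : ℝ => u + s • ν) ν 0 := by
      simpa using ((hasDerivAt_id (0 : ℝ)).smul_const ν).const_add u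
    exact hdiff.hasFDerivAt.comp_hasDerivAt_of_eq (0 : ℝ) h1 (by simp)
  -- Moving along the graph with the flow and then applying `flow η T` amounts to moving along the
  -- orbit at `q`.
  have hF : D (u.2, a u) = vf η ![0, 0, 0, q₄] := by
    set g := graphPt a b u with hgu
    have h1 : HasDerivAt (fun σ => pr (flow η σ g)) (u.2, a u) 0 := by
      have e0 := hasDerivAt_flow_zero (zero_mem_flowDomain η g)
      have e1 := hasDerivAt_flow_one (zero_mem_flowDomain η g)
      rw [flow_zero] at e0 e1
      exact e0.prodMk e1
    have h2 := hdiff.hasFDerivAt.comp_hasDerivAt_of_eq (0 : ℝ) h1 (by simp [hgu])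
    have h3 : ∀ᶠ σ in 𝓝 (0 : ℝ), sqNorm (pr (flow η σ g)) < R ^ 2 :=
      (continuousAt_sqNorm_pr_flow (zero_mem_flowDomain η g)).eventually_lt_const (by
        simpa [hgu] using hu)
    have h4 : ∀ᶠ σ in 𝓝 (0 : ℝ), T + σ ∈ flowDomain η g := by
      have : ContinuousAt (fun σ : ℝ => T + σ) 0 := by fun_prop
      exact this.eventually ((isOpen_flowDomain η g).mem_nhds (by simpa using hT))
    obtain ⟨δ, hδ, hball⟩ := Metric.eventually_nhds_iff.1 (h3.and (h4.and
      ((isOpen_flowDomain η g).mem_nhds (zero_mem_flowDomain η g))))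
    have h5 : (G ∘ fun σ => pr (flow η σ g)) =ᶠ[𝓝 0] fun σ => flow η σ (flow η T g) := by
      filter_upwards [Metric.ball_mem_nhds (0 : ℝ) hδ] with σ hσ
      have hI : ∀ τ ∈ Icc (-|σ|) |σ|, dist τ 0 < δ := fun τ hτ => by
        rw [Metric.mem_ball, Real.dist_eq, sub_zero] at hσ
        rw [Real.dist_eq, sub_zero]
        exact (abs_le.2 hτ).trans_lt hσ
      have hgr := hg.graphPt_pr_flow (x := g) (fun τ hτ => (hball (hI τ hτ)).2.2)
        (fun τ hτ => (hball (hI τ hτ)).1.le) (τ₀ := 0) ⟨by simp, by simp⟩ (by simp [hgu])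
        σ ⟨neg_abs_le σ, le_abs_self σ⟩
      obtain ⟨-, hσ2, hσ3⟩ := hball hσ
      simp only [hG, Function.comp_apply, hgr]
      rw [(flow_add_of_mem hT hσ2).2, add_comm, ← (flow_add_of_mem hσ3 (by rwa [add_comm])).2]
    have h6 := (hasDerivAt_flow (zero_mem_flowDomain η (flow η T g))).congr_of_eventuallyEq h5
    rw [flow_zero, hTq] at h6
    exact h2.unique h6
  have hνne : ν ≠ 0 := by
    rintro rfl
    simp at hν0
  refine ⟨ν, hνne, ?_, ?_, ?_⟩
  · intro hc
    obtain ⟨k, hk⟩ := exists_eq_smul_of_cross_eq_zero hνne hc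
    rw [hk, map_smul] at hF
    have e0 := congrFun hF 0
    have e2 := congrFun hF 2
    rw [vf_apply_zero] at e0
    rw [vf_apply_two] at e2
    simp [hν0] at e0
    rw [e0] at e2
    simp at e2
    exact hq₄ e2.symm
  · have := hasDerivAt_pi.1 hline 0
    rwa [hν0] at this
  · have := hasDerivAt_pi.1 hline 2
    rwa [hν2] at this

/-- The curve transverse to the flow, through the point `flow η T (graphPt a b u)`. -/
def sectionCurve (η T : ℝ) (a b : ℝ × ℝ → ℝ) (u ν : ℝ × ℝ) (s : ℝ) : E4 :=
  flow η T (graphPt a b (u + s • ν))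

lemma hasDerivAt_cross_pr_flow (ν w : ℝ × ℝ) (ht : t ∈ flowDomain η x) :
    HasDerivAt (fun t => cross (pr (flow η t x) - w) ν)
      (cross (flow η t x 1, flow η t x 2) ν) t :=
  (((hasDerivAt_flow_zero ht).sub_const w.1).mul_const ν.2).sub
    (((hasDerivAt_flow_one ht).sub_const w.2).mul_const ν.1)

lemma continuousAt_flow_coord (ht : t ∈ flowDomain η x) (i : Fin 4) :
    ContinuousAt (fun p : E4 × ℝ => flow η p.2 p.1 i) (x, t) :=
  (continuous_apply i).continuousAt.comp (continuousAt_flow ht)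

lemma eventually_cross_flow_pos (ht : t ∈ flowDomain η x)
    (hν : cross (flow η t x 1, flow η t x 2) ν ≠ 0) :
    ∀ᶠ p : E4 × ℝ in 𝓝 (x, t), p.2 ∈ flowDomain η p.1 ∧
      0 < cross (flow η t x 1, flow η t x 2) ν * cross (flow η p.2 p.1 1, flow η p.2 p.1 2) ν := by
  have h1 : ContinuousAt (fun p : E4 × ℝ => cross (flow η p.2 p.1 1, flow η p.2 p.1 2) ν) (x, t) :=
    (continuous_cross ν).continuousAt.comp (f := fun p : E4 × ℝ =>
      (flow η p.2 p.1 1, flow η p.2 p.1 2))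
      ((continuousAt_flow_coord ht 1).prodMk (continuousAt_flow_coord ht 2))
  exact (eventually_mem_flowDomain ht).and
    ((h1.const_mul _).eventually_const_lt (mul_self_pos.2 hν))

lemma eventually_mem_flowDomain_graphPt_line (hg : IsInvariantGraph η R a b) (hu : u ∈ disc R)
    (ν : ℝ × ℝ) (hT : T ∈ flowDomain η (graphPt a b u)) :
    ∀ᶠ s in 𝓝 (0 : ℝ), T ∈ flowDomain η (graphPt a b (u + s • ν)) :=
  (continuousAt_graphPt_line hg hu ν).eventually (p := fun y => T ∈ flowDomain η y)
    (by simpa using eventually_mem_flowDomain_left hT)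

/-- Different points of the section curve are on different local orbits. -/
lemma IsInvariantGraph.exists_sectionCurve_injective (hg : IsInvariantGraph η R a b)
    (hu : u ∈ disc R) (hν : ν ≠ 0) (hcr : cross (u.2, a u) ν ≠ 0)
    (hT : T ∈ flowDomain η (graphPt a b u)) :
    ∃ ρ > 0, ∀ s s' t t', |s| < ρ → |s'| < ρ → |t| < ρ → |t'| < ρ →
      t ∈ flowDomain η (sectionCurve η T a b u ν s) →
      t' ∈ flowDomain η (sectionCurve η T a b u ν s') →
      flow η t (sectionCurve η T a b u ν s) = flow η t' (sectionCurve η T a b u ν s') →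
      s = s' := by
  set κ := cross (u.2, a u) ν with hκ
  have h0 : cross (flow η 0 (graphPt a b u) 1, flow η 0 (graphPt a b u) 2) ν = κ := by
    rw [flow_zero]; rfl
  have hev := eventually_cross_flow_pos (zero_mem_flowDomain η (graphPt a b u))
    (by rw [h0]; exact hcr)
  rw [h0] at hev
  have hline : ContinuousAt (fun p : ℝ × ℝ => (graphPt a b (u + p.1 • ν), p.2)) (0, 0) :=
    (ContinuousAt.comp (g := fun s : ℝ => graphPt a b (u + s • ν)) (f := fun p : ℝ × ℝ => p.1)
      (x := (0, 0)) (continuousAt_graphPt_line hg hu ν) continuousAt_fst).prodMk continuousAt_snd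
  have hev' := hline.eventually (p := fun p : E4 × ℝ => p.2 ∈ flowDomain η p.1 ∧
    0 < κ * cross (flow η p.2 p.1 1, flow η p.2 p.1 2) ν) (by simpa using hev)
  have hdom := eventually_mem_flowDomain_graphPt_line hg hu ν hT
  obtain ⟨ρ₁, hρ₁, hb₁⟩ := Metric.eventually_nhds_iff.1 hev'
  obtain ⟨ρ₂, hρ₂, hb₂⟩ := Metric.eventually_nhds_iff.1 hdom
  refine ⟨min (ρ₁ / 2) ρ₂, lt_min (by linarith) hρ₂, ?_⟩
  intro s s' t t' hs hs' ht ht' hD hD' he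
  have hs'1 : |s'| < ρ₁ / 2 := hs'.trans_le (min_le_left _ _)
  have ht1 : |t| < ρ₁ / 2 := ht.trans_le (min_le_left _ _)
  have ht'1 : |t'| < ρ₁ / 2 := ht'.trans_le (min_le_left _ _)
  have hTs : T ∈ flowDomain η (graphPt a b (u + s • ν)) :=
    hb₂ (by rw [Real.dist_eq, sub_zero]; exact hs.trans_le (min_le_right _ _))
  have hTs' : T ∈ flowDomain η (graphPt a b (u + s' • ν)) :=
    hb₂ (by rw [Real.dist_eq, sub_zero]; exact hs'.trans_le (min_le_right _ _))
  set g := graphPt a b (u + s • ν) with hgs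
  set g' := graphPt a b (u + s' • ν) with hgs'
  have e1 := flow_neg hD
  rw [he] at e1
  have e2 := flow_add hD' e1.1
  rw [e1.2] at e2
  have e3 := flow_add hTs' e2.1
  change _ ∧ _ = flow η (t' + -t) (sectionCurve η T a b u ν s') at e3
  rw [e2.2] at e3
  have e4 := flow_neg hTs
  change -T ∈ flowDomain η (sectionCurve η T a b u ν s) ∧ _ at e4
  rw [← e3.2] at e4
  have e5 := flow_add e3.1 e4.1
  have e6 : T + (t' + -t) + -T = t' - t := by ring
  rw [e6, e3.2] at e5
  have e7 : flow η (t' - t) g' = g := by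
    rw [e5.2]
    exact (flow_neg hTs).2
  have hθ : |t' - t| < ρ₁ := by
    have := abs_sub t' t
    linarith
  have hbox : ∀ σ ∈ Ioo (-ρ₁) ρ₁, σ ∈ flowDomain η g' ∧
      0 < κ * cross (flow η σ g' 1, flow η σ g' 2) ν := fun σ hσ =>
    hb₁ (y := (s', σ)) (by
      rw [Prod.dist_eq, Real.dist_eq, Real.dist_eq]
      simp only [sub_zero]
      exact max_lt (by linarith) (abs_lt.2 hσ))
  -- After transport back by `T`, both `g` and `g'` lie on one short orbit and over the line `u + s
  -- ν`. The signed distance to this line is strictly monotone along the orbit, so they coincide.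
  have hmono : StrictMonoOn (fun σ => κ * cross (pr (flow η σ g') - u) ν) (Ioo (-ρ₁) ρ₁) :=
    strictMonoOn_of_hasDerivWithinAt_pos (convex_Ioo _ _)
      (fun σ hσ => ((hasDerivAt_cross_pr_flow ν u
        (hbox σ hσ).1).const_mul κ).continuousAt.continuousWithinAt)
      (fun σ hσ => ((hasDerivAt_cross_pr_flow ν u
        (hbox σ (interior_subset hσ)).1).const_mul κ).hasDerivWithinAt)
      (fun σ hσ => (hbox σ (interior_subset hσ)).2)
  have hzero : ∀ k : ℝ, cross (u + k • ν - u) ν = 0 := fun k => by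
    rw [add_sub_cancel_left]
    simp only [cross, Prod.smul_fst, Prod.smul_snd, smul_eq_mul]
    ring
  have hθ0 : t' - t = 0 := hmono.injOn (abs_lt.1 hθ) ⟨by linarith, hρ₁⟩ (by
    simp only [e7, flow_zero]
    rw [hgs, hgs', pr_graphPt, pr_graphPt, hzero, hzero])
  rw [hθ0, flow_zero] at e7
  have e8 : u + s' • ν = u + s • ν := congrArg pr e7
  have e9 := smul_left_injective ℝ hν (add_left_cancel e8)
  exact e9.symm

end

end Bifocus

/-! ### Orbits near `q` that come from `Dᵘ`. -/

namespace Bifocus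

noncomputable section

variable {η r R : ℝ} {x y q : E4} {s t T T₀ : ℝ} {a b : ℝ × ℝ → ℝ} {u ν : ℝ × ℝ}

namespace IsPastConnection

lemma mem_flowDomain_T (h : IsPastConnection η r R a b q u T T₀) :
    T ∈ flowDomain η (graphPt a b u) ∧ flow η T (graphPt a b u) = q := by
  have := flow_neg (h.subset_flowDomain (show -T ≤ 0 by linarith [h.T₀_pos, h.T₀_lt]))
  rwa [h.flow_neg_T, neg_neg] at this

lemma sqNorm_u_lt (h : IsPastConnection η r R a b q u T T₀) : sqNorm u < r ^ 2 := by
  have := h.sqNorm_lt (-T) ⟨le_rfl, by linarith [h.T₀_lt]⟩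
  rwa [h.flow_neg_T, pr_graphPt] at this

lemma sectionCurve_zero (h : IsPastConnection η r R a b q u T T₀) (ν : ℝ × ℝ) :
    sectionCurve η T a b u ν 0 = q := by
  simpa [sectionCurve] using h.mem_flowDomain_T.2

lemma eventually_continuousAt_sectionCurve (h : IsPastConnection η r R a b q u T T₀)
    (hg : IsInvariantGraph η R a b) (hr : 0 < r) (hrR : r < R) (ν : ℝ × ℝ) :
    ∀ᶠ s in 𝓝 0, T ∈ flowDomain η (graphPt a b (u + s • ν)) ∧ sqNorm (u + s • ν) < r ^ 2 ∧
      ContinuousAt (sectionCurve η T a b u ν) s ∧ H η (sectionCurve η T a b u ν s) = 0 := by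
  have hu := h.sqNorm_u_lt
  have h1 : ∀ᶠ s : ℝ in 𝓝 0, sqNorm (u + s • ν) < r ^ 2 := by
    have : ContinuousAt (fun s : ℝ => sqNorm (u + s • ν)) 0 := by fun_prop
    exact this.eventually_lt_const (by simpa using hu)
  filter_upwards [h1, eventually_mem_flowDomain_graphPt_line hg
    (disc_subset_disc hr.le hrR.le hu.le) ν h.mem_flowDomain_T.1] with s hs hs'
  have hsR : u + s • ν ∈ disc R := disc_subset_disc hr.le hrR.le hs.le
  refine ⟨hs', hs, ?_, ?_⟩
  · have h2 : ContinuousAt (fun s : ℝ => graphPt a b (u + s • ν)) s :=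
      ContinuousAt.comp (g := graphPt a b) (f := fun s : ℝ => u + s • ν)
        (hg.continuousAt_graphPt hsR) (by fun_prop)
    exact ContinuousAt.comp (g := fun y => flow η T y)
      (f := fun s : ℝ => graphPt a b (u + s • ν)) (continuousAt_flow_left hs') h2
  · rw [sectionCurve, H_flow hs', hg.H_eq_zero _ hsR]

/-- Near `q`, the whole past segment between the line and `Dᵘ` lies over the larger disc, so one
point on the graph there puts the entire segment on it. -/
lemma exists_strip (h : IsPastConnection η r R a b q u T T₀) (hr : 0 < r) (hrR : r < R) :
    ∃ ρ > 0, ρ < T₀ ∧ ρ < T - T₀ ∧ ∀ᶠ y in 𝓝 q, ∀ σ ∈ Icc (-T - ρ) (-T₀ + ρ),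
      σ ∈ flowDomain η y ∧ pr (flow η σ y) ∈ disc R := by
  have h0 := h.T₀_pos
  have hT := h.T₀_lt
  have hrR2 : r ^ 2 < R ^ 2 := by gcongr
  have hle : ∀ σ ∈ Icc (-T) (-T₀), sqNorm (pr (flow η σ q)) < R ^ 2 := fun σ hσ => by
    rcases hσ.2.lt_or_eq with h' | h'
    · exact (h.sqNorm_lt σ ⟨hσ.1, h'⟩).trans hrR2
    · rw [h', ((mem_Du_iff hr).1 h.mem_Du).1]; exact hrR2
  have hev : ∀ σ ∈ Icc (-T) (-T₀), ∀ᶠ τ in 𝓝 σ, sqNorm (pr (flow η τ q)) < R ^ 2 := fun σ hσ =>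
    (continuousAt_sqNorm_pr_flow (h.subset_flowDomain (show σ ≤ 0 by
      linarith [hσ.2]))).eventually_lt_const (hle σ hσ)
  obtain ⟨ρ₁, hρ₁, hb₁⟩ := Metric.eventually_nhds_iff.1 (hev (-T) ⟨le_rfl, by linarith⟩)
  obtain ⟨ρ₂, hρ₂, hb₂⟩ := Metric.eventually_nhds_iff.1 (hev (-T₀) ⟨by linarith, le_rfl⟩)
  obtain ⟨ρ, hρ, hρlt⟩ := exists_between
    (lt_min (lt_min hρ₁ hρ₂) (lt_min h0 (sub_pos.2 hT)))
  have l1 : ρ < ρ₁ := hρlt.trans_le ((min_le_left _ _).trans (min_le_left _ _))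
  have l2 : ρ < ρ₂ := hρlt.trans_le ((min_le_left _ _).trans (min_le_right _ _))
  have l3 : ρ < T₀ := hρlt.trans_le ((min_le_right _ _).trans (min_le_left _ _))
  have l4 : ρ < T - T₀ := hρlt.trans_le ((min_le_right _ _).trans (min_le_right _ _))
  refine ⟨ρ, hρ, l3, l4, isCompact_Icc.eventually_forall_of_forall_eventually fun σ hσ => ?_⟩
  have hσ0 : σ ∈ flowDomain η q := h.subset_flowDomain (show σ ≤ 0 by linarith [hσ.2])
  have hσ1 : sqNorm (pr (flow η σ q)) < R ^ 2 := by
    rcases le_total σ (-T) with h1 | h1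
    · exact hb₁ (by rw [Real.dist_eq, abs_lt]; constructor <;> linarith [hσ.1])
    · rcases le_total σ (-T₀) with h2 | h2
      · exact hle σ ⟨h1, h2⟩
      · exact hb₂ (by rw [Real.dist_eq, abs_lt]; constructor <;> linarith [hσ.2])
  have hc : ContinuousAt (fun p : E4 × ℝ => sqNorm (pr (flow η p.2 p.1))) (q, σ) :=
    (continuous_sqNorm.comp continuous_pr).continuousAt.comp (continuousAt_flow hσ0)
  exact (eventually_mem_flowDomain hσ0).and
    ((hc.eventually_lt_const hσ1).mono fun p hp => hp.le)

/-- Points near `q` which come from `Dᵘ` lie on orbits through the section curve. -/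
lemma exists_eq_flow_sectionCurve (h : IsPastConnection η r R a b q u T T₀)
    (hg : IsInvariantGraph η R a b) (hr : 0 < r) (hrR : r < R) (hν : ν ≠ 0)
    (hcr : cross (u.2, a u) ν ≠ 0) :
    ∃ ρ > 0, ρ < T₀ ∧ ∀ ε > 0, ∀ δ > 0, ∀ᶠ y in 𝓝 q, ∀ τ ∈ Ioo (T₀ - ρ) (T₀ + ρ),
      flow η (-τ) y ∈ Du r a b → ∃ s t, |s| < δ ∧ |t| < ε ∧
        t ∈ flowDomain η (sectionCurve η T a b u ν s) ∧
        flow η t (sectionCurve η T a b u ν s) = y := by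
  have h0 := h.T₀_pos
  have hT := h.T₀_lt
  obtain ⟨ρ, hρ, hρ0, hρT, hstrip⟩ := h.exists_strip hr hrR
  refine ⟨ρ, hρ, hρ0, fun ε hε δ' hδ' => ?_⟩
  have hTdom : -T ∈ flowDomain η q := h.subset_flowDomain (show -T ≤ 0 by linarith)
  obtain ⟨δ'', hδ'', hb''⟩ := Metric.eventually_nhds_iff.1
    (eventually_mem_flowDomain_graphPt_line hg
    (disc_subset_disc hr.le hrR.le h.sqNorm_u_lt.le) ν h.mem_flowDomain_T.1)
  set δ := min δ' δ'' with hδdef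
  have hδ : 0 < δ := lt_min hδ' hδ''
  set κ := cross (u.2, a u) ν with hκ
  have hκ0 : cross (flow η (-T) q 1, flow η (-T) q 2) ν = κ := by
    rw [h.flow_neg_T]; rfl
  have hev := eventually_cross_flow_pos hTdom (by rw [hκ0]; exact hcr)
  rw [hκ0] at hev
  have hνpos : 0 < ‖ν‖ := norm_pos_iff.2 hν
  have hnear : ∀ᶠ p : E4 × ℝ in 𝓝 (q, -T), ‖pr (flow η p.2 p.1) - u‖ < δ * ‖ν‖ := by
    have hc : ContinuousAt (fun p : E4 × ℝ => ‖pr (flow η p.2 p.1) - u‖) (q, -T) :=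
      ((continuous_pr.continuousAt.comp (continuousAt_flow hTdom)).sub continuousAt_const).norm
    refine hc.eventually_lt_const ?_
    simp only [h.flow_neg_T, pr_graphPt, sub_self, norm_zero]
    positivity
  obtain ⟨V, hV, W, hW, hVW⟩ := mem_nhds_prod_iff.1 (hev.and hnear)
  obtain ⟨ε₁, hε₁, hball⟩ := Metric.mem_nhds_iff.1 hW
  obtain ⟨ε₂, hε₂, hlt⟩ := exists_between (lt_min hε₁ (lt_min hε hρ))
  have l1 : ε₂ < ε₁ := hlt.trans_le (min_le_left _ _)
  have l2 : ε₂ < ε := hlt.trans_le ((min_le_right _ _).trans (min_le_left _ _))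
  have l3 : ε₂ < ρ := hlt.trans_le ((min_le_right _ _).trans (min_le_right _ _))
  have hWI : ∀ σ ∈ Icc (-T - ε₂) (-T + ε₂), σ ∈ W := fun σ hσ => hball (by
    rw [Metric.mem_ball, Real.dist_eq, abs_lt]
    constructor <;> linarith [hσ.1, hσ.2])
  have hd : ∀ y ∈ V, ∀ σ ∈ Icc (-T - ε₂) (-T + ε₂),
      HasDerivAt (fun σ => κ * cross (pr (flow η σ y) - u) ν)
        (κ * cross (flow η σ y 1, flow η σ y 2) ν) σ := fun y hy σ hσ =>
    (hasDerivAt_cross_pr_flow ν u (hVW (mk_mem_prod hy (hWI σ hσ))).1.1).const_mul κ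
  have hqV := mem_of_mem_nhds hV
  have hmono : StrictMonoOn (fun σ => κ * cross (pr (flow η σ q) - u) ν)
      (Icc (-T - ε₂) (-T + ε₂)) :=
    strictMonoOn_of_hasDerivWithinAt_pos (convex_Icc _ _)
      (fun σ hσ => (hd q hqV σ hσ).continuousAt.continuousWithinAt)
      (fun σ hσ => (hd q hqV σ (interior_subset hσ)).hasDerivWithinAt)
      (fun σ hσ => (hVW (mk_mem_prod hqV (hWI σ (interior_subset hσ)))).1.2)
  have hmid : κ * cross (pr (flow η (-T) q) - u) ν = 0 := by
    rw [h.flow_neg_T, pr_graphPt, sub_self]; simp [cross]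
  have mI : -T ∈ Icc (-T - ε₂) (-T + ε₂) := ⟨by linarith, by linarith⟩
  have aI : -T - ε₂ ∈ Icc (-T - ε₂) (-T + ε₂) := ⟨le_rfl, by linarith⟩
  have bI : -T + ε₂ ∈ Icc (-T - ε₂) (-T + ε₂) := ⟨by linarith, le_rfl⟩
  have hA : κ * cross (pr (flow η (-T - ε₂) q) - u) ν < 0 :=
    (hmono aI mI (by linarith)).trans_eq hmid
  have hB : 0 < κ * cross (pr (flow η (-T + ε₂) q) - u) ν :=
    hmid.symm.trans_lt (hmono mI bI (by linarith))
  have hcont : ∀ σ ≤ 0, ContinuousAt (fun y => κ * cross (pr (flow η σ y) - u) ν) q := fun σ hσ =>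
    ((continuous_cross ν).continuousAt.comp (((continuous_pr.continuousAt).comp
      (continuousAt_flow_left (h.subset_flowDomain hσ))).sub continuousAt_const)).const_mul κ
  filter_upwards [hstrip, hV, (hcont (-T - ε₂) (by linarith)).eventually_lt_const hA,
    (hcont (-T + ε₂) (by linarith)).eventually_const_lt hB] with y hy hyV hyA hyB τ hτ hτD
  have hgr := hg.graphPt_pr_flow (x := y) (fun σ hσ => (hy σ hσ).1) (fun σ hσ => (hy σ hσ).2)
    (τ₀ := -τ) ⟨by linarith [hτ.2], by linarith [hτ.1]⟩ ((mem_Du_iff hr).1 hτD).2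
  -- The signed distance to the line changes sign near time `-T`. Since the segment is on the graph,
  -- the point over the line is a `graphPt a b (u + s • ν)`.
  obtain ⟨σ, hσ, hσ0⟩ := intermediate_value_Icc (by linarith)
    (fun σ hσ => (hd y hyV σ hσ).continuousAt.continuousWithinAt) ⟨hyA.le, hyB.le⟩
  have hcz : cross (pr (flow η σ y) - u) ν = 0 :=
    (mul_eq_zero.1 hσ0).resolve_left hcr
  obtain ⟨s, hs⟩ := exists_eq_smul_of_cross_eq_zero hν hcz
  have hsδ : |s| < δ := by
    have h1 := (hVW (mk_mem_prod hyV (hWI σ hσ))).2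
    have h1 : ‖pr (flow η σ y) - u‖ < δ * ‖ν‖ := h1
    rw [hs, norm_smul, Real.norm_eq_abs] at h1
    exact lt_of_mul_lt_mul_right h1 hνpos.le
  have hprs : pr (flow η σ y) = u + s • ν := by
    rw [← hs, add_sub_cancel]
  have hgs := hgr σ ⟨by linarith [hσ.1], by linarith [hσ.2]⟩
  rw [hprs] at hgs
  have hσD : σ ∈ flowDomain η y := (hy σ ⟨by linarith [hσ.1], by linarith [hσ.2]⟩).1
  have hback := flow_neg hσD
  rw [← hgs] at hback
  have hTs : T ∈ flowDomain η (graphPt a b (u + s • ν)) := hb'' (by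
    rw [Real.dist_eq, sub_zero]; exact hsδ.trans_le (min_le_right _ _))
  have e : T + (-T - σ) = -σ := by ring
  have hfin := flow_add_of_mem hTs (s := -T - σ) (by rw [e]; exact hback.1)
  rw [e, hback.2] at hfin
  refine ⟨s, -T - σ, hsδ.trans_le (min_le_left _ _), ?_, hfin.1, hfin.2⟩
  rw [abs_lt]
  constructor <;> linarith [hσ.1, hσ.2]

/-- The orbits through the section curve come from `Dᵘ`. -/
lemma eventually_exists_mem_Du (h : IsPastConnection η r R a b q u T T₀)
    (hg : IsInvariantGraph η R a b) (hr : 0 < r) (hrR : r < R) (ν : ℝ × ℝ) {ρ : ℝ} (hρ : 0 < ρ) :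
    ∀ᶠ s in 𝓝 0, ∃ τ ∈ Ioo (T₀ - ρ) (T₀ + ρ), -τ ∈ flowDomain η (sectionCurve η T a b u ν s) ∧
      flow η (-τ) (sectionCurve η T a b u ν s) ∈ Du r a b := by
  have h0 := h.T₀_pos
  have hT := h.T₀_lt
  obtain ⟨ρ₁, hρ₁, hρ₁0, hρ₁T, hstrip⟩ := h.exists_strip hr hrR
  have hm : 0 < min ρ ρ₁ := lt_min hρ hρ₁
  obtain ⟨σ₁, hσ₁N, hσ₁⟩ := (h.lt_sqNorm.and
    (Ioo_mem_nhdsGT (show -T₀ < -T₀ + min ρ ρ₁ by linarith))).exists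
  have hσ₁ρ : σ₁ < -T₀ + ρ := hσ₁.2.trans_le (by linarith [min_le_left ρ ρ₁])
  have hσ₁ρ₁ : σ₁ < -T₀ + ρ₁ := hσ₁.2.trans_le (by linarith [min_le_right ρ ρ₁])
  set σ₀ := max (-T) (-T₀ - ρ / 2) with hσ₀
  have hσ₀T : -T ≤ σ₀ := le_max_left _ _
  have hσ₀ρ : -T₀ - ρ < σ₀ := lt_of_lt_of_le (by linarith) (le_max_right _ _)
  have hσ₀0 : σ₀ < -T₀ := max_lt (by linarith) (by linarith)
  have hσ₀N := h.sqNorm_lt σ₀ ⟨hσ₀T, hσ₀0⟩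
  have hcont : ∀ σ ≤ 0, ContinuousAt (fun y => sqNorm (pr (flow η σ y))) q := fun σ hσ =>
    (continuous_sqNorm.comp continuous_pr).continuousAt.comp
      (continuousAt_flow_left (h.subset_flowDomain hσ))
  have hy : ∀ᶠ y in 𝓝 q, (∀ σ ∈ Icc (-T - ρ₁) (-T₀ + ρ₁),
      σ ∈ flowDomain η y ∧ pr (flow η σ y) ∈ disc R) ∧ sqNorm (pr (flow η σ₀ y)) < r ^ 2 ∧
      r ^ 2 < sqNorm (pr (flow η σ₁ y)) :=
    hstrip.and (((hcont σ₀ (by linarith)).eventually_lt_const hσ₀N).and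
      ((hcont σ₁ (by linarith)).eventually_const_lt hσ₁N))
  have hall := h.eventually_continuousAt_sectionCurve hg hr hrR ν
  have hc0 := hall.self_of_nhds.2.2.1
  have hy' := hc0.eventually (p := fun y => (∀ σ ∈ Icc (-T - ρ₁) (-T₀ + ρ₁),
      σ ∈ flowDomain η y ∧ pr (flow η σ y) ∈ disc R) ∧ sqNorm (pr (flow η σ₀ y)) < r ^ 2 ∧
      r ^ 2 < sqNorm (pr (flow η σ₁ y))) (by rwa [h.sectionCurve_zero])
  filter_upwards [hy', hall] with s ⟨hs1, hs2, hs3⟩ ⟨hs4, _⟩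
  have hback := flow_neg hs4
  change -T ∈ flowDomain η (sectionCurve η T a b u ν s) ∧
    flow η (-T) (sectionCurve η T a b u ν s) = _ at hback
  have hgr := hg.graphPt_pr_flow (fun σ hσ => (hs1 σ hσ).1) (fun σ hσ => (hs1 σ hσ).2)
    (τ₀ := -T) ⟨by linarith, by linarith⟩ (by rw [hback.2, pr_graphPt])
  -- The radius is below `r` at `σ₀` and above `r` at `σ₁`; the segment lies on the graph, so it
  -- meets `Dᵘ` in between.
  obtain ⟨σ, hσ, hσN⟩ := intermediate_value_Icc (by linarith [hσ₁.1] : σ₀ ≤ σ₁)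
    (f := fun σ => sqNorm (pr (flow η σ (sectionCurve η T a b u ν s))))
    (fun σ hσ => (continuousAt_sqNorm_pr_flow (hs1 σ ⟨by linarith [hσ.1],
      by linarith [hσ.2]⟩).1).continuousWithinAt) ⟨hs2.le, hs3.le⟩
  have hσI : σ ∈ Icc (-T - ρ₁) (-T₀ + ρ₁) := ⟨by linarith [hσ.1], by linarith [hσ.2]⟩
  refine ⟨-σ, ⟨by linarith [hσ.2], by linarith [hσ.1]⟩, ?_, ?_⟩
  · rw [neg_neg]; exact (hs1 σ hσI).1
  · rw [neg_neg]; exact (mem_Du_iff hr).2 ⟨hσN, hgr σ hσI⟩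

end IsPastConnection

end

end Bifocus

/-! ### The set `Σᵘ_k` near `q`, and arcs. -/

namespace Bifocus

noncomputable section

variable {η r R : ℝ} {x y q : E4} {s t τ T T₀ ε : ℝ} {a b : ℝ × ℝ → ℝ} {u ν : ℝ × ℝ}

lemma DuPlus_union_DuMinus (r : ℝ) (a b : ℝ × ℝ → ℝ) :
    DuPlus r a b ∪ DuMinus r a b = Du r a b := by
  rw [DuPlus, DuMinus, ← image_union,
    Ioc_union_Ioc_eq_Ioc Real.pi_pos.le (by linarith [Real.pi_pos]), Du]

lemma mem_SigmaU_succ_iff {k : ℕ} : y ∈ SigmaU η r a b (k + 1) ↔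
    ∃ t > 0, -t ∈ flowDomain η y ∧ flow η (-t) y ∈ Du r a b ∧ y ∈ S ∧
      (pastCrossings η t y).encard = k + 1 := by
  rw [SigmaU, mem_union, mem_crossings_succ_iff, mem_crossings_succ_iff, ← exists_or,
    ← DuPlus_union_DuMinus]
  refine exists_congr fun t => ?_
  simp only [mem_union]
  tauto

lemma poincareImage_subset_SigmaU_succ {A : Set E4} {k : ℕ} (hA : A ⊆ SigmaU η r a b k) :
    poincareImage η A ⊆ SigmaU η r a b (k + 1) := by
  rintro y ⟨x, hx, t, ht⟩
  exact (hA hx).imp (fun h => ⟨x, h, t, ht⟩) (fun h => ⟨x, h, t, ht⟩)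

lemma IsReturnTime.unique (h : IsReturnTime η x s) (h' : IsReturnTime η x t) : s = t := by
  rcases lt_trichotomy s t with hlt | heq | hlt
  · exact absurd h.2.2.1 (h'.2.2.2 s ⟨h.1, hlt⟩)
  · exact heq
  · exact absurd h'.2.2.1 (h.2.2.2 t ⟨h'.1, hlt⟩)

lemma encard_pastCrossings_flow (hD : Icc (-τ) t ⊆ flowDomain η x) (ht : -τ ≤ t) :
    (pastCrossings η (t + τ) (flow η t x)).encard =
      {s ∈ Ioc (-τ) t | flow η s x ∈ S}.encard := by
  have htD : t ∈ flowDomain η x := hD ⟨ht, le_rfl⟩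
  have : pastCrossings η (t + τ) (flow η t x) =
      (fun s => s - t) '' {s ∈ Ioc (-τ) t | flow η s x ∈ S} := by
    ext σ
    simp only [pastCrossings, mem_image]
    constructor
    · rintro ⟨hσ, hσS⟩
      have h1 : σ + t ∈ Ioc (-τ) t := ⟨by linarith [hσ.1], by linarith [hσ.2]⟩
      have h2 := flow_sub htD (hD (Ioc_subset_Icc_self h1))
      rw [add_sub_cancel_right] at h2
      exact ⟨σ + t, ⟨h1, by rwa [← h2.2]⟩, by ring⟩
    · rintro ⟨s, ⟨hs, hsS⟩, rfl⟩
      exact ⟨⟨by linarith [hs.1], by linarith [hs.2]⟩,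
        by rwa [(flow_sub htD (hD (Ioc_subset_Icc_self hs))).2]⟩
  rw [this, Function.Injective.encard_image sub_left_injective]

/-- The number of intersections with the cross section before `q` is locally constant. -/
lemma IsPastConnection.exists_eventually_encard_eq (h : IsPastConnection η r R a b q u T T₀)
    {k : ℕ} (hqS : q ∈ S) (hk : (pastCrossings η T₀ q).encard = k + 1)
    (htr : ∀ t ∈ Ioo (-T₀) 0, flow η t q ∈ S → flow η t q 2 ≠ 0) (hε : 0 < ε) (hεT : ε < T₀)
    (hεS : ∀ t ∈ Ico (-ε) 0, flow η t q ∉ S) :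
    ∃ ρ > 0, ρ < T₀ - ε ∧ ∀ᶠ y in 𝓝 q, ∀ τ ∈ Ioo (T₀ - ρ) (T₀ + ρ),
      {s ∈ Ioc (-τ) (-ε) | flow η s y ∈ S}.encard = k := by
  have hcont : ∀ t ≤ 0, ∀ i, ContinuousAt (fun p : E4 × ℝ => flow η p.2 p.1 i) (q, t) :=
    fun t ht i => continuousAt_flow_coord (h.subset_flowDomain ht) i
  have h0 := h.T₀_pos
  have hne : ∀ᶠ p : E4 × ℝ in 𝓝 (q, -T₀), flow η p.2 p.1 1 ≠ 0 :=
    (hcont (-T₀) (by linarith) 1).eventually_ne h.notMem_S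
  obtain ⟨V, hV, W, hW, hVW⟩ := mem_nhds_prod_iff.1 hne
  obtain ⟨ρ₁, hρ₁, hball⟩ := Metric.mem_nhds_iff.1 hW
  obtain ⟨ρ, hρ, hlt⟩ := exists_between (lt_min hρ₁ (sub_pos.2 hεT))
  have hρρ : ρ < ρ₁ := hlt.trans_le (min_le_left _ _)
  have hρε : ρ < T₀ - ε := hlt.trans_le (min_le_right _ _)
  -- No crossing occurs near the time of `Dᵘ`, so the count does not change when the left end point
  -- `-τ` is replaced by the fixed `-T₀ - ρ`.
  have hno : ∀ y ∈ V, ∀ t ∈ Icc (-T₀ - ρ) (-T₀ + ρ), flow η t y 1 ≠ 0 := fun y hy t ht =>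
    hVW (mk_mem_prod hy (hball (by
      rw [Metric.mem_ball, Real.dist_eq, abs_lt]; constructor <;> linarith [ht.1, ht.2])))
  have hqV := mem_of_mem_nhds hV
  have hset : pastCrossings η T₀ q =
      insert 0 {t ∈ Icc (-T₀ - ρ) (-ε) | flow η t q 1 = 0} := by
    ext t
    simp only [pastCrossings, mem_insert_iff]
    constructor
    · rintro ⟨ht, htS⟩
      rcases ht.2.eq_or_lt with h1 | h1
      · exact Or.inl h1
      · refine Or.inr ⟨⟨by linarith [ht.1], ?_⟩, htS⟩
        by_contra! h2
        exact hεS t ⟨h2.le, h1⟩ htS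
    · rintro (h1 | ⟨ht, htS⟩)
      · subst h1
        exact ⟨⟨by linarith, le_rfl⟩, by simpa using hqS⟩
      · refine ⟨⟨?_, by linarith [ht.2]⟩, htS⟩
        by_contra! h2
        exact hno q hqV t ⟨ht.1, by linarith⟩ htS
  have hcard : {t ∈ Icc (-T₀ - ρ) (-ε) | flow η t q 1 = 0}.encard = k := by
    rw [hset, encard_insert_of_notMem (fun hm => by linarith [hm.1.2])] at hk
    exact (WithTop.add_right_inj (by simp : (1 : ℕ∞) ≠ ⊤)).1 hk
  have hev := eventually_encard_zeros_eq (X := E4) (f := fun y t => flow η t y 1)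
    (f' := fun y t => flow η t y 2) (x₀ := q) (A := -T₀ - ρ) (B := -ε)
    (fun t ht => hcont t (by linarith [ht.2]) 1) (fun t ht => hcont t (by linarith [ht.2]) 2)
    (isCompact_Icc.eventually_forall_of_forall_eventually fun t ht =>
      (eventually_mem_flowDomain (h.subset_flowDomain (show t ≤ 0 by linarith [ht.2]))).mono
        fun p hp => hasDerivAt_flow_one hp)
    (hno q hqV _ ⟨le_rfl, by linarith⟩) (hεS _ ⟨le_rfl, by linarith⟩)
    (fun t ht htS => htr t ⟨by
      by_contra! h2
      exact hno q hqV t ⟨ht.1, by linarith⟩ htS, by linarith [ht.2]⟩ htS) hcard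
  refine ⟨ρ, hρ, hρε, ?_⟩
  filter_upwards [hev, hV] with y hy hyV τ hτ
  rw [← hy]
  congr 1
  ext t
  refine ⟨fun ht => ⟨⟨by linarith [ht.1.1, hτ.2], ht.1.2⟩, ht.2⟩,
    fun ht => ⟨⟨?_, ht.1.2⟩, ht.2⟩⟩
  by_contra! h2
  exact hno y hyV t ⟨ht.1.1, by linarith [hτ.1]⟩ ht.2

/-- Points near `q` with a given number of past intersections come from `Dᵘ` near the same point
as `q`. -/
lemma IsPastConnection.eventually_forall_mem_Ioo (h : IsPastConnection η r R a b q u T T₀)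
    (hη : -2 < η ∧ η < 2) (hloc : IsLocalUnstableGraph η a b) (hg : IsInvariantGraph η R a b)
    (hr : 0 < r) (hrR : r < R) (hqW : q ∈ Wu η) (hq0 : q ≠ 0) (n : ℕ) {ρ : ℝ} (hρ : 0 < ρ) :
    ∀ᶠ y in 𝓝 q, ∀ t > 0, -t ∈ flowDomain η y → flow η (-t) y ∈ Du r a b →
      (pastCrossings η t y).encard = n → t ∈ Ioo (T₀ - ρ) (T₀ + ρ) := by
  -- With `n + 1` crossings already in `(-L, 0)`, a count of `n` forces `t < L`. On the remaining
  -- compact set of times the orbit of `q` avoids the closed set `Dᵘ`, and so do nearby orbits.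
  obtain ⟨L, hL, -, hev⟩ := exists_eventually_le_encard hη hloc hg (hr.trans hrR).ne' hqW hq0 (n + 1)
  have hK : IsCompact (Icc (-L) 0 \ Ioo (-T₀ - ρ) (-T₀ + ρ)) := isCompact_Icc.diff isOpen_Ioo
  have hclosed : IsClosed (Du r a b) := (hg.isCompact_Du hr hrR.le).isClosed
  have hno : ∀ᶠ y in 𝓝 q, ∀ t ∈ Icc (-L) 0 \ Ioo (-T₀ - ρ) (-T₀ + ρ), flow η t y ∉ Du r a b := by
    refine hK.eventually_forall_of_forall_eventually fun t ht => ?_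
    refine (continuousAt_flow (h.subset_flowDomain ht.1.2)).eventually_mem
      (hclosed.isOpen_compl.mem_nhds fun hD => ht.2 ?_)
    rw [h.eq_of_mem_Du t ht.1.2 hD]
    constructor <;> linarith
  filter_upwards [hev, hno] with y hyL hy t ht htD htDu hcard
  have htL : t < L := by
    by_contra! hle
    have hsub : {s ∈ Ioo (-L) 0 | flow η s y ∈ S} ⊆ pastCrossings η t y := fun s hs =>
      ⟨⟨by linarith [hs.1.1], hs.1.2.le⟩, hs.2⟩
    have := hyL.2.trans (encard_le_encard hsub)
    rw [hcard] at this
    have : n + 1 ≤ n := by exact_mod_cast this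
    omega
  by_contra hnot
  refine hy (-t) ⟨⟨by linarith, by linarith⟩, fun hm => hnot ⟨by linarith [hm.2], by linarith [hm.1]⟩⟩
    htDu

/-- `U` is a small neighbourhood minus the compact image of the parameters outside `(-δ, δ)`;
injectivity of `l` keeps the inner arc intact. -/
lemma exists_isOpen_inter_eq_image {X : Type*} [TopologicalSpace X] [T2Space X] {l : ℝ → X}
    {δ₀ : ℝ} (hδ₀ : 0 < δ₀) (hl : ContinuousOn l (Icc (-δ₀) δ₀)) (hinj : InjOn l (Icc (-δ₀) δ₀))
    {A V : Set X} (hlA : l '' Icc (-δ₀) δ₀ ⊆ A) (hA : ∀ᶠ y in 𝓝 (l 0), y ∈ A → y ∈ l '' Icc (-δ₀) δ₀)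
    (hV : V ∈ 𝓝 (l 0)) :
    ∃ δ > 0, δ < δ₀ ∧ ∃ U ⊆ V, IsOpen U ∧ l 0 ∈ U ∧ A ∩ U = l '' Ioo (-δ) δ := by
  obtain ⟨W, hWV, hWo, h0W⟩ := mem_nhds_iff.1 (inter_mem hV hA)
  have hc : ContinuousAt l 0 := hl.continuousAt (Icc_mem_nhds (by linarith) hδ₀)
  obtain ⟨δ₁, hδ₁, hb⟩ := Metric.mem_nhds_iff.1 (hc.preimage_mem_nhds (hWo.mem_nhds h0W))
  obtain ⟨δ, hδ, hlt⟩ := exists_between (lt_min hδ₁ hδ₀)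
  have l1 : δ < δ₁ := hlt.trans_le (min_le_left _ _)
  have l2 : δ < δ₀ := hlt.trans_le (min_le_right _ _)
  have hK : IsCompact (l '' (Icc (-δ₀) δ₀ \ Ioo (-δ) δ)) :=
    (isCompact_Icc.diff isOpen_Ioo).image_of_continuousOn (hl.mono sdiff_subset)
  have hIs : Ioo (-δ) δ ⊆ Icc (-δ₀) δ₀ := fun s hs => ⟨by linarith [hs.1], by linarith [hs.2]⟩
  have hnot : ∀ s ∈ Ioo (-δ) δ, l s ∉ l '' (Icc (-δ₀) δ₀ \ Ioo (-δ) δ) := by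
    rintro s hs ⟨s', hs', e⟩
    rw [hinj hs'.1 (hIs hs) e] at hs'
    exact hs'.2 hs
  refine ⟨δ, hδ, l2, W \ l '' (Icc (-δ₀) δ₀ \ Ioo (-δ) δ),
    sdiff_subset.trans fun y hy => (hWV hy).1, hWo.sdiff hK.isClosed,
    ⟨h0W, hnot 0 ⟨by linarith, hδ⟩⟩, ?_⟩
  ext y
  constructor
  · rintro ⟨hyA, hyW, hyK⟩
    obtain ⟨s, hs, rfl⟩ := (hWV hyW).2 hyA
    refine ⟨s, ?_, rfl⟩
    by_contra hns
    exact hyK ⟨s, ⟨hs, hns⟩, rfl⟩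
  · rintro ⟨s, hs, rfl⟩
    refine ⟨hlA ⟨s, hIs hs, rfl⟩, hb ?_, hnot s hs⟩
    rw [Metric.mem_ball, Real.dist_eq, abs_lt]
    constructor <;> linarith [hs.1, hs.2]

lemma isOpenArcFrom_image_Ioo {l : ℝ → E4} {δ : ℝ} (hδ : 0 < δ) (hl : ContinuousOn l (Icc 0 δ))
    (hinj : InjOn l (Icc 0 δ)) : IsOpenArcFrom (l 0) (l '' Ioo 0 δ) := by
  have hm : MapsTo (fun x => δ * x) (Icc 0 1) (Icc 0 δ) := fun x hx =>
    ⟨mul_nonneg hδ.le hx.1, by nlinarith [hx.2]⟩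
  refine ⟨fun x => l (δ * x), hl.comp (by fun_prop) hm,
    fun x hx y hy e => mul_left_cancel₀ hδ.ne' (hinj (hm hx) (hm hy) e), by simp, ?_⟩
  rw [← image_image l (fun x => δ * x), image_mul_left_Ioo hδ, mul_zero, mul_one]

lemma isOpenArcFrom_image_Ioo_neg {l : ℝ → E4} {δ : ℝ} (hδ : 0 < δ)
    (hl : ContinuousOn l (Icc (-δ) 0)) (hinj : InjOn l (Icc (-δ) 0)) :
    IsOpenArcFrom (l 0) (l '' Ioo (-δ) 0) := by
  have hm : MapsTo (fun x : ℝ => -x) (Icc 0 δ) (Icc (-δ) 0) := fun x hx =>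
    ⟨by linarith [hx.2], by linarith [hx.1]⟩
  have := isOpenArcFrom_image_Ioo (l := fun x => l (-x)) hδ (hl.comp (by fun_prop) hm)
    fun x hx y hy e => neg_injective (hinj (hm hx) (hm hy) e)
  rw [← image_image l (fun x => -x)] at this
  simpa using this

end

end Bifocus

/-! ### Assembly: the two curves and the theorem. -/

namespace Bifocus

variable {η r R : ℝ} {x y q : E4} {s t τ T T₀ ε : ℝ} {a b : ℝ × ℝ → ℝ} {u ν : ℝ × ℝ}

/-- Near `q` the set `Σᵘ_k` is a curve `l` through `q`, and the Poincaré map takes `l` to a second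
curve `m` through `q`. -/
theorem IsPastConnection.exists_curves (h : IsPastConnection η r R a b q u T T₀)
    (hη : -2 < η ∧ η < 2) (hloc : IsLocalUnstableGraph η a b) (hg : IsInvariantGraph η R a b)
    (hr : 0 < r) (hrR : r < R) (hqW : q ∈ Wu η) {q₄ : ℝ} (hq : q = ![0, 0, 0, q₄]) (hq₄ : 0 < q₄)
    {k : ℕ} (hk : (pastCrossings η T₀ q).encard = k + 1)
    (htr : ∀ t ∈ Ioo (-T₀) 0, flow η t q ∈ S → flow η t q 2 ≠ 0)
    (hν : ν ≠ 0) (hcr : cross (u.2, a u) ν ≠ 0)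
    (hd0 : HasDerivAt (fun s => sectionCurve η T a b u ν s 0) 1 0)
    (hd2 : HasDerivAt (fun s => sectionCurve η T a b u ν s 2) 0 0) :
    ∃ δ > 0, ∃ l m : ℝ → E4, l 0 = q ∧ m 0 = q ∧
      ContinuousOn l (Icc (-δ) δ) ∧ ContinuousOn m (Icc (-δ) δ) ∧
      InjOn l (Icc (-δ) δ) ∧ InjOn m (Icc (-δ) δ) ∧
      l '' Icc (-δ) δ ⊆ SigmaU η r a b (k + 1) ∧
      (∀ᶠ y in 𝓝 q, y ∈ SigmaU η r a b (k + 1) → y ∈ l '' Icc (-δ) δ) ∧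
      ∀ s ∈ Icc (-δ) δ, s ≠ 0 → l s ∈ C η ∧ 0 < s * l s 0 ∧ l s 2 < 0 ∧
        m s ∈ C η ∧ 0 < s * m s 0 ∧ 0 < m s 2 ∧
        ∃ t, IsReturnTime η (l s) t ∧ flow η t (l s) = m s := by
  have h0 := h.T₀_pos
  have hq0 : q ≠ 0 := fun e => hq₄.ne' (by simpa [hq] using congrFun e 3)
  have hqS : q ∈ S := by simp [S, hq]
  have hsec0 := h.sectionCurve_zero ν
  obtain ⟨ρi, hρi, hinj⟩ := hg.exists_sectionCurve_injective
    (disc_subset_disc hr.le hrR.le h.sqNorm_u_lt.le) hν hcr h.mem_flowDomain_T.1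
  obtain ⟨ρe, hρe, hρeT, hex⟩ := h.exists_eq_flow_sectionCurve hg hr hrR hν hcr
  have hsec := h.eventually_continuousAt_sectionCurve hg hr hrR ν
  obtain ⟨ε, hε, hεlt, δ₁, hδ₁, lo, hi, hlo0, hhi0, hloc', hhic, hcross⟩ :=
    exists_two_crossings hq₄ (hsec0.trans hq) (hsec.mono fun s hs => hs.2.2.1)
      (hsec.mono fun s hs => hs.2.2.2) hd0 hd2 (lt_min hρi h0)
  have hερ : ε < ρi := hεlt.trans_le (min_le_left _ _)
  have hεT : ε < T₀ := hεlt.trans_le (min_le_right _ _)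
  have hεS : ∀ t ∈ Ico (-ε) 0, flow η t q ∉ S := fun t ht htS => by
    have := ((hcross 0 ⟨by linarith, hδ₁.le⟩).2.2.2.2.2.2.1 t
      ⟨ht.1, by linarith [ht.2]⟩).1 (by rwa [hsec0])
    rw [hlo0, hhi0, or_self] at this
    exact ht.2.ne this
  obtain ⟨ρc, hρc, hρcε, hcount⟩ := h.exists_eventually_encard_eq hqS hk htr hε hεT hεS
  -- The other half of `ρc` is reserved for the time shift between `y` and its point on the section
  -- curve.
  have hρ : 0 < min ρe (ρc / 2) := lt_min hρe (by positivity)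
  have hcomp := h.eventually_forall_mem_Ioo hη hloc hg hr hrR hqW hq0 (k + 1) hρ
  have hev := (h.eventually_exists_mem_Du hg hr hrR ν hρc).and
    (hsec.self_of_nhds.2.2.1.eventually (p := fun y => ∀ τ ∈ Ioo (T₀ - ρc) (T₀ + ρc),
      {s ∈ Ioc (-τ) (-ε) | flow η s y ∈ S}.encard = k) (by rwa [hsec0]))
  obtain ⟨δ₂, hδ₂, hb⟩ := Metric.eventually_nhds_iff.1 hev
  obtain ⟨δ, hδ, hδlt⟩ := exists_between (lt_min hδ₁ (lt_min hδ₂ hρi))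
  have l1 : δ < δ₁ := hδlt.trans_le (min_le_left _ _)
  have l2 : δ < δ₂ := hδlt.trans_le ((min_le_right _ _).trans (min_le_left _ _))
  have l3 : δ < ρi := hδlt.trans_le ((min_le_right _ _).trans (min_le_right _ _))
  have hIcc : Icc (-δ) δ ⊆ Icc (-δ₁) δ₁ := Icc_subset_Icc (by linarith) l1.le
  have hbs : ∀ s ∈ Icc (-δ) δ, dist s 0 < δ₂ := fun s hs => by
    rw [Real.dist_eq, sub_zero, abs_lt]; constructor <;> linarith [hs.1, hs.2]
  have hsρ : ∀ s ∈ Icc (-δ) δ, |s| < ρi := fun s hs => by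
    rw [abs_lt]; constructor <;> linarith [hs.1, hs.2]
  have hloI : ∀ s ∈ Icc (-δ) δ, lo s ∈ Icc (-ε) ε := fun s hs => by
    obtain ⟨-, -, -, i1, i2, i3, -⟩ := hcross s (hIcc hs)
    exact ⟨i1.le, i2.trans i3.le⟩
  have hhiI : ∀ s ∈ Icc (-δ) δ, hi s ∈ Icc (-ε) ε := fun s hs => by
    obtain ⟨-, -, -, i1, i2, i3, -⟩ := hcross s (hIcc hs)
    exact ⟨i1.le.trans i2, i3.le⟩
  have habs : ∀ t ∈ Icc (-ε) ε, |t| < ρi := fun t ht => (abs_le.2 ht).trans_lt hερ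
  have hdom : ∀ s ∈ Icc (-δ) δ, Icc (-ε) ε ⊆ flowDomain η (sectionCurve η T a b u ν s) :=
    fun s hs => (hcross s (hIcc hs)).2.2.1
  have hcontOn : ∀ f : ℝ → ℝ, ContinuousOn f (Icc (-δ₁) δ₁) → (∀ s ∈ Icc (-δ) δ, f s ∈ Icc (-ε) ε) →
      ContinuousOn (fun s => flow η (f s) (sectionCurve η T a b u ν s)) (Icc (-δ) δ) :=
    fun f hf hfI s hs => ContinuousAt.comp_continuousWithinAt
      (g := fun p : E4 × ℝ => flow η p.2 p.1) (f := fun s => (sectionCurve η T a b u ν s, f s))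
      (continuousAt_flow (hdom s hs (hfI s hs)))
      ((hcross s (hIcc hs)).1.continuousWithinAt.prodMk ((hf.mono hIcc) s hs))
  have hinjOn : ∀ f : ℝ → ℝ, (∀ s ∈ Icc (-δ) δ, f s ∈ Icc (-ε) ε) →
      InjOn (fun s => flow η (f s) (sectionCurve η T a b u ν s)) (Icc (-δ) δ) :=
    fun f hfI s hs s' hs' e => hinj s s' (f s) (f s') (hsρ s hs) (hsρ s' hs') (habs _ (hfI s hs))
      (habs _ (hfI s' hs')) (hdom s hs (hfI s hs)) (hdom s' hs' (hfI s' hs')) e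
  -- the set of crossings before the first crossing near `q`
  have hpast : ∀ s ∈ Icc (-δ) δ, ∀ τ > ε,
      {t ∈ Ioc (-τ) (lo s) | flow η t (sectionCurve η T a b u ν s) ∈ S} =
        insert (lo s) {t ∈ Ioc (-τ) (-ε) | flow η t (sectionCurve η T a b u ν s) ∈ S} ∧
      lo s ∉ {t ∈ Ioc (-τ) (-ε) | flow η t (sectionCurve η T a b u ν s) ∈ S} := by
    intro s hs τ hτ
    obtain ⟨-, -, -, i1, i2, i3, i4, -⟩ := hcross s (hIcc hs)
    refine ⟨?_, fun hm => by linarith [hm.1.2]⟩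
    ext t
    simp only [mem_insert_iff]
    constructor
    · rintro ⟨ht, htS⟩
      rcases le_or_gt t (-ε) with h1 | h1
      · exact Or.inr ⟨⟨ht.1, h1⟩, htS⟩
      · rcases (i4 t ⟨h1.le, by linarith [ht.2]⟩).1 htS with h2 | h2
        · exact Or.inl h2
        · exact Or.inl (le_antisymm ht.2 (i2.trans_eq h2.symm))
    · rintro (h1 | h1)
      · subst h1
        exact ⟨⟨by linarith, le_rfl⟩, (i4 _ (hloI s hs)).2 (Or.inl rfl)⟩
      · exact ⟨⟨h1.1.1, by linarith [h1.1.2]⟩, h1.2⟩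
  refine ⟨δ, hδ, fun s => flow η (lo s) (sectionCurve η T a b u ν s),
    fun s => flow η (hi s) (sectionCurve η T a b u ν s), by simp [hlo0, hsec0],
    by simp [hhi0, hsec0], hcontOn lo hloc' hloI, hcontOn hi hhic hhiI, hinjOn lo hloI,
    hinjOn hi hhiI, ?_, ?_, ?_⟩
  · rintro _ ⟨s, hs, rfl⟩
    obtain ⟨⟨τ, hτ, hτD, hτDu⟩, hZ⟩ := hb (hbs s hs)
    have hlos := hloI s hs
    have hτε : ε < τ := by linarith [hτ.1]
    have hD : Icc (-τ) (lo s) ⊆ flowDomain η (sectionCurve η T a b u ν s) := fun t ht => by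
      rcases le_total t 0 with h1 | h1
      · exact flowDomain_subset hτD (by rw [uIcc_of_ge (by linarith)]; exact ⟨ht.1, h1⟩)
      · exact hdom s hs ⟨by linarith, ht.2.trans hlos.2⟩
    have hb' := flow_sub (hdom s hs hlos) hτD
    rw [show -τ - lo s = -(lo s + τ) by ring] at hb'
    refine mem_SigmaU_succ_iff.2 ⟨lo s + τ, by linarith [hlos.1], hb'.1, by rwa [hb'.2],
      ((hcross s (hIcc hs)).2.2.2.2.2.2.1 _ hlos).2 (Or.inl rfl), ?_⟩
    -- There are `k` crossings before time `-ε`, and `lo s` is the next one.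
    rw [encard_pastCrossings_flow hD (by linarith [hlos.1]), (hpast s hs τ hτε).1,
      encard_insert_of_notMem (hpast s hs τ hτε).2, hZ τ hτ]
  · filter_upwards [hcomp, hex (min ε (ρc / 2)) (lt_min hε (by positivity)) δ hδ] with y hy1 hy2 hyk
    obtain ⟨t, ht, htD, htDu, hyS, hcard⟩ := mem_SigmaU_succ_iff.1 hyk
    have htI := hy1 t ht htD htDu hcard
    obtain ⟨s, t', hsδ, ht', htD', rfl⟩ := hy2 t
      ⟨by linarith [htI.1, min_le_left ρe (ρc / 2)], by linarith [htI.2, min_le_left ρe (ρc / 2)]⟩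
      htDu
    have hs : s ∈ Icc (-δ) δ := abs_le.1 hsδ.le
    have ht'ε := abs_lt.1 (ht'.trans_le (min_le_left _ _))
    have ht'ρ := abs_lt.1 (ht'.trans_le (min_le_right _ _))
    have hmr := min_le_right ρe (ρc / 2)
    obtain ⟨-, -, -, i1, i2, i3, i4, i5⟩ := hcross s (hIcc hs)
    rcases (i4 t' ⟨ht'ε.1.le, ht'ε.2.le⟩).1 hyS with e | e
    · exact ⟨s, hs, by rw [e]⟩
    rcases eq_or_ne s 0 with hs0 | hs0
    · exact ⟨s, hs, by simp only [e, hs0, hlo0, hhi0]⟩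
    -- An upward crossing distinct from the downward one would have at least `k + 2` past crossings:
    -- the `k` early ones, `lo s` and itself.
    exfalso
    have hlt := (i5 hs0).1
    have hτ : t - t' ∈ Ioo (T₀ - ρc) (T₀ + ρc) :=
      ⟨by linarith [htI.1], by linarith [htI.2]⟩
    have hτε : ε < t - t' := by linarith [hτ.1]
    have hτD := (flow_add htD' htD).1
    rw [show t' + -t = -(t - t') by ring] at hτD
    have hD : Icc (-(t - t')) t' ⊆ flowDomain η (sectionCurve η T a b u ν s) := fun σ hσ => by
      rcases le_total σ 0 with h1 | h1
      · exact flowDomain_subset hτD (by rw [uIcc_of_ge (by linarith)]; exact ⟨hσ.1, h1⟩)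
      · exact hdom s hs ⟨by linarith, by linarith [hσ.2]⟩
    have hc := encard_pastCrossings_flow hD (by linarith)
    rw [show t' + (t - t') = t by ring, hcard] at hc
    have hsub : insert t' {σ ∈ Ioc (-(t - t')) (lo s) |
        flow η σ (sectionCurve η T a b u ν s) ∈ S} ⊆
        {σ ∈ Ioc (-(t - t')) t' | flow η σ (sectionCurve η T a b u ν s) ∈ S} := by
      rintro σ (h1 | h1)
      · subst h1
        exact ⟨⟨by linarith, le_rfl⟩, hyS⟩
      · exact ⟨⟨h1.1.1, by linarith [h1.1.2]⟩, h1.2⟩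
    have hle := encard_le_encard hsub
    rw [← hc, encard_insert_of_notMem (fun hm => by linarith [hm.1.2]), (hpast s hs _ hτε).1,
      encard_insert_of_notMem (hpast s hs _ hτε).2, (hb (hbs s hs)).2 _ hτ] at hle
    have : k + 1 + 1 ≤ k + 1 := by exact_mod_cast hle
    omega
  · intro s hs hs0
    obtain ⟨-, hH, -, -, -, -, i4, i5⟩ := hcross s (hIcc hs)
    obtain ⟨j1, j2, j3, j4, j5⟩ := i5 hs0
    have hlD := hdom s hs (hloI s hs)
    have hhD := hdom s hs (hhiI s hs)
    have hmS := (i4 _ (hhiI s hs)).2 (Or.inr rfl)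
    have hsub := flow_sub hlD hhD
    refine ⟨⟨(i4 _ (hloI s hs)).2 (Or.inl rfl), (H_flow hlD).trans hH⟩, j2, j4,
      ⟨hmS, (H_flow hhD).trans hH⟩, j3, j5, hi s - lo s,
      ⟨sub_pos.2 j1, hsub.1, by rwa [hsub.2], fun σ hσ hσS => ?_⟩, hsub.2⟩
    have hσI : lo s + σ ∈ Icc (-ε) ε :=
      ⟨by linarith [(hloI s hs).1, hσ.1], by linarith [(hhiI s hs).2, hσ.2]⟩
    rw [(flow_add_of_mem hlD (hdom s hs hσI)).2] at hσS
    rcases (i4 _ hσI).1 hσS with e | e <;> linarith [hσ.1, hσ.2]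

/-- On the zero level of `H`, the flow is tangent to the cross section only along `v₁` and `v₂`. -/
lemma mem_v₁_union_v₂ (hH : H η x = 0) (hS : x ∈ S) (h2 : x 2 = 0) : x ∈ v₁ ∪ v₂ := by
  have h1 : x 1 = 0 := hS
  have : x 0 ^ 2 * (3 / 2 - x 0) = 0 := by
    rw [H, h1, h2] at hH
    linear_combination 3 * hH
  rcases mul_eq_zero.1 this with h0 | h0
  · exact Or.inl ⟨h1, pow_eq_zero_iff (two_ne_zero) |>.1 h0, h2⟩
  · exact Or.inr ⟨h1, by linarith, h2⟩

end Bifocus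

open Bifocus in
theorem mainTheorem3 (η r : ℝ) (hη : -2 < η ∧ η < 2) (a b : ℝ × ℝ → ℝ)
    (hset : Bifocus.IsSetting η r a b)
    (k : ℕ) (hk : 1 ≤ k) (q : Bifocus.E4) (q₄ : ℝ)
    (hq : q = ![0, 0, 0, q₄]) (hq₄ : 0 < q₄)
    (hqk : q ∈ Bifocus.SigmaU η r a b k ∩ Bifocus.v₁)
    (htrans : Bifocus.TransverseToV₁At η r a b q)
    (honce : ∃! p, p ∈ Bifocus.orbit η q ∩ Bifocus.Du r a b)
    (hearlier : ∀ p ∈ Bifocus.Du r a b, ∀ T > 0, T ∈ Bifocus.flowDomain η p →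
      Bifocus.flow η T p = q →
        ∀ t ∈ Ioo 0 T, Bifocus.flow η t p ∉ Bifocus.v₁ ∪ Bifocus.v₂) :
    ∀ V ∈ 𝓝 q, ∃ U ⊆ V, IsOpen U ∧ q ∈ U ∧
      ∃ A₁ A₂ A₃ A₄ : Set Bifocus.E4,
        (Bifocus.SigmaU η r a b k ∩ U) \ {q} = A₃ ∪ A₄ ∧
        A₃ ⊆ Bifocus.C₃ η ∧ A₄ ⊆ Bifocus.C₄ η ∧
        Bifocus.IsOpenArcFrom q A₃ ∧ Bifocus.IsOpenArcFrom q A₄ ∧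
        A₁ ⊆ Bifocus.SigmaU η r a b (k + 1) ∩ Bifocus.C₁ η ∧
        A₂ ⊆ Bifocus.SigmaU η r a b (k + 1) ∩ Bifocus.C₂ η ∧
        Bifocus.IsOpenArcFrom q A₁ ∧ Bifocus.IsOpenArcFrom q A₂ ∧
        (∀ x ∈ A₃ ∪ A₄, Bifocus.PoincareDefined η x) ∧
        A₁ = Bifocus.poincareImage η A₄ ∧ A₂ = Bifocus.poincareImage η A₃ := by
  obtain ⟨k, rfl⟩ : ∃ n, k = n + 1 := ⟨k - 1, by omega⟩
  obtain ⟨R, hrR, hg⟩ := hset.exists_isInvariantGraph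
  have hr := hset.r_pos
  have hq0 : q ≠ 0 := fun e => hq₄.ne' (by simpa [hq] using congrFun e 3)
  have hpr : pr q = 0 := by simp [pr, hq]
  obtain ⟨T₀, hT₀, hT₀D, hT₀Du, -, hcard⟩ := mem_SigmaU_succ_iff.1 hqk.1
  have hback := flow_neg hT₀D
  rw [neg_neg] at hback
  have hqW : q ∈ Wu η := by
    have := flow_mem_Wu (hset.Du_subset hT₀Du) hback.1
    rwa [hback.2] at this
  have hdom := (mem_Wu_iff.1 hqW).1
  -- Hypothesis 2 concerns points; since the orbit is not periodic, it determines the time as well.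
  have honce' : ∀ t ≤ 0, flow η t q ∈ Du r a b → t = -T₀ := fun t ht htDu =>
    flow_injOn_of_mem_Wu hqW hq0 (hdom ht) hT₀D
      (honce.unique ⟨⟨t, hdom ht, rfl⟩, htDu⟩ ⟨⟨-T₀, hT₀D, rfl⟩, hT₀Du⟩)
  obtain ⟨T, hT, u, hu, hTD, hTq, htr⟩ := htrans
  have hTu : flow η (-T) q = graphPt a b u := by
    have := (flow_neg hTD).2
    rwa [hTq] at this
  have h := hg.isPastConnection hr hrR hdom hq0 hpr hT₀ hT₀Du honce' hT hu hTu
  obtain ⟨ν, hν, hcr, hd0, hd2⟩ := hg.exists_transverse_direction hq₄.ne'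
    (h.sqNorm_u_lt.trans (by gcongr)) hTD (hTq.trans hq) (by rw [htr, hq])
  have htan : ∀ t ∈ Ioo (-T₀) 0, flow η t q ∈ S → flow η t q 2 ≠ 0 := fun t ht htS h2 => by
    have htD : t ∈ flowDomain η q := hdom ht.2.le
    have hsub := (flow_sub hT₀D htD).2
    refine hearlier _ hT₀Du T₀ hT₀ hback.1 hback.2 (t - -T₀)
      ⟨by linarith [ht.1], by linarith [ht.2]⟩ ?_
    rw [hsub]
    exact mem_v₁_union_v₂ ((H_flow htD).trans (H_eq_zero_of_mem_Wu hqW)) htS h2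
  obtain ⟨δ₀, hδ₀, l, m, hl0, hm0, hlc, hmc, hli, hmi, hlk, hkl, hlm⟩ :=
    h.exists_curves hη hset.local_unstable hg hr hrR hqW hq hq₄ hcard htan hν hcr hd0 hd2
  intro V hV
  rw [← hl0] at hV hkl
  obtain ⟨δ, hδ, hδδ, U, hUV, hUo, h0U, hU⟩ :=
    exists_isOpen_inter_eq_image hδ₀ hlc hli hlk hkl hV
  have hsub₁ : Icc 0 δ ⊆ Icc (-δ₀) δ₀ := Icc_subset_Icc (by linarith) hδδ.le
  have hsub₂ : Icc (-δ) 0 ⊆ Icc (-δ₀) δ₀ := Icc_subset_Icc (by linarith) hδ₀.le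
  have hpos : ∀ s ∈ Ioo 0 δ, s ∈ Icc (-δ₀) δ₀ ∧ s ≠ 0 := fun s hs =>
    ⟨hsub₁ (Ioo_subset_Icc_self hs), hs.1.ne'⟩
  have hneg : ∀ s ∈ Ioo (-δ) 0, s ∈ Icc (-δ₀) δ₀ ∧ s ≠ 0 := fun s hs =>
    ⟨hsub₂ (Ioo_subset_Icc_self hs), hs.2.ne⟩
  have himage : ∀ I : Set ℝ, (∀ s ∈ I, s ∈ Icc (-δ₀) δ₀ ∧ s ≠ 0) →
      m '' I = poincareImage η (l '' I) := by
    intro I hI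
    ext y
    constructor
    · rintro ⟨s, hs, rfl⟩
      obtain ⟨t, ht, hty⟩ := (hlm s (hI s hs).1 (hI s hs).2).2.2.2.2.2.2
      exact ⟨l s, ⟨s, hs, rfl⟩, t, ht, hty⟩
    · rintro ⟨_, ⟨s, hs, rfl⟩, t, ht, rfl⟩
      obtain ⟨t', ht', hty⟩ := (hlm s (hI s hs).1 (hI s hs).2).2.2.2.2.2.2
      exact ⟨s, hs, by rw [ht.unique ht', hty]⟩
  have hmk : ∀ I : Set ℝ, (∀ s ∈ I, s ∈ Icc (-δ₀) δ₀ ∧ s ≠ 0) →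
      m '' I ⊆ SigmaU η r a b (k + 1 + 1) := fun I hI => by
    rw [himage I hI]
    exact poincareImage_subset_SigmaU_succ
      ((image_mono fun s hs => (hI s hs).1).trans hlk)
  -- Since `x₁` has the sign of `s` on both curves, negative parameters give `A₁` and `A₄`, positive
  -- ones `A₂` and `A₃`.
  refine ⟨U, hUV, hUo, hl0 ▸ h0U, m '' Ioo (-δ) 0, m '' Ioo 0 δ, l '' Ioo 0 δ, l '' Ioo (-δ) 0,
    ?_, ?_, ?_, ?_, ?_, subset_inter (hmk _ hneg) ?_, subset_inter (hmk _ hpos) ?_, ?_, ?_, ?_,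
    himage _ hneg, himage _ hpos⟩
  · rw [hU, ← image_union]
    ext y
    constructor
    · rintro ⟨⟨s, hs, rfl⟩, hne⟩
      refine ⟨s, ?_, rfl⟩
      rcases lt_trichotomy s 0 with h1 | h1 | h1
      · exact Or.inr ⟨hs.1, h1⟩
      · exact absurd (by rw [h1, hl0]; rfl) hne
      · exact Or.inl ⟨h1, hs.2⟩
    · rintro ⟨s, hs, rfl⟩
      have hs' : s ∈ Icc (-δ₀) δ₀ ∧ s ≠ 0 := hs.elim (hpos s) (hneg s)
      refine ⟨⟨s, ?_, rfl⟩, fun e => hs'.2 (hli hs'.1 ⟨by linarith, hδ₀.le⟩ (e.trans hl0.symm))⟩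
      rcases hs with hs | hs
      · exact ⟨by linarith [hs.1], hs.2⟩
      · exact ⟨hs.1, by linarith [hs.2]⟩
  · rintro _ ⟨s, hs, rfl⟩
    obtain ⟨h1, h2, h3, -⟩ := hlm s (hpos s hs).1 (hpos s hs).2
    exact ⟨h1, (pos_iff_pos_of_mul_pos h2).1 hs.1, h3⟩
  · rintro _ ⟨s, hs, rfl⟩
    obtain ⟨h1, h2, h3, -⟩ := hlm s (hneg s hs).1 (hneg s hs).2
    exact ⟨h1, (neg_iff_neg_of_mul_pos h2).1 hs.2, h3⟩
  · exact hl0 ▸ isOpenArcFrom_image_Ioo hδ (hlc.mono hsub₁) (hli.mono hsub₁)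
  · exact hl0 ▸ isOpenArcFrom_image_Ioo_neg hδ (hlc.mono hsub₂) (hli.mono hsub₂)
  · rintro _ ⟨s, hs, rfl⟩
    obtain ⟨-, -, -, h1, h2, h3, -⟩ := hlm s (hneg s hs).1 (hneg s hs).2
    exact ⟨h1, (neg_iff_neg_of_mul_pos h2).1 hs.2, h3⟩
  · rintro _ ⟨s, hs, rfl⟩
    obtain ⟨-, -, -, h1, h2, h3, -⟩ := hlm s (hpos s hs).1 (hpos s hs).2
    exact ⟨h1, (pos_iff_pos_of_mul_pos h2).1 hs.1, h3⟩
  · exact hm0 ▸ isOpenArcFrom_image_Ioo_neg hδ (hmc.mono hsub₂) (hmi.mono hsub₂)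
  · exact hm0 ▸ isOpenArcFrom_image_Ioo hδ (hmc.mono hsub₁) (hmi.mono hsub₁)
  · rw [← image_union]
    rintro _ ⟨s, hs, rfl⟩
    have hs' : s ∈ Icc (-δ₀) δ₀ ∧ s ≠ 0 := hs.elim (hpos s) (hneg s)
    exact (hlm s hs'.1 hs'.2).2.2.2.2.2.2.imp fun t ht => ht.1
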